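/- **Setting.** Let $k$ be a field and $R$ an associative $k$-algebra. A *complete local $k$-algebra* is a (not necessarily commutative) local $k$-algebra $A$ with Jacobson radical $\mathfrak m_A$ such that $k\cong A/\mathfrak m_A$, $\dim_k \mathfrak m_A/\mathfrak m_A^2<\infty$ and $A\cong\varprojlim A/\mathfrak m_A^n$. For a left $R$-module $M$ put $M\widehat\otimes_k A=\varprojlim M\otimes_k A/\mathfrak m_A^n$. Let $\mathbb F=(F,d)$ be a chain complex of projective left $R$-modules indexed by $\mathbb Z$, and let $\mathrm{Ext}^i_R(\mathbb F,\mathbb F)$ be the $k$-space of homotopy classes of chain homomorphisms $\mathbb F\to\mathbb F$ of degree $-i$. A *lift* of $\mathbb F$ to $A$ is a complex $(F\widehat\otimes_kA,\Delta)$ with $\Delta$ homogeneous of degree $-1$, left $R$-linear and right $A$-linear, $\Delta^2=0$ and $\Delta\otimes_A k=d$. **Small extensions.** A small extension $(E,\epsilon)$ of a complete local $k$-algebra $P$ is a complete local $k$-algebra $E$ with an element $\epsilon\neq0$ such that $\mathfrak m_E\epsilon=\epsilon\mathfrak m_E=0$, together with a surjective $k$-algebra map $\pi:E\to P$ with kernel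 $(\epsilon)=k\epsilon$. Two are equivalent if there is a $k$-algebra isomorphism compatible with the projections to $P$ and with the elements $\epsilon$. The set $\mathcal T(P)$ of equivalence classes is a $k$-vector space with $[E_1,\epsilon_1]+[E_2,\epsilon_2]=[E_1\times_PE_2/(\epsilon_1,-\epsilon_2),(\epsilon_1,0)]$, zero the class of the trivial extension, and $c\cdot[E,\epsilon]=[E,c^{-1}\epsilon]$ for $c\ne0$, $0\cdot[E,\epsilon]=0$. **Universal and maximal lifts.** A lift $\mathbb L_0=(F\widehat\otimes_kP_0,\Delta_0)$ of $\mathbb F$ to a complete local $k$-algebra $P_0$ is *universal* if for every artinian local $k$-algebra $A$ with residue field $k$ the map $f\mapsto\mathbb L_0\otimes_{P_0}{}_fA$ is a bijection from $\mathrm{Hom}_{k\text{-alg}}(P_0,A)$ to the set of isomorphism classes of lifts of $\mathbb F$ to $A$. It is *maximal* if, whenever $q:Q\to P_0$ is a surjection of complete local $k$-algebras with $\ker q\subseteq\mathfrak m_Q^2$ and $\mathbb L_0$ lifts to $Q$ along $q$ (i.e. there is a lift $(F\widehat\otimes_k Q,\Delta)$ of $\mathbb F$ with $\Delta\otimes_QP_0=\Delta_0$),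 the map $q$ is an isomorphism. **Theorem.** Let $\mathbb L_0=(F\widehat\otimes_kP_0,\Delta_0)$ be a lift of $\mathbb F$ to a complete local $k$-algebra $P_0$ which is universal or maximal. Then for each small extension $(E,\epsilon)$ of $P_0$, $\Delta_0$ lifts to a graded bimodule homomorphism $\Delta'$ of degree $-1$ on $F\widehat\otimes_kE$; for every such $\Delta'$ there is a chain homomorphism $\sigma:\mathbb F\to\mathbb F$ of degree $-2$ with $\Delta'^2=\sigma\otimes\epsilon$; the class $[\sigma]\in \mathrm{Ext}^2_R(\mathbb F,\mathbb F)$ depends only on $[E,\epsilon]$; and the resulting obstruction map $$\alpha_{\mathbb L_0}:\mathcal T(P_0)\to\mathrm{Ext}^2_R(\mathbb F,\mathbb F),\qquad [E,\epsilon]\mapsto[\sigma],$$ is $k$-linear and injective. -/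

import Mathlib

open scoped TensorProduct ModuleCat
universe u v w
namespace ComplexLift

/-- The Jacobson radical `𝔪_A`. -/
abbrev rad (A : Type*) [Ring A] : Ideal A := Ring.jacobson A

/-- Complete local `k`-algebras (not necessarily commutative): local `k`-algebras `A` with
`k ≅ A / 𝔪_A`, `dim_k 𝔪_A / 𝔪_A² < ∞`, and `A ≅ lim A / 𝔪_Aⁿ`. -/
class IsCompleteLocal (k A : Type*) [Field k] [Ring A] [Algebra k A] : Prop where
  isLocalRing : IsLocalRing A
  residue_bijective : Function.Bijective (algebraMap k (A ⧸ rad A))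
  finite_cotangent : Module.Finite k (rad A ⧸ (rad A ^ 2).submoduleOf (rad A))
  separated : ∀ x : A, (∀ n : ℕ, x ∈ rad A ^ n) → x = 0
  complete : ∀ s : ℕ → A, (∀ n, s (n + 1) - s n ∈ rad A ^ n) → ∃ x, ∀ n, x - s n ∈ rad A ^ n

section Residue

variable (k : Type*) {A : Type*} [Field k] [Ring A] [Algebra k A]

/-- The residue map `A → A / 𝔪_A ≅ k`. -/
noncomputable def residue (A : Type*) [Ring A] [Algebra k A] [IsCompleteLocal k A] : A →ₐ[k] k :=
  ((AlgEquiv.ofBijective (Algebra.ofId k (A ⧸ rad A))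
    IsCompleteLocal.residue_bijective).symm : (A ⧸ rad A) →ₐ[k] k).comp
      (Ideal.Quotient.mkₐ k (rad A))

theorem mem_rad_iff [IsCompleteLocal k A] (x : A) : x ∈ rad A ↔ residue k A x = 0 := by
  simp [residue, Ideal.Quotient.eq_zero_iff_mem]

theorem sub_residue_mem [IsCompleteLocal k A] (x : A) :
    x - algebraMap k A (residue k A x) ∈ rad A := by
  simp [mem_rad_iff k]

theorem rad_eq_ker (χ : A →ₐ[k] k) (h : ∀ x, χ x = 0 → IsUnit (1 + x)) :
    rad A = RingHom.ker χ := by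
  have hs : Function.Surjective χ := fun c => ⟨algebraMap k A c, by simp⟩
  apply le_antisymm
  · have : (RingHom.ker χ).IsMaximal := RingHom.ker_isMaximal_of_surjective χ hs
    exact Ring.jacobson_le_of_isMaximal _
  · intro x hx
    have : x ∈ (⊥ : Ideal A).jacobson := by
      rw [Ideal.mem_jacobson_iff]
      intro y
      obtain ⟨u, hu⟩ := h (y * x) (by rw [map_mul, (RingHom.mem_ker).1 hx, mul_zero])
      refine ⟨↑u⁻¹, ?_⟩
      have : (↑u⁻¹ : A) * (1 + y * x) = 1 := by rw [← hu]; simp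
      rw [Ideal.mem_bot, sub_eq_zero, ← this]
      noncomm_ring
    rwa [Ideal.jacobson_bot] at this

theorem isLocalRing_of_character (χ : A →ₐ[k] k) (h : ∀ x, χ x = 0 → IsUnit (1 + x)) :
    IsLocalRing A := by
  have hu : ∀ x, χ x ≠ 0 → IsUnit x := by
    intro x hx
    have h1 : IsUnit (1 + (algebraMap k A (χ x)⁻¹ * x - 1)) := h _ (by simp [hx])
    have h2 : IsUnit (algebraMap k A (χ x)⁻¹) :=
      (IsUnit.mk0 _ (inv_ne_zero hx)).map (algebraMap k A)
    rw [add_sub_cancel] at h1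
    obtain ⟨a, ha⟩ := h2
    obtain ⟨b, hb⟩ := h1
    refine ⟨a⁻¹ * b, ?_⟩
    rw [Units.val_mul, hb, ← ha]
    simp
  have : Nontrivial A := χ.toRingHom.domain_nontrivial
  refine IsLocalRing.of_isUnit_or_isUnit_one_sub_self fun a => ?_
  by_cases ha : χ a = 0
  · right
    exact hu _ (by simp [ha])
  · exact Or.inl (hu _ ha)

theorem residue_bijective_of_character (χ : A →ₐ[k] k) (h : rad A = RingHom.ker χ) :
    Function.Bijective (algebraMap k (A ⧸ rad A)) := by
  constructor
  · intro a b hab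
    have h1 : (Ideal.Quotient.mk (rad A)) (algebraMap k A a) =
      (Ideal.Quotient.mk (rad A)) (algebraMap k A b) := hab
    rw [Ideal.Quotient.eq, h, RingHom.mem_ker] at h1
    simpa [sub_eq_zero] using h1
  · intro y
    obtain ⟨x, rfl⟩ := Ideal.Quotient.mk_surjective y
    refine ⟨χ x, ?_⟩
    change (Ideal.Quotient.mk (rad A)) (algebraMap k A (χ x)) = _
    rw [Ideal.Quotient.eq, h, RingHom.mem_ker]
    simp

theorem isUnit_one_add [IsCompleteLocal k A] {x : A} (hx : x ∈ rad A) : IsUnit (1 + x) := by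
  have := (IsCompleteLocal.isLocalRing k : IsLocalRing A)
  have h : IsUnit (1 + x + -x) := by simp
  rcases IsLocalRing.isUnit_or_isUnit_of_isUnit_add h with h | h
  · exact h
  · exfalso
    have h1 := (h.map (residue k A)).ne_zero
    rw [map_neg, (mem_rad_iff k x).1 hx, neg_zero] at h1
    exact h1 rfl

theorem finite_cotangent_iff : Module.Finite k (rad A ⧸ (rad A ^ 2).submoduleOf (rad A)) ↔
    ∃ V : Submodule k A, V.FG ∧ ∀ x ∈ rad A, ∃ v ∈ V, x - v ∈ rad A ^ 2 := by
  constructor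
  · intro h
    obtain ⟨s, hs⟩ := h.fg_top
    choose f hf using Submodule.Quotient.mk_surjective ((rad A ^ 2).submoduleOf (rad A))
    classical
    refine ⟨Submodule.span k (s.image fun y => (f y : A)), ⟨_, rfl⟩, fun x hx => ?_⟩
    have key : ∀ y ∈ Submodule.span k (s : Set (rad A ⧸ (rad A ^ 2).submoduleOf (rad A))),
        ∀ x : rad A, Submodule.Quotient.mk x = y →
        ∃ v ∈ Submodule.span k ((s.image fun y => (f y : A) : Finset A) : Set A),
          (x : A) - v ∈ rad A ^ 2 := by
      intro y hy
      induction hy using Submodule.span_induction with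
      | mem y hy =>
        intro x hx
        refine ⟨f y, Submodule.subset_span (Finset.mem_image_of_mem _ hy), ?_⟩
        rw [← hf y, Submodule.Quotient.eq] at hx
        exact hx
      | zero =>
        intro x hx
        refine ⟨0, zero_mem _, ?_⟩
        rw [Submodule.Quotient.mk_eq_zero] at hx
        have h3 : (x : A) ∈ rad A ^ 2 := hx
        simpa using h3
      | add y z _ _ hy hz =>
        intro x hx
        obtain ⟨v, hv, hv'⟩ := hy (f y) (hf y)
        obtain ⟨w, hw, hw'⟩ := hz (f z) (hf z)
        refine ⟨v + w, add_mem hv hw, ?_⟩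
        rw [← hf y, ← hf z, ← Submodule.Quotient.mk_add, Submodule.Quotient.eq] at hx
        have h3 : (x : A) - (f y + f z) ∈ rad A ^ 2 := hx
        have := add_mem h3 (add_mem hv' hw')
        convert! this using 1
        abel
      | smul c y _ hy =>
        intro x hx
        obtain ⟨v, hv, hv'⟩ := hy (f y) (hf y)
        refine ⟨c • v, Submodule.smul_mem _ _ hv, ?_⟩
        rw [← hf y, ← Submodule.Quotient.mk_smul, Submodule.Quotient.eq] at hx
        have h3 : (x : A) - c • (f y : A) ∈ rad A ^ 2 := hx
        have h4 : c • ((f y : A) - v) ∈ rad A ^ 2 := by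
          rw [Algebra.smul_def]; exact Ideal.mul_mem_left _ _ hv'
        have := add_mem h3 h4
        convert! this using 1
        rw [smul_sub]; abel
    exact key _ (hs ▸ Submodule.mem_top) ⟨x, hx⟩ rfl
  · rintro ⟨V, hV, h⟩
    have hle : (rad A ^ 2) ≤ rad A := Ideal.pow_le_self two_ne_zero
    let W : Submodule k V := (V ⊓ (rad A).restrictScalars k).submoduleOf V
    have : Module.Finite k V := Module.Finite.iff_fg.2 hV
    let g : W →ₗ[k] (rad A ⧸ (rad A ^ 2).submoduleOf (rad A)) :=
      { toFun := fun x => Submodule.Quotient.mk ⟨x.1.1, x.2.2⟩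
        map_add' := fun _ _ => rfl
        map_smul' := fun _ _ => rfl }
    refine Module.Finite.of_surjective g fun y => ?_
    obtain ⟨x, rfl⟩ := Submodule.Quotient.mk_surjective _ y
    obtain ⟨v, hv, hv'⟩ := h x x.2
    have hvr : v ∈ rad A := by
      have := sub_mem x.2 (hle hv')
      simpa using this
    refine ⟨⟨⟨v, hv⟩, hv, hvr⟩, ?_⟩
    refine ((Submodule.Quotient.eq _).2 ?_).symm
    exact hv'

theorem residue_unique [IsCompleteLocal k A] (χ : A →ₐ[k] k) (x : A) : χ x = residue k A x := by
  have h : ∀ y ∈ rad A, χ y = 0 := by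
    intro y hy
    by_contra hne
    have h1 : IsUnit (1 + (algebraMap k A (-(χ y)⁻¹) * y)) :=
      isUnit_one_add k (Ideal.mul_mem_left _ _ hy)
    have h2 := (h1.map χ).ne_zero
    simp [hne] at h2
  have := h _ (sub_residue_mem k x)
  simpa [sub_eq_zero] using this

theorem residue_map {B : Type*} [Ring B] [Algebra k B] [IsCompleteLocal k A] [IsCompleteLocal k B]
    (f : A →ₐ[k] B) (x : A) : residue k B (f x) = residue k A x :=
  residue_unique k ((residue k B).comp f) x

/-- Homomorphisms of complete local algebras are local. -/
theorem map_mem_rad_pow {B : Type*} [Ring B] [Algebra k B] [IsCompleteLocal k A]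
    [IsCompleteLocal k B] (f : A →ₐ[k] B) (n : ℕ) {x : A} (hx : x ∈ rad A ^ n) :
    f x ∈ rad B ^ n := by
  induction n generalizing x with
  | zero => simp [Submodule.pow_zero]
  | succ n ih =>
    rw [Submodule.pow_succ] at hx
    induction hx using Submodule.mul_induction_on' with
    | mem_mul_mem a ha b hb =>
      rw [Submodule.pow_succ, map_mul]
      refine Ideal.mul_mem_mul (ih ha) ?_
      rw [mem_rad_iff k, residue_map, ← mem_rad_iff k]
      exact hb
    | add a _ b _ ha hb => rw [map_add]; exact add_mem ha hb

end Residue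

section Extension

variable {k : Type*} {E P : Type*} [Field k] [Ring E] [Algebra k E] [Ring P] [Algebra k P]
  [IsCompleteLocal k P]

theorem rad_of_square_zero (π : E →ₐ[k] P) (hπ : Function.Surjective π) (ε : E)
    (hk : ∀ x, π x = 0 → ∃ c : k, x = c • ε)
    (hs : ∀ x : E, residue k P (π x) = 0 → x * ε = 0 ∧ ε * x = 0)
    (h0 : π ε = 0) :
    (∀ x : E, residue k P (π x) = 0 → IsUnit (1 + x)) := by
  have hee : ε * ε = 0 := (hs ε (by simp [h0])).1
  have h1 : ∀ x, π x = 0 → IsUnit (1 + x) := by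
    intro x hx
    obtain ⟨c, rfl⟩ := hk x hx
    refine ⟨⟨1 + c • ε, 1 - c • ε, ?_, ?_⟩, rfl⟩ <;>
    simp [mul_sub, sub_mul, mul_add, add_mul, hee]
  intro x hx
  have hu : IsUnit (1 + π x) := isUnit_one_add k ((mem_rad_iff k _).2 hx)
  obtain ⟨u, hu⟩ := hu
  obtain ⟨y, hy⟩ := hπ ↑u⁻¹
  have ha : IsUnit ((1 + x) * y) := by
    have := h1 ((1 + x) * y - 1) (by simp [hy, ← hu])
    simpa using this
  have hb : IsUnit (y * (1 + x)) := by
    have := h1 (y * (1 + x) - 1) (by simp [hy, ← hu])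
    simpa using this
  obtain ⟨a, ha⟩ := ha
  obtain ⟨b, hb⟩ := hb
  rw [isUnit_iff_exists_and_exists]
  refine ⟨⟨y * ↑a⁻¹, ?_⟩, ⟨↑b⁻¹ * y, ?_⟩⟩
  · rw [← mul_assoc, ← ha]; simp
  · rw [mul_assoc, ← hb]; simp

/-- An extension of a complete local algebra by a one-dimensional socle which is not contained
in every power of the radical is complete local. -/
theorem isCompleteLocal_of_extension (π : E →ₐ[k] P) (hπ : Function.Surjective π) (ε : E)
    (hk : ∀ x, π x = 0 → ∃ c : k, x = c • ε)
    (hs : ∀ x : E, residue k P (π x) = 0 → x * ε = 0 ∧ ε * x = 0)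
    (h0 : π ε = 0)
    (hN : rad E = RingHom.ker ((residue k P).comp π) → ∃ N, ε ∉ rad E ^ N) :
    IsCompleteLocal k E := by
  have hu := rad_of_square_zero π hπ ε hk hs h0
  have hrad : rad E = RingHom.ker ((residue k P).comp π) := rad_eq_ker k _ hu
  have hmem : ∀ x, x ∈ rad E ↔ π x ∈ rad P := fun x => by
    rw [hrad, mem_rad_iff k, RingHom.mem_ker]; rfl
  obtain ⟨N, hN⟩ := hN hrad
  have hdown : ∀ n x, x ∈ rad E ^ n → π x ∈ rad P ^ n := by
    intro n
    induction n with
    | zero => intro x _; simp [Submodule.pow_zero]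
    | succ n ih =>
      intro x hx
      rw [Submodule.pow_succ] at hx
      induction hx using Submodule.mul_induction_on' with
      | mem_mul_mem a ha b hb =>
        rw [Submodule.pow_succ, map_mul]
        exact Ideal.mul_mem_mul (ih _ ha) ((hmem b).1 hb)
      | add a _ b _ ha hb => rw [map_add]; exact add_mem ha hb
  have hup : ∀ n y, y ∈ rad P ^ n → ∃ x ∈ rad E ^ n, π x = y := by
    intro n
    induction n with
    | zero => intro y _; obtain ⟨x, hx⟩ := hπ y; exact ⟨x, by simp [Submodule.pow_zero], hx⟩
    | succ n ih =>
      intro y hy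
      rw [Submodule.pow_succ] at hy
      induction hy using Submodule.mul_induction_on' with
      | mem_mul_mem a ha b hb =>
        obtain ⟨x, hx, rfl⟩ := ih a ha
        obtain ⟨z, rfl⟩ := hπ b
        refine ⟨x * z, ?_, by simp⟩
        rw [Submodule.pow_succ]
        exact Ideal.mul_mem_mul hx ((hmem z).2 hb)
      | add a _ b _ ha hb =>
        obtain ⟨x, hx, rfl⟩ := ha
        obtain ⟨z, hz, rfl⟩ := hb
        exact ⟨x + z, add_mem hx hz, by simp⟩
  have hsc : ∀ c : k, c • ε ∈ rad E ^ N → c = 0 := by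
    intro c hc
    by_contra hne
    apply hN
    have := Ideal.mul_mem_left _ (algebraMap k E c⁻¹) hc
    rwa [← Algebra.smul_def, smul_smul, inv_mul_cancel₀ hne, one_smul] at this
  have hmono : ∀ {m n : ℕ}, m ≤ n → rad E ^ n ≤ rad E ^ m := fun h => Ideal.pow_le_pow_right h
  refine ⟨isLocalRing_of_character k ((residue k P).comp π) hu, residue_bijective_of_character k _ hrad, ?_, ?_, ?_⟩
  · obtain ⟨V, hV, h⟩ := (finite_cotangent_iff k).1
      (IsCompleteLocal.finite_cotangent : Module.Finite k (rad P ⧸ _))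
    obtain ⟨s, hs⟩ := hV
    choose f hf using hπ
    classical
    refine (finite_cotangent_iff k).2
      ⟨Submodule.span k (s.image f ∪ {ε} : Finset E), ⟨_, rfl⟩, fun x hx => ?_⟩
    obtain ⟨v, hv, hv'⟩ := h (π x) ((hmem x).1 hx)
    have hlift : ∃ v' ∈ Submodule.span k (s.image f : Set E), π v' = v := by
      have h2 : v ∈ Submodule.map π.toLinearMap (Submodule.span k (s.image f : Set E)) := by
        rw [Submodule.map_span, Finset.coe_image, ← Set.image_comp]
        have h3 : (⇑π.toLinearMap ∘ f) = id := funext fun y => hf y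
        rw [h3, Set.image_id]
        rwa [hs]
      obtain ⟨v', h1, h2⟩ := h2
      exact ⟨v', h1, h2⟩
    obtain ⟨v', hv1, rfl⟩ := hlift
    obtain ⟨w, hw, hw'⟩ := hup 2 _ hv'
    obtain ⟨c, hc⟩ := hk (x - v' - w) (by simp [hw'])
    refine ⟨v' + c • ε, add_mem (Submodule.span_mono (by simp) hv1)
      (Submodule.smul_mem _ _ (Submodule.subset_span (by simp))), ?_⟩
    have : x - (v' + c • ε) = w := by rw [← hc]; abel
    rwa [this]
  · intro x hx
    have h1 : π x = 0 := IsCompleteLocal.separated (k := k) _ fun n => hdown n x (hx n)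
    obtain ⟨c, rfl⟩ := hk x h1
    rw [hsc c (hx N), zero_smul]
  · intro s hsq
    obtain ⟨p, hp⟩ := IsCompleteLocal.complete k (fun n => π (s n))
      (fun n => by rw [← map_sub]; exact hdown n _ (hsq n))
    obtain ⟨y, rfl⟩ := hπ p
    have h1 : ∀ n, ∃ c : k, y - s n + c • ε ∈ rad E ^ n := by
      intro n
      obtain ⟨w, hw, hw'⟩ := hup n _ (hp n)
      obtain ⟨c, hc⟩ := hk (w - (y - s n)) (by simp [hw'])
      exact ⟨c, by rw [← hc]; simpa using hw⟩
    choose c hc using h1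
    have hcs : ∀ n, N ≤ n → c n = c N := by
      intro n hn
      induction n, hn using Nat.le_induction with
      | base => rfl
      | succ n hn ih =>
        rw [← ih]
        have h2 := sub_mem (sub_mem (hmono (Nat.le_succ n) (hc (n + 1))) (hc n))
          (neg_mem (hsq n))
        have h3 : (c (n + 1) - c n) • ε ∈ rad E ^ N := by
          apply hmono hn
          convert! h2 using 1
          rw [sub_smul]; abel
        exact sub_eq_zero.1 (hsc _ h3)
    have hsum : ∀ n d, s (n + d) - s n ∈ rad E ^ n := by
      intro n d
      induction d with
      | zero => simp
      | succ d ih =>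
        have := add_mem (hmono (Nat.le_add_right n d) (hsq (n + d))) ih
        convert! this using 1
        rw [← add_assoc]; abel
    refine ⟨y + c N • ε, fun n => ?_⟩
    have h2 := hc (n + N)
    rw [hcs (n + N) (Nat.le_add_left _ _)] at h2
    have := add_mem (hmono (Nat.le_add_right n N) h2) (hsum n N)
    convert! this using 1
    abel

end Extension

/-! ### Small extensions -/

section Small

variable (k P : Type u) [Field k] [Ring P] [Algebra k P]

/-- A small extension `0 → k --ε--> E → P → 0`: a complete local `k`-algebra `E`, a nonzero
`ε ∈ E` with `𝔪_E ε = ε 𝔪_E = 0` (so that the ideal `(ε)` equals `k ε`), and a surjective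
`k`-algebra homomorphism `π : E → P` with kernel `(ε)`. -/
structure SmallExtension where
  /-- the underlying algebra -/
  E : Type u
  [ring : Ring E]
  [algebra : Algebra k E]
  [isCompleteLocal : IsCompleteLocal k E]
  /-- the projection -/
  π : E →ₐ[k] P
  /-- the socle element -/
  ε : E
  surjective : Function.Surjective π
  ε_ne_zero : ε ≠ 0
  socle : ∀ x ∈ rad E, x * ε = 0 ∧ ε * x = 0
  ker_eq : ∀ x, π x = 0 ↔ ∃ c : k, x = c • ε

attribute [instance] SmallExtension.ring SmallExtension.algebra SmallExtension.isCompleteLocal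

variable {k P}

namespace SmallExtension

/-- Two small extensions of `P` are equivalent if there is an isomorphism of `k`-algebras
compatible with the projections to `P` and mapping one socle element to the other. -/
def Equivalent (X Y : SmallExtension k P) : Prop :=
  ∃ f : X.E ≃ₐ[k] Y.E, (∀ x, Y.π (f x) = X.π x) ∧ f X.ε = Y.ε

instance setoid (k P : Type u) [Field k] [Ring P] [Algebra k P] :
    Setoid (SmallExtension k P) where
  r := Equivalent
  iseqv := by
    refine ⟨fun X => ⟨AlgEquiv.refl, fun _ => rfl, rfl⟩, ?_, ?_⟩
    · rintro X Y ⟨f, h1, h2⟩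
      exact ⟨f.symm, fun x => by rw [← h1, f.apply_symm_apply], by rw [← h2, f.symm_apply_apply]⟩
    · rintro X Y Z ⟨f, h1, h2⟩ ⟨g, h3, h4⟩
      exact ⟨f.trans g, fun x => by simp [h3, h1], by simp [h2, h4]⟩

theorem π_ε (X : SmallExtension k P) : X.π X.ε = 0 := (X.ker_eq _).2 ⟨1, by simp⟩

theorem smul_inj (X : SmallExtension k P) {c d : k} (h : c • X.ε = d • X.ε) : c = d := by
  have h1 : (c - d) • X.ε = 0 := by rw [sub_smul, h, sub_self]
  by_contra hne
  refine X.ε_ne_zero ?_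
  rw [← one_smul k X.ε, ← inv_mul_cancel₀ (sub_ne_zero.2 hne), ← smul_smul, h1, smul_zero]

theorem exists_ε_notMem (X : SmallExtension k P) : ∃ N, X.ε ∉ rad X.E ^ N := by
  by_contra! h
  exact X.ε_ne_zero (IsCompleteLocal.separated k _ h)

variable [IsCompleteLocal k P]

theorem socle' (X : SmallExtension k P) {x : X.E} (h : residue k P (X.π x) = 0) :
    x * X.ε = 0 ∧ X.ε * x = 0 :=
  X.socle x (by rwa [mem_rad_iff k, ← residue_map k X.π])

theorem mul_ε (X : SmallExtension k P) (x : X.E) : x * X.ε = residue k P (X.π x) • X.ε := by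
  have := (X.socle' (x := x - algebraMap k X.E (residue k P (X.π x))) (by simp)).1
  rw [sub_mul, sub_eq_zero] at this
  rw [this, Algebra.smul_def]

theorem ε_mul (X : SmallExtension k P) (x : X.E) : X.ε * x = residue k P (X.π x) • X.ε := by
  have := (X.socle' (x := x - algebraMap k X.E (residue k P (X.π x))) (by simp)).2
  rw [mul_sub, sub_eq_zero] at this
  rw [this, Algebra.smul_def, Algebra.commutes]

theorem ε_mul_ε (X : SmallExtension k P) : X.ε * X.ε = 0 := by
  rw [X.mul_ε, X.π_ε, map_zero, zero_smul]

/-- Two small extensions receiving homomorphisms over `P` from one algebra `B`, surjective onto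
`P`, with the same values on the kernel, are equivalent. -/
theorem equivalent_of_common {X Y : SmallExtension k P} {B : Type u} [Ring B] [Algebra k B]
    (p : B →ₐ[k] P) (hp : Function.Surjective p) (g : B →ₐ[k] X.E) (g' : B →ₐ[k] Y.E)
    (hg : ∀ b, X.π (g b) = p b) (hg' : ∀ b, Y.π (g' b) = p b)
    (h : ∀ b, p b = 0 → ∃ c : k, g b = c • X.ε ∧ g' b = c • Y.ε) : X ≈ Y := by
  have hX : ∀ x, ∃ b, ∃ c : k, x = g b + c • X.ε := by
    intro x
    obtain ⟨b, hb⟩ := hp (X.π x)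
    obtain ⟨c, hc⟩ := (X.ker_eq (x - g b)).1 (by rw [map_sub, hg, hb, sub_self])
    exact ⟨b, c, by rw [← hc]; abel⟩
  choose b c hbc using hX
  have key : ∀ (x : X.E) (b' : B) (c' : k), x = g b' + c' • X.ε →
      g' (b x) + c x • Y.ε = g' b' + c' • Y.ε := by
    intro x b' c' hx
    have h1 := (hbc x).symm.trans hx
    have h2 : p (b x - b') = 0 := by
      have := congrArg X.π h1
      simpa [hg, X.π_ε, sub_eq_zero] using this
    obtain ⟨d, hd, hd'⟩ := h _ h2
    have h3 : d = c' - c x := by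
      apply X.smul_inj
      rw [← hd, map_sub, sub_smul, sub_eq_sub_iff_add_eq_add, h1, add_comm]
    rw [h3, map_sub] at hd'
    rw [sub_smul, sub_eq_sub_iff_add_eq_add] at hd'
    rw [hd', add_comm]
  let f : X.E →ₐ[k] Y.E := AlgHom.ofLinearMap
    { toFun := fun x => g' (b x) + c x • Y.ε
      map_add' := fun x y => by
        rw [key (x + y) (b x + b y) (c x + c y)
          (by conv_lhs => rw [hbc x, hbc y]
              rw [map_add, add_smul]; abel), map_add, add_smul]
        abel
      map_smul' := fun a x => by
        rw [key (a • x) (a • b x) (a * c x)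
          (by conv_lhs => rw [hbc x]
              rw [map_smul, smul_add, smul_smul]), map_smul, RingHom.id_apply, smul_add, smul_smul] }
    (by
      change g' (b 1) + c 1 • Y.ε = 1
      rw [key 1 1 0 (by simp)]; simp)
    (fun x y => by
      change g' (b (x * y)) + c (x * y) • Y.ε = (g' (b x) + c x • Y.ε) * (g' (b y) + c y • Y.ε)
      rw [key (x * y) (b x * b y) (residue k P (p (b x)) * c y + c x * residue k P (p (b y)))
        (by
          conv_lhs => rw [hbc x, hbc y]
          simp only [mul_add, add_mul, mul_smul_comm, smul_mul_assoc, X.mul_ε, X.ε_mul, hg,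
            map_add, map_smul, X.π_ε, smul_zero, add_zero, map_mul, add_smul, smul_smul]
          rw [mul_comm (c y)]; abel)]
      simp only [mul_add, add_mul, mul_smul_comm, smul_mul_assoc, Y.mul_ε, Y.ε_mul, hg',
            map_add, map_smul, Y.π_ε, smul_zero, add_zero, map_mul, add_smul, smul_smul]
      rw [mul_comm (c y)]; abel)
  have hf : ∀ x, f x = g' (b x) + c x • Y.ε := fun _ => rfl
  have hfε : ∀ a : k, f (a • X.ε) = a • Y.ε := by
    intro a; rw [hf, key _ 0 a (by simp)]; simp
  have hfπ : ∀ x, Y.π (f x) = X.π x := by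
    intro x
    rw [hf]
    conv_rhs => rw [hbc x]
    simp [hg, hg', X.π_ε, Y.π_ε]
  refine ⟨AlgEquiv.ofBijective f ⟨?_, ?_⟩, hfπ, (by simpa using hfε 1 : f X.ε = Y.ε)⟩
  · rw [injective_iff_map_eq_zero]
    intro x hx
    have h1 : X.π x = 0 := by rw [← hfπ, hx, map_zero]
    obtain ⟨a, rfl⟩ := (X.ker_eq x).1 h1
    rw [hfε] at hx
    have : a = 0 := Y.smul_inj (by simpa using hx)
    rw [this, zero_smul]
  · intro y
    obtain ⟨x, hx⟩ := X.surjective (Y.π y)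
    obtain ⟨a, ha⟩ := (Y.ker_eq (y - f x)).1 (by rw [map_sub, hfπ, hx, sub_self])
    refine ⟨x + a • X.ε, ?_⟩
    rw [map_add, hfε, ← ha]; abel

end SmallExtension

/-- The fibre product `A ×_P B`. -/
abbrev Fib {A B : Type*} [Ring A] [Algebra k A] [Ring B] [Algebra k B]
    (f : A →ₐ[k] P) (g : B →ₐ[k] P) : Subalgebra k (A × B) :=
  AlgHom.equalizer (f.comp (AlgHom.fst k A B)) (g.comp (AlgHom.snd k A B))

namespace Fib

variable {A B : Type u} [Ring A] [Algebra k A] [Ring B] [Algebra k B]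
  (f : A →ₐ[k] P) (g : B →ₐ[k] P)

/-- First projection of the fibre product. -/
def fst : Fib f g →ₐ[k] A := (AlgHom.fst k A B).comp (Fib f g).val
/-- Second projection of the fibre product. -/
def snd : Fib f g →ₐ[k] B := (AlgHom.snd k A B).comp (Fib f g).val

theorem fst_apply (x : Fib f g) : fst f g x = x.1.1 := rfl
theorem snd_apply (x : Fib f g) : snd f g x = x.1.2 := rfl
theorem condition (x : Fib f g) : f x.1.1 = g x.1.2 := x.2

/-- Universal property of the fibre product. -/
def lift {C : Type*} [Ring C] [Algebra k C] (u : C →ₐ[k] A) (v : C →ₐ[k] B)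
    (h : ∀ c, f (u c) = g (v c)) : C →ₐ[k] Fib f g :=
  (u.prod v).codRestrict _ h

theorem lift_apply {C : Type*} [Ring C] [Algebra k C] (u : C →ₐ[k] A) (v : C →ₐ[k] B)
    (h : ∀ c, f (u c) = g (v c)) (c : C) : (lift f g u v h c : A × B) = (u c, v c) := rfl

end Fib

namespace SmallExtension

theorem fib_surjective (X Y : SmallExtension k P) :
    Function.Surjective (X.π.comp (Fib.fst X.π Y.π)) := fun q => by
  obtain ⟨x, rfl⟩ := X.surjective q
  obtain ⟨y, hy⟩ := Y.surjective (X.π x)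
  exact ⟨⟨(x, y), hy.symm⟩, rfl⟩

theorem fib_ker (X Y : SmallExtension k P) (b : Fib X.π Y.π)
    (h : X.π.comp (Fib.fst X.π Y.π) b = 0) :
    ∃ c d : k, b.1.1 = c • X.ε ∧ b.1.2 = d • Y.ε := by
  obtain ⟨c, hc⟩ := (X.ker_eq b.1.1).1 h
  obtain ⟨d, hd⟩ := (Y.ker_eq b.1.2).1 ((Fib.condition _ _ b).symm.trans h)
  exact ⟨c, d, hc, hd⟩

end SmallExtension

variable [IsCompleteLocal k P]

namespace SmallExtension

/-- Constructor for small extensions in which completeness is replaced by the condition that the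
socle element avoids some power of the radical. -/
def ofExtension {E : Type u} [Ring E] [Algebra k E] (π : E →ₐ[k] P)
    (hπ : Function.Surjective π) (ε : E) (hε : ε ≠ 0)
    (hk : ∀ x, π x = 0 → ∃ c : k, x = c • ε)
    (hs : ∀ x : E, residue k P (π x) = 0 → x * ε = 0 ∧ ε * x = 0)
    (h0 : π ε = 0)
    (hN : rad E = RingHom.ker ((residue k P).comp π) → ∃ N, ε ∉ rad E ^ N) :
    SmallExtension k P :=
  have : IsCompleteLocal k E := isCompleteLocal_of_extension π hπ ε hk hs h0 hN
  { E := E, π := π, ε := ε, surjective := hπ, ε_ne_zero := hε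
    socle := fun x hx => hs x (by rwa [residue_map k π, ← mem_rad_iff k])
    ker_eq := fun x => ⟨hk x, by rintro ⟨c, rfl⟩; rw [map_smul, h0, smul_zero]⟩ }

variable (k P) in
/-- The trivial small extension `P ×_k k[ε] ≅ P[x] / (x², 𝔪_P x, x 𝔪_P)`. -/
noncomputable def trivial : SmallExtension k P :=
  ofExtension (E := Fib (residue k P) (TrivSqZeroExt.fstHom k k k))
    (Fib.fst _ _)
    (fun p => ⟨⟨(p, TrivSqZeroExt.inl (residue k P p)), by
      change residue k P p = TrivSqZeroExt.fst (TrivSqZeroExt.inl (residue k P p) : DualNumber k)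
      rw [TrivSqZeroExt.fst_inl]⟩, rfl⟩)
    ⟨(0, DualNumber.eps), by
      change residue k P 0 = TrivSqZeroExt.fst (DualNumber.eps : DualNumber k)
      rw [map_zero, DualNumber.fst_eps]⟩
    (fun h => by
      have := congrArg (fun x => TrivSqZeroExt.snd x.1.2) h
      simp at this)
    (fun x hx => by
      refine ⟨TrivSqZeroExt.snd x.1.2, Subtype.ext (Prod.ext ?_ (TrivSqZeroExt.ext ?_ ?_))⟩
      · exact hx.trans (by simp)
      · have h1 := x.2
        rw [AlgHom.mem_equalizer] at h1
        have h2 : x.1.1 = 0 := hx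
        simp only [AlgHom.comp_apply, AlgHom.fst_apply, AlgHom.snd_apply, h2, map_zero] at h1
        simpa using h1.symm
      · simp)
    (fun x hx => by
      have h1 := x.2
      rw [AlgHom.mem_equalizer] at h1
      have h3 : TrivSqZeroExt.fst x.1.2 = 0 := h1.symm.trans hx
      constructor <;>
      · refine Subtype.ext (Prod.ext ?_ (TrivSqZeroExt.ext ?_ ?_)) <;> simp [h3])
    rfl
    (fun hrad => by
      refine ⟨2, fun h => ?_⟩
      have key : ∀ x ∈ rad (Fib (residue k P) (TrivSqZeroExt.fstHom k k k)) ^ 2,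
          x.1.2 = 0 := by
        have hfst : ∀ x ∈ rad (Fib (residue k P) (TrivSqZeroExt.fstHom k k k)),
            TrivSqZeroExt.fst x.1.2 = 0 := by
          intro x hx
          have h1 := x.2
          rw [AlgHom.mem_equalizer] at h1
          rw [hrad] at hx
          exact h1.symm.trans hx
        intro x hx
        rw [Submodule.pow_succ, Submodule.pow_one] at hx
        induction hx using Submodule.mul_induction_on' with
        | mem_mul_mem a ha b hb =>
          refine TrivSqZeroExt.ext ?_ ?_ <;> simp [hfst a ha, hfst b hb]
        | add a _ b _ ha hb => simp [ha, hb]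
      have := congrArg TrivSqZeroExt.snd (key _ h)
      simp at this)

/-- The ideal of `X ×_P Y` generated by `(ε_X, -ε_Y)`, i.e. the line spanned by that element. -/
def baerIdeal (X Y : SmallExtension k P) : Ideal (Fib X.π Y.π) where
  carrier := {b | ∃ c : k, (b : X.E × Y.E) = (c • X.ε, -(c • Y.ε))}
  zero_mem' := ⟨0, by ext <;> simp⟩
  add_mem' := by
    rintro a b ⟨c, hc⟩ ⟨d, hd⟩
    refine ⟨c + d, ?_⟩
    rw [Subalgebra.coe_add, hc, hd, Prod.mk_add_mk, add_smul, add_smul, neg_add]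
  smul_mem' := by
    rintro a b ⟨c, hc⟩
    refine ⟨c * residue k P (X.π a.1.1), ?_⟩
    have := Fib.condition _ _ a
    rw [smul_eq_mul, Subalgebra.coe_mul, hc]
    ext <;> simp [X.mul_ε, Y.mul_ε, smul_smul, ← this]

instance (X Y : SmallExtension k P) : (baerIdeal X Y).IsTwoSided where
  mul_mem_of_left := by
    rintro b a ⟨c, hc⟩
    refine ⟨c * residue k P (X.π a.1.1), ?_⟩
    have := Fib.condition _ _ a
    rw [Subalgebra.coe_mul, hc]
    ext <;> simp [X.ε_mul, Y.ε_mul, smul_smul, ← this]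

theorem mem_baerIdeal {X Y : SmallExtension k P} {b : Fib X.π Y.π} :
    b ∈ baerIdeal X Y ↔ ∃ c : k, (b : X.E × Y.E) = (c • X.ε, -(c • Y.ε)) := Iff.rfl

/-- The sum `(X ×_P Y) / (ε_X, -ε_Y)` of two small extensions, with socle element the class of
`(ε_X, 0)`. -/
noncomputable def add (X Y : SmallExtension k P) : SmallExtension k P :=
  have hmk : ∀ b : Fib X.π Y.π,
      Ideal.Quotient.mkₐ k (baerIdeal X Y) b = 0 ↔ b ∈ baerIdeal X Y := fun b =>
    Ideal.Quotient.eq_zero_iff_mem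
  ofExtension (E := Fib X.π Y.π ⧸ baerIdeal X Y)
    (Ideal.Quotient.liftₐ (baerIdeal X Y) (X.π.comp (Fib.fst X.π Y.π)) (by
      rintro b ⟨c, hc⟩
      have : b.1.1 = c • X.ε := congrArg Prod.fst hc
      change X.π b.1.1 = 0
      rw [this, map_smul, X.π_ε, smul_zero]))
    (fun p => by
      obtain ⟨x, rfl⟩ := X.surjective p
      obtain ⟨y, hy⟩ := Y.surjective (X.π x)
      exact ⟨Ideal.Quotient.mkₐ k (baerIdeal X Y) ⟨(x, y), hy.symm⟩, rfl⟩)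
    (Ideal.Quotient.mkₐ k (baerIdeal X Y) ⟨(X.ε, 0), by
      simp [AlgHom.mem_equalizer, X.π_ε]⟩)
    (fun h => by
      obtain ⟨c, hc⟩ := (hmk _).1 h
      have h1 : X.ε = c • X.ε := congrArg Prod.fst hc
      have h2 : (0 : Y.E) = -(c • Y.ε) := congrArg Prod.snd hc
      have h3 : c = 0 := Y.smul_inj (by rw [zero_smul]; simpa using h2.symm)
      rw [h3, zero_smul] at h1
      exact X.ε_ne_zero h1)
    (fun x hx => by
      obtain ⟨b, rfl⟩ := Ideal.Quotient.mkₐ_surjective k (baerIdeal X Y) x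
      have h1 : X.π b.1.1 = 0 := hx
      have h2 : Y.π b.1.2 = 0 := by rw [← Fib.condition, h1]
      obtain ⟨c, hc⟩ := (X.ker_eq _).1 h1
      obtain ⟨d, hd⟩ := (Y.ker_eq _).1 h2
      refine ⟨c + d, ?_⟩
      rw [← map_smul, ← sub_eq_zero, ← map_sub, hmk]
      refine ⟨-d, Prod.ext ?_ ?_⟩
      · change b.1.1 - (c + d) • X.ε = _
        rw [hc]; simp [add_smul]
      · change b.1.2 - (c + d) • (0 : Y.E) = _
        rw [hd]; simp)
    (fun x hx => by
      obtain ⟨b, rfl⟩ := Ideal.Quotient.mkₐ_surjective k (baerIdeal X Y) x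
      have h1 : residue k P (X.π b.1.1) = 0 := hx
      rw [← map_mul, ← map_mul]
      constructor
      · refine (congrArg _ (Subtype.ext (Prod.ext ?_ ?_) : _ = (0 : Fib X.π Y.π))).trans
          (map_zero (Ideal.Quotient.mkₐ k (baerIdeal X Y)))
        · exact (X.socle' h1).1
        · exact mul_zero _
      · refine (congrArg _ (Subtype.ext (Prod.ext ?_ ?_) : _ = (0 : Fib X.π Y.π))).trans
          (map_zero (Ideal.Quotient.mkₐ k (baerIdeal X Y)))
        · exact (X.socle' h1).2
        · exact zero_mul _)
    (X.π_ε)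
    (fun hrad => by
      obtain ⟨M, hM⟩ := X.exists_ε_notMem
      obtain ⟨N, hN⟩ := Y.exists_ε_notMem
      refine ⟨M + N, fun h => ?_⟩
      have key : ∀ n, ∀ x ∈ rad (Fib X.π Y.π ⧸ baerIdeal X Y) ^ n, ∃ b : Fib X.π Y.π,
          Ideal.Quotient.mkₐ k (baerIdeal X Y) b = x ∧ b.1.1 ∈ rad X.E ^ n ∧
            b.1.2 ∈ rad Y.E ^ n := by
        intro n
        induction n with
        | zero =>
          intro x _
          obtain ⟨b, rfl⟩ := Ideal.Quotient.mkₐ_surjective k (baerIdeal X Y) x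
          exact ⟨b, rfl, by simp [Submodule.pow_zero], by simp [Submodule.pow_zero]⟩
        | succ n ih =>
          intro x hx
          rw [Submodule.pow_succ] at hx
          induction hx using Submodule.mul_induction_on' with
          | mem_mul_mem x hx y hy =>
            obtain ⟨a, rfl, ha1, ha2⟩ := ih x hx
            obtain ⟨b, rfl⟩ := Ideal.Quotient.mkₐ_surjective k (baerIdeal X Y) y
            rw [hrad] at hy
            have hb : residue k P (X.π b.1.1) = 0 := hy
            have hb' : residue k P (Y.π b.1.2) = 0 := by rw [← Fib.condition, hb]
            rw [residue_map, ← mem_rad_iff] at hb hb'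
            refine ⟨a * b, map_mul _ _ _, ?_, ?_⟩ <;> rw [Submodule.pow_succ]
            · exact Ideal.mul_mem_mul ha1 hb
            · exact Ideal.mul_mem_mul ha2 hb'
          | add x _ y _ hx hy =>
            obtain ⟨a, rfl, ha1, ha2⟩ := hx
            obtain ⟨b, rfl, hb1, hb2⟩ := hy
            exact ⟨a + b, map_add _ _ _, add_mem ha1 hb1, add_mem ha2 hb2⟩
      obtain ⟨b, hb, hb1, hb2⟩ := key _ _ h
      rw [← sub_eq_zero, ← map_sub, hmk] at hb
      obtain ⟨c, hc⟩ := hb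
      have h1 : b.1.1 - X.ε = c • X.ε := congrArg Prod.fst hc
      have h2 : b.1.2 - 0 = -(c • Y.ε) := congrArg Prod.snd hc
      by_cases hc0 : c = 0
      · rw [hc0, zero_smul, sub_eq_zero] at h1
        rw [h1] at hb1
        exact hM (Ideal.pow_le_pow_right (Nat.le_add_right M N) hb1)
      · rw [sub_zero] at h2
        rw [h2] at hb2
        have h3 := Ideal.pow_le_pow_right (Nat.le_add_left N M) hb2
        have h4 := Ideal.mul_mem_left _ (algebraMap k Y.E (-c⁻¹)) h3
        rw [← Algebra.smul_def, neg_smul, smul_neg, neg_neg, smul_smul,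
          inv_mul_cancel₀ hc0, one_smul] at h4
        exact hN h4)

open Classical in
/-- Scalar multiples of small extensions: `c · (E, ε) = (E, c⁻¹ ε)` for `c ≠ 0`, and `0 · (E, ε)`
is the trivial small extension. -/
noncomputable def smul (c : k) (X : SmallExtension k P) : SmallExtension k P :=
  if hc : c = 0 then trivial k P else
  { X with
    ε := c⁻¹ • X.ε
    ε_ne_zero := smul_ne_zero (inv_ne_zero hc) X.ε_ne_zero
    socle := fun x hx => by simp [X.socle x hx]
    ker_eq := fun x => by
      rw [X.ker_eq]
      constructor
      · rintro ⟨a, rfl⟩; exact ⟨a * c, by rw [smul_smul, mul_assoc, mul_inv_cancel₀ hc, mul_one]⟩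
      · rintro ⟨a, rfl⟩; exact ⟨a * c⁻¹, by rw [smul_smul]⟩ }

theorem mk_eq_smul (X Y : SmallExtension k P) (b : Fib X.π Y.π) (c d : k)
    (hc : b.1.1 = c • X.ε) (hd : b.1.2 = d • Y.ε) (h) :
    Ideal.Quotient.mkₐ k (baerIdeal X Y) b =
      (c + d) • Ideal.Quotient.mkₐ k (baerIdeal X Y) ⟨(X.ε, 0), h⟩ := by
  rw [← map_smul, ← sub_eq_zero, ← map_sub]
  refine Ideal.Quotient.eq_zero_iff_mem.2 ⟨-d, Prod.ext ?_ ?_⟩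
  · change b.1.1 - (c + d) • X.ε = _
    rw [hc]; simp [add_smul]
  · change b.1.2 - (c + d) • (0 : Y.E) = _
    rw [hd]; simp

theorem exists_addMap (X Y : SmallExtension k P) : ∃ g : Fib X.π Y.π →ₐ[k] (X.add Y).E,
    (∀ b, (X.add Y).π (g b) = X.π b.1.1) ∧
    ∀ (b : Fib X.π Y.π) (c d : k), b.1.1 = c • X.ε → b.1.2 = d • Y.ε →
      g b = (c + d) • (X.add Y).ε := by
  exact ⟨Ideal.Quotient.mkₐ k (baerIdeal X Y), fun _ => rfl,
    fun b c d hc hd => mk_eq_smul X Y b c d hc hd _⟩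

theorem exists_trivialMap : ∃ g : P →ₐ[k] (trivial k P).E, ∀ p, (trivial k P).π (g p) = p :=
  ⟨Fib.lift _ _ (AlgHom.id k P) ((Algebra.ofId k _).comp (residue k P)) (fun c => by
    simp [Algebra.ofId_apply]), fun _ => rfl⟩

theorem exists_smulMap (c : k) (X : SmallExtension k P) : ∃ g : X.E →ₐ[k] (smul c X).E,
    (∀ x, (smul c X).π (g x) = X.π x) ∧ ∀ a : k, g (a • X.ε) = (a * c) • (smul c X).ε := by
  by_cases hc : c = 0
  · subst hc
    have h : smul 0 X = trivial k P := by simp [smul]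
    rw [h]
    obtain ⟨g, hg⟩ := exists_trivialMap (k := k) (P := P)
    exact ⟨g.comp X.π, fun x => by simp [hg], fun a => by simp [X.π_ε]⟩
  · rw [smul, dif_neg hc]
    refine ⟨AlgHom.id k X.E, fun _ => rfl, fun a => ?_⟩
    change a • X.ε = (a * c) • c⁻¹ • X.ε
    rw [smul_smul, mul_assoc, mul_inv_cancel₀ hc, mul_one]

end SmallExtension

variable (k P) in
/-- `𝒯(P)`: the set of equivalence classes of small extensions of `P`. -/
def SmallExtClass : Type (u + 1) := Quotient (SmallExtension.setoid k P)

namespace SmallExtClass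

open SmallExtension

/-- The class of a small extension. -/
def mk (X : SmallExtension k P) : SmallExtClass k P := Quotient.mk _ X

theorem add_congr {X X' Y Y' : SmallExtension k P} (h : X ≈ X') (h' : Y ≈ Y') :
    X.add Y ≈ X'.add Y' := by
  obtain ⟨f, hf, hf'⟩ := h
  obtain ⟨g, hg, hg'⟩ := h'
  obtain ⟨a, ha, ha'⟩ := exists_addMap X Y
  obtain ⟨b, hb, hb'⟩ := exists_addMap X' Y'
  let F : Fib X.π Y.π →ₐ[k] Fib X'.π Y'.π := Fib.lift _ _
    ((f : X.E →ₐ[k] X'.E).comp (Fib.fst _ _)) ((g : Y.E →ₐ[k] Y'.E).comp (Fib.snd _ _))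
    (fun c => by simpa [hf, hg, Fib.fst_apply, Fib.snd_apply] using Fib.condition _ _ c)
  refine equivalent_of_common (X.π.comp (Fib.fst X.π Y.π)) ?_ a (b.comp F) ha ?_ ?_
  · exact fib_surjective X Y
  · intro c
    exact (hb _).trans (hf _)
  · intro c hc
    obtain ⟨s, t, hs, ht⟩ := fib_ker X Y c hc
    refine ⟨s + t, ha' c s t hs ht, hb' _ s t ?_ ?_⟩
    · change f c.1.1 = _
      rw [hs, map_smul, hf']
    · change g c.1.2 = _
      rw [ht, map_smul, hg']

theorem smul_congr (c : k) {X Y : SmallExtension k P} (h : X ≈ Y) :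
    SmallExtension.smul c X ≈ SmallExtension.smul c Y := by
  obtain ⟨f, hf, hf'⟩ := h
  obtain ⟨a, ha, ha'⟩ := exists_smulMap c X
  obtain ⟨b, hb, hb'⟩ := exists_smulMap c Y
  refine equivalent_of_common X.π X.surjective a (b.comp (f : X.E →ₐ[k] Y.E)) ha
    (fun x => (hb _).trans (hf _)) fun x hx => ?_
  obtain ⟨s, rfl⟩ := (X.ker_eq x).1 hx
  refine ⟨s * c, ha' s, ?_⟩
  change b (f (s • X.ε)) = _
  rw [map_smul, hf', hb']

theorem add_comm_equiv (X Y : SmallExtension k P) : X.add Y ≈ Y.add X := by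
  obtain ⟨a, ha, ha'⟩ := exists_addMap X Y
  obtain ⟨b, hb, hb'⟩ := exists_addMap Y X
  refine equivalent_of_common (X.π.comp (Fib.fst X.π Y.π)) (fib_surjective X Y) a
    (b.comp (Fib.lift _ _ (Fib.snd _ _) (Fib.fst _ _)
      (fun c => (Fib.condition _ _ c).symm))) ha
    (fun c => (hb _).trans (Fib.condition _ _ c).symm) fun c hc => ?_
  obtain ⟨s, t, hs, ht⟩ := fib_ker X Y c hc
  exact ⟨s + t, ha' c s t hs ht, by rw [add_comm]; exact hb' _ t s ht hs⟩

theorem add_assoc_equiv (X Y Z : SmallExtension k P) :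
    (X.add Y).add Z ≈ X.add (Y.add Z) := by
  obtain ⟨a, ha, ha'⟩ := exists_addMap X Y
  obtain ⟨b, hb, hb'⟩ := exists_addMap (X.add Y) Z
  obtain ⟨c, hc, hc'⟩ := exists_addMap Y Z
  obtain ⟨d, hd, hd'⟩ := exists_addMap X (Y.add Z)
  let p := X.π.comp (Fib.fst X.π Y.π)
  let B := Fib p Z.π
  let g₁ : B →ₐ[k] (X.add Y).E := a.comp (Fib.fst p Z.π)
  let g₂ : B →ₐ[k] Z.E := Fib.snd p Z.π
  let g : B →ₐ[k] ((X.add Y).add Z).E := b.comp (Fib.lift (X.add Y).π Z.π g₁ g₂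
    (fun x => (ha _).trans (Fib.condition p Z.π x)))
  let h₁ : B →ₐ[k] X.E := (Fib.fst X.π Y.π).comp (Fib.fst p Z.π)
  let h₂ : B →ₐ[k] Y.E := (Fib.snd X.π Y.π).comp (Fib.fst p Z.π)
  have h₁₂ : ∀ x, X.π (h₁ x) = Y.π (h₂ x) := fun x => Fib.condition X.π Y.π (Fib.fst p Z.π x)
  have h₁₃ : ∀ x, X.π (h₁ x) = Z.π (g₂ x) := fun x => Fib.condition p Z.π x
  let yz : B →ₐ[k] Fib Y.π Z.π := Fib.lift Y.π Z.π h₂ g₂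
    (fun x => (h₁₂ x).symm.trans (h₁₃ x))
  let g' : B →ₐ[k] (X.add (Y.add Z)).E := d.comp (Fib.lift X.π (Y.add Z).π h₁ (c.comp yz)
    (fun x => (h₁₂ x).trans (hc (yz x)).symm))
  refine equivalent_of_common (B := B) (X.π.comp h₁) ?_ g g' ?_ ?_ ?_
  · intro q
    obtain ⟨w, hw⟩ := fib_surjective X Y q
    obtain ⟨z, hz⟩ := Z.surjective q
    exact ⟨⟨(w, z), hw.trans hz.symm⟩, hw⟩
  · exact fun x => (hb _).trans (ha _)
  · exact fun x => hd _
  · intro x hx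
    obtain ⟨s, t, hs, ht⟩ := fib_ker X Y x.1.1 hx
    obtain ⟨r, hr⟩ := (Z.ker_eq x.1.2).1 ((Fib.condition p Z.π x).symm.trans hx)
    refine ⟨s + t + r, hb' _ (s + t) r (ha' _ s t hs ht) hr, ?_⟩
    rw [add_assoc]
    exact hd' _ s (t + r) hs (hc' _ t r ht hr)

theorem zero_add_equiv (X : SmallExtension k P) : (trivial k P).add X ≈ X := by
  obtain ⟨z, hz⟩ := exists_trivialMap (k := k) (P := P)
  obtain ⟨a, ha, ha'⟩ := exists_addMap (trivial k P) X
  refine equivalent_of_common X.π X.surjective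
    (a.comp (Fib.lift _ _ (z.comp X.π) (AlgHom.id k _) (fun x => hz _))) (AlgHom.id k _)
    (fun x => (ha _).trans (hz _)) (fun _ => rfl) fun x hx => ?_
  obtain ⟨c, hc⟩ := (X.ker_eq x).1 hx
  refine ⟨c, ?_, hc⟩
  rw [← zero_add c]
  refine ha' _ 0 c ?_ hc
  change z (X.π x) = _
  rw [hx, map_zero, zero_smul]

/-- Common form of the identities for sums of two multiples of one small extension. -/
theorem exists_smul_add_smul (c d : k) (X : SmallExtension k P) :
    ∃ g : X.E →ₐ[k] ((SmallExtension.smul c X).add (SmallExtension.smul d X)).E,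
      (∀ x, SmallExtension.π _ (g x) = X.π x) ∧
      ∀ a : k, g (a • X.ε) = (a * (c + d)) • SmallExtension.ε _ := by
  obtain ⟨u, hu, hu'⟩ := exists_smulMap c X
  obtain ⟨v, hv, hv'⟩ := exists_smulMap d X
  obtain ⟨a, ha, ha'⟩ := exists_addMap (SmallExtension.smul c X) (SmallExtension.smul d X)
  refine ⟨a.comp (Fib.lift _ _ u v (fun x => (hu x).trans (hv x).symm)),
    fun x => (ha _).trans (hu x), fun s => ?_⟩
  rw [mul_add]
  exact ha' _ _ _ (hu' s) (hv' s)

theorem one_smul_equiv (X : SmallExtension k P) : SmallExtension.smul 1 X ≈ X := by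
  obtain ⟨u, hu, hu'⟩ := exists_smulMap 1 X
  refine equivalent_of_common X.π X.surjective u (AlgHom.id k _) hu (fun _ => rfl) fun x hx => ?_
  obtain ⟨c, rfl⟩ := (X.ker_eq x).1 hx
  exact ⟨c, by rw [hu', mul_one], rfl⟩

theorem mul_smul_equiv (c d : k) (X : SmallExtension k P) :
    SmallExtension.smul (c * d) X ≈ SmallExtension.smul c (SmallExtension.smul d X) := by
  obtain ⟨u, hu, hu'⟩ := exists_smulMap (c * d) X
  obtain ⟨v, hv, hv'⟩ := exists_smulMap d X
  obtain ⟨w, hw, hw'⟩ := exists_smulMap c (SmallExtension.smul d X)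
  refine equivalent_of_common X.π X.surjective u (w.comp v) hu
    (fun x => (hw _).trans (hv x)) fun x hx => ?_
  obtain ⟨a, rfl⟩ := (X.ker_eq x).1 hx
  refine ⟨a * (c * d), hu' a, ?_⟩
  rw [AlgHom.comp_apply, hv', hw', mul_assoc, mul_comm d c]

theorem add_smul_equiv (c d : k) (X : SmallExtension k P) :
    SmallExtension.smul (c + d) X ≈ (SmallExtension.smul c X).add (SmallExtension.smul d X) := by
  obtain ⟨u, hu, hu'⟩ := exists_smulMap (c + d) X
  obtain ⟨v, hv, hv'⟩ := exists_smul_add_smul c d X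
  refine equivalent_of_common X.π X.surjective u v hu hv fun x hx => ?_
  obtain ⟨a, rfl⟩ := (X.ker_eq x).1 hx
  exact ⟨a * (c + d), hu' a, hv' a⟩

theorem smul_add_equiv (c : k) (X Y : SmallExtension k P) :
    SmallExtension.smul c (X.add Y) ≈
      (SmallExtension.smul c X).add (SmallExtension.smul c Y) := by
  obtain ⟨u, hu, hu'⟩ := exists_smulMap c X
  obtain ⟨v, hv, hv'⟩ := exists_smulMap c Y
  obtain ⟨a, ha, ha'⟩ := exists_addMap X Y
  obtain ⟨b, hb, hb'⟩ := exists_addMap (SmallExtension.smul c X) (SmallExtension.smul c Y)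
  obtain ⟨w, hw, hw'⟩ := exists_smulMap c (X.add Y)
  refine equivalent_of_common (X.π.comp (Fib.fst X.π Y.π)) (fib_surjective X Y) (w.comp a)
    (b.comp (Fib.lift _ _ (u.comp (Fib.fst _ _)) (v.comp (Fib.snd _ _))
      (fun x => ((hu _).trans (Fib.condition _ _ x)).trans (hv _).symm)))
    (fun x => (hw _).trans (ha x)) (fun x => (hb _).trans (hu _)) fun x hx => ?_
  obtain ⟨s, t, hs, ht⟩ := fib_ker X Y x hx
  refine ⟨(s + t) * c, ?_, ?_⟩
  · rw [AlgHom.comp_apply, ha' x s t hs ht, hw']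
  · rw [add_mul]
    refine hb' _ (s * c) (t * c) ?_ ?_
    · change u x.1.1 = _
      rw [hs, hu']
    · change v x.1.2 = _
      rw [ht, hv']

theorem neg_add_equiv (X : SmallExtension k P) :
    (SmallExtension.smul (-1) X).add X ≈ trivial k P := by
  obtain ⟨z, hz⟩ := exists_trivialMap (k := k) (P := P)
  obtain ⟨u, hu, hu'⟩ := exists_smulMap (-1) X
  obtain ⟨a, ha, ha'⟩ := exists_addMap (SmallExtension.smul (-1) X) X
  refine equivalent_of_common X.π X.surjective
    (a.comp (Fib.lift _ _ u (AlgHom.id k _) hu)) (z.comp X.π)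
    (fun x => (ha _).trans (hu x)) (fun _ => hz _) fun x hx => ?_
  obtain ⟨c, rfl⟩ := (X.ker_eq x).1 hx
  refine ⟨0, ?_, by rw [AlgHom.comp_apply, hx, map_zero, zero_smul]⟩
  rw [show (0 : k) = c * -1 + c by ring]
  exact ha' _ _ _ (hu' c) rfl

theorem zero_smul_equiv (X : SmallExtension k P) : SmallExtension.smul 0 X ≈ trivial k P := by
  rw [SmallExtension.smul, dif_pos rfl]

/-- The sum `[E₁, ε₁] + [E₂, ε₂] = [E₁ ×_P E₂ / (ε₁, -ε₂), (ε₁, 0)]`. -/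
noncomputable instance : Add (SmallExtClass k P) where
  add := Quotient.map₂ SmallExtension.add fun _ _ h _ _ h' => add_congr h h'

noncomputable instance : Zero (SmallExtClass k P) where
  zero := mk (trivial k P)

noncomputable instance : Neg (SmallExtClass k P) where
  neg := Quotient.map (SmallExtension.smul (-1)) fun _ _ h => smul_congr _ h

noncomputable instance : AddCommGroup (SmallExtClass k P) where
  add_assoc := by rintro ⟨X⟩ ⟨Y⟩ ⟨Z⟩; exact Quotient.sound (add_assoc_equiv X Y Z)
  add_comm := by rintro ⟨X⟩ ⟨Y⟩; exact Quotient.sound (add_comm_equiv X Y)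
  zero_add := by rintro ⟨X⟩; exact Quotient.sound (zero_add_equiv X)
  add_zero := by
    rintro ⟨X⟩
    exact Quotient.sound ((setoid k P).trans (add_comm_equiv X _) (zero_add_equiv X))
  neg_add_cancel := by rintro ⟨X⟩; exact Quotient.sound (neg_add_equiv X)
  nsmul := nsmulRec
  zsmul := zsmulRec

/-- The scalar multiplication `c • [E, ε] = [E, c⁻¹ ε]` for `c ≠ 0`, and `0 • [E, ε] = 0`. -/
noncomputable instance : Module k (SmallExtClass k P) where
  smul c := Quotient.map (SmallExtension.smul c) fun _ _ h => smul_congr _ h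
  one_smul := by rintro ⟨X⟩; exact Quotient.sound (one_smul_equiv X)
  mul_smul := by rintro c d ⟨X⟩; exact Quotient.sound (mul_smul_equiv c d X)
  smul_add := by rintro c ⟨X⟩ ⟨Y⟩; exact Quotient.sound (smul_add_equiv c X Y)
  add_smul := by rintro c d ⟨X⟩; exact Quotient.sound (add_smul_equiv c d X)
  zero_smul := by rintro ⟨X⟩; exact Quotient.sound (zero_smul_equiv X)
  smul_zero := fun c => Quotient.sound (by
    obtain ⟨z, hz⟩ := exists_trivialMap (k := k) (P := P)
    obtain ⟨u, hu, hu'⟩ := exists_smulMap c (trivial k P)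
    exact equivalent_of_common (AlgHom.id k P) (fun x => ⟨x, rfl⟩) (u.comp z) z
      (fun x => (hu _).trans (hz x)) hz
      fun b hb => ⟨0, by rw [show b = 0 from hb, map_zero, zero_smul],
        by rw [show b = 0 from hb, map_zero, zero_smul]⟩)

end SmallExtClass

end Small

/-! ### Complete tensor products -/

section Tensor

variable (k : Type*) (R : Type*) [Field k] [Ring R] [Algebra k R]

/-- `𝔪_Aⁿ` as a `k`-subspace of `A`. -/
abbrev radPow (A : Type*) [Ring A] [Algebra k A] (n : ℕ) : Submodule k A :=
  (rad A ^ n).restrictScalars k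

/-- The projection `A / 𝔪_Aⁿ⁺¹ → A / 𝔪_Aⁿ`. -/
def radProj (A : Type*) [Ring A] [Algebra k A] (n : ℕ) :
    (A ⧸ radPow k A (n + 1)) →ₗ[k] (A ⧸ radPow k A n) :=
  Submodule.mapQ _ _ LinearMap.id fun _ hx => Ideal.pow_le_pow_right (Nat.le_succ n) hx

/-- The complete tensor product `M ⊗̂_k A = lim M ⊗_k A / 𝔪_Aⁿ` of a left `R`-module `M` with `A`,
as a left `R`-module. Its right `A`-module structure is `CTensor.rmul`. -/
def CTensor (M : Type*) [AddCommGroup M] [Module k M] [Module R M] [IsScalarTower k R M]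
    (A : Type*) [Ring A] [Algebra k A] :
    Submodule R (∀ n : ℕ, M ⊗[k] (A ⧸ radPow k A n)) where
  carrier := {x | ∀ n, TensorProduct.AlgebraTensorModule.map (LinearMap.id : M →ₗ[R] M)
    (radProj k A n) (x (n + 1)) = x n}
  zero_mem' := fun n => by simp
  add_mem' := fun hx hy n => by rw [Pi.add_apply, map_add, hx, hy, Pi.add_apply]
  smul_mem' := fun r x hx n => by rw [Pi.smul_apply, map_smul, hx, Pi.smul_apply]

namespace CTensor

variable {k R}
variable {M N : Type*} [AddCommGroup M] [Module k M] [Module R M] [IsScalarTower k R M]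
  [AddCommGroup N] [Module k N] [Module R N] [IsScalarTower k R N]
  {A B : Type*} [Ring A] [Algebra k A] [Ring B] [Algebra k B]

/-- The map `u ⊗̂ v` for an `R`-linear map `u` and a `k`-linear map `v` with `v(𝔪_Aⁿ) ⊆ 𝔪_Bⁿ`. -/
def map (u : M →ₗ[R] N) (v : A →ₗ[k] B) (hv : ∀ n, ∀ a ∈ rad A ^ n, v a ∈ rad B ^ n) :
    CTensor k R M A →ₗ[R] CTensor k R N B :=
  LinearMap.restrict
    (LinearMap.pi fun n => (TensorProduct.AlgebraTensorModule.map u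
      (Submodule.mapQ (radPow k A n) (radPow k B n) v (hv n))) ∘ₗ LinearMap.proj n)
    (fun x hx n => by
      have h : ∀ y : M ⊗[k] (A ⧸ radPow k A (n + 1)),
          TensorProduct.AlgebraTensorModule.map (LinearMap.id : N →ₗ[R] N) (radProj k B n)
            (TensorProduct.AlgebraTensorModule.map u
              (Submodule.mapQ (radPow k A (n + 1)) (radPow k B (n + 1)) v (hv (n + 1))) y) =
          TensorProduct.AlgebraTensorModule.map u
            (Submodule.mapQ (radPow k A n) (radPow k B n) v (hv n))
            (TensorProduct.AlgebraTensorModule.map (LinearMap.id : M →ₗ[R] M) (radProj k A n) y) := by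
        intro y
        induction y with
        | zero => simp
        | add y z hy hz => simp only [map_add, hy, hz]
        | tmul m a =>
          obtain ⟨a, rfl⟩ := Submodule.Quotient.mk_surjective _ a
          rfl
      have := h (x (n + 1))
      rw [hx n] at this
      exact this)

/-- Right multiplication by `a ∈ A` on `M ⊗̂_k A`. -/
def rmul (a : A) : CTensor k R M A →ₗ[R] CTensor k R M A :=
  map LinearMap.id (LinearMap.mulRight k a) fun _ _ h => Ideal.mul_mem_right _ _ h

/-- The map `1 ⊗̂ f : M ⊗̂_k A → M ⊗̂_k B` induced by a homomorphism `f : A → B`. -/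
def baseChange [IsCompleteLocal k A] [IsCompleteLocal k B] (f : A →ₐ[k] B) :
    CTensor k R M A →ₗ[R] CTensor k R M B :=
  map LinearMap.id f.toLinearMap fun n _ h => map_mem_rad_pow k f n h

/-- The map `σ ⊗̂ ε`, given by `x ⊗ a ↦ σ(x) ⊗ ε a`. -/
def tmulLeft (σ : M →ₗ[R] N) (ε : A) : CTensor k R M A →ₗ[R] CTensor k R N A :=
  map σ (LinearMap.mulLeft k ε) fun _ _ h => Ideal.mul_mem_left _ _ h

end CTensor

end Tensor

/-! ### Complexes, `Ext`, and lifts -/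

section Complexes

variable (k : Type u) {R : Type v} [Field k] [Ring R] [Algebra k R]
  (F : ChainComplex (ModuleCat.{w} R) ℤ)

/-- Families of `R`-linear maps `F_i → F_j`, for all `i` and `j`. -/
abbrev Family : Type w := ∀ i j : ℤ, F.X i →ₗ[R] F.X j

/-- The differential `d` of `F`. -/
def diff : Family F := fun i j => (F.d i j).hom

/-- Graded homomorphisms `F → F[n]`, i.e. families concentrated in the components
`F_i → F_{i+n}`. -/
def gradedHom (n : ℤ) : Submodule k (Family F) where
  carrier := {f | ∀ i j, j ≠ i + n → f i j = 0}
  zero_mem' := fun _ _ _ => rfl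
  add_mem' := fun hf hg i j h => by simp [hf i j h, hg i j h]
  smul_mem' := fun c f hf i j h => by simp [hf i j h]

/-- For a graded homomorphism `f` of degree `n`, the graded homomorphism
`f ∘ d + (-1)ⁿ⁺¹ d ∘ f` of degree `n - 1`. -/
def homDiff (n : ℤ) : Family F →ₗ[k] Family F where
  toFun f := fun i l => f (i - 1) l ∘ₗ diff F i (i - 1) +
    ((n + 1).negOnePow : ℤ) • (diff F (i + n) l ∘ₗ f i (i + n))
  map_add' f g := by
    funext i l
    simp only [Pi.add_apply, LinearMap.add_comp, LinearMap.comp_add, smul_add]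
    abel
  map_smul' c f := by
    funext i l
    ext x
    simp [smul_comm c]

/-- Chain homomorphisms `F → F` of degree `n`. -/
def chainHom (n : ℤ) : Submodule k (Family F) := gradedHom k F n ⊓ LinearMap.ker (homDiff k F n)

/-- Graded homomorphisms of degree `n` that are homotopic to zero: those of the form
`h ∘ d + (-1)ⁿ d ∘ h` with `h` graded of degree `n + 1`. -/
def nullHomotopic (n : ℤ) : Submodule k (Family F) :=
  (gradedHom k F (n + 1)).map (homDiff k F (n + 1))

/-- `Ext_R^i(F, F)` for a projective complex `F`: homotopy classes of chain homomorphisms of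
degree `-i`. -/
abbrev ExtGroup (i : ℤ) : Type w :=
  chainHom k F (-i) ⧸ (nullHomotopic k F (-i)).submoduleOf (chainHom k F (-i))

/-- Graded homomorphisms `F ⊗̂_k P → F ⊗̂_k P [n]` of left `R`- and right `P`-modules. -/
structure CHom (P : Type*) [Ring P] [Algebra k P] (n : ℤ) where
  /-- the components -/
  map : ∀ i j : ℤ, CTensor k R (F.X i) P →ₗ[R] CTensor k R (F.X j) P
  shape : ∀ i j, j ≠ i + n → map i j = 0
  map_rmul : ∀ i j (a : P) x, map i j (CTensor.rmul a x) = CTensor.rmul a (map i j x)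

/-- A lift `(F ⊗̂_k P, Δ)` of `F` to `P`: a graded homomorphism `Δ` of degree `-1` with `Δ² = 0`
and `Δ ⊗_P (P / 𝔪_P) = d ⊗ 1` on `F ⊗_k P / 𝔪_P ≅ F`. -/
structure Lift (P : Type*) [Ring P] [Algebra k P] extends CHom k F P (-1) where
  sq_zero : ∀ i j l x, map j l (map i j x) = 0
  reduction : ∀ i j (x : CTensor k R (F.X i) P),
    (map i j x).1 1 = TensorProduct.AlgebraTensorModule.map (diff F i j) LinearMap.id (x.1 1)

variable {k F}

section

variable {P Q : Type*} [Ring P] [Algebra k P] [Ring Q] [Algebra k Q]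
  [IsCompleteLocal k P] [IsCompleteLocal k Q]

/-- `Δ'` equals `Δ ⊗_P Q`, where `Q` is a `P`-algebra through `f : P → Q`; equivalently (when `f`
is surjective) `Δ` is a lifting of `Δ'` along `f`. -/
def IsBaseChange (f : P →ₐ[k] Q) {n : ℤ} (Δ : CHom k F P n) (Δ' : CHom k F Q n) : Prop :=
  ∀ i j x, Δ'.map i j (CTensor.baseChange f x) = CTensor.baseChange f (Δ.map i j x)

/-- Isomorphism of two lifts to `P` as complexes of left `R`- and right `P`-modules. -/
def Lift.IsIso (L L' : Lift k F P) : Prop :=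
  ∃ φ : ∀ i : ℤ, CTensor k R (F.X i) P ≃ₗ[R] CTensor k R (F.X i) P,
    (∀ i (a : P) x, φ i (CTensor.rmul a x) = CTensor.rmul a (φ i x)) ∧
    ∀ i j x, φ j (L.map i j x) = L'.map i j (φ i x)

end

variable {P : Type u} [Ring P] [Algebra k P] [IsCompleteLocal k P]

/-- A lift `L` to `P` is universal if for each artinian local `k`-algebra `A` with residue field
`k` (that is, each finite-dimensional complete local `k`-algebra) `f ↦ L ⊗_P A` (along `f`) is a
bijection from the `k`-algebra homomorphisms `P → A` to the isomorphism classes of lifts of `F`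
to `A`. -/
def Lift.IsUniversal (L : Lift k F P) : Prop :=
  ∀ (A : Type u) [Ring A] [Algebra k A] [IsCompleteLocal k A] [Module.Finite k A]
    (M : Lift k F A), ∃! f : P →ₐ[k] A,
      ∃ M' : Lift k F A, IsBaseChange f L.toCHom M'.toCHom ∧ M'.IsIso M

/-- A lift `L` to `P` is maximal if it cannot be lifted further along a proper surjection
`q : Q → P` of complete local algebras inducing an isomorphism `𝔪_Q / 𝔪_Q² ≅ 𝔪_P / 𝔪_P²` (i.e.
with kernel in `𝔪_Q²`). Writing `P = T / I` with `T` a ring of noncommutative formal power series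
and `I ⊆ 𝔪_T²` closed, these are the projections `T / I' → T / I` with `I' ⊆ I` closed. -/
def Lift.IsMaximal (L : Lift k F P) : Prop :=
  ∀ (Q : Type u) [Ring Q] [Algebra k Q] [IsCompleteLocal k Q] (q : Q →ₐ[k] P),
    Function.Surjective q → (∀ x, q x = 0 → x ∈ rad Q ^ 2) →
    (∃ M : Lift k F Q, IsBaseChange q M.toCHom L.toCHom) → Function.Injective q

/-- The linear map `α` is the obstruction map of the lift `L`: for each small extension
`(E, ε)` of `P`, the map `Δ` lifts to a graded homomorphism `Δ'` on `F ⊗̂_k E`, and for each such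
`Δ'` there is a chain homomorphism `σ` of degree `-2` with `Δ'² = σ ⊗ ε` and `α [E, ε] = [σ]`. -/
def IsObstructionMap (L : Lift k F P) (α : SmallExtClass k P →ₗ[k] ExtGroup k F 2) : Prop :=
  ∀ X : SmallExtension k P,
    (∃ Δ' : CHom k F X.E (-1), IsBaseChange X.π Δ' L.toCHom) ∧
    ∀ Δ' : CHom k F X.E (-1), IsBaseChange X.π Δ' L.toCHom →
      ∃ σ : chainHom k F (-2),
        (∀ i l x, Δ'.map (i - 1) l (Δ'.map i (i - 1) x) =
          CTensor.tmulLeft ((σ : Family F) i l) X.ε x) ∧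
        α (SmallExtClass.mk X) = Submodule.Quotient.mk σ

end Complexes

end ComplexLift

/-!
The obstruction map of a lift is computed on `F` alone: a right `A`-linear map out of the complete
tensor product `M ⊗̂_k A` is automatically continuous, because finite dimensionality of
`𝔪_A / 𝔪_A²` makes the kernel of `M ⊗̂_k A → M ⊗ A / 𝔪_Aⁿ` algebraically generated by multiples by
elements of `𝔪_Aⁿ` (`CTensor.exists_eq_sum_rmul`, `CTensor.isFiltered_of_semilinear`). Hence such a
map is determined by its values on the elements `m ⊗ 1` (`CTensor.semilinear_ext`), and these can be
prescribed arbitrarily (`CTensor.extend`). In particular graded homomorphisms can be pushed forward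
along every algebra homomorphism, and by projectivity of `F` they lift along surjections.

For a small extension `E → P` the kernel of `M ⊗̂_k E → M ⊗̂_k P` is `M ⊗ ε`. If `Δ` on `F ⊗̂_k E`
lifts the differential over `P`, then `Δ²` vanishes over `P`, so `Δ² = σ ⊗ ε`; associativity
`Δ Δ² = Δ² Δ` says that `σ` is a chain homomorphism, and replacing `Δ` by `Δ + h ⊗ ε` adds the
boundary of `h` to `σ`. So `[σ]` is well defined, and if `[σ] = 0` then the lift extends to `E`.
Invariance under equivalence, additivity and homogeneity all follow from one naturality statement
(`obstructionClass_relation`): if a complete local algebra `B` over `P` maps to three small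
extensions, the differential lifts to `B`, and its square there specializes to the three
obstructions, so that a linear relation between the three functionals on the kernel of `B → P` holds
for the obstruction classes.

For injectivity, let the obstruction in `E` vanish, so that the lift extends to `E`; the extension
`E` has to be trivial. If the lift is maximal, then `ε ∉ 𝔪_E²`, and a functional separating `ε` from
`𝔪_E²` splits `E → P` (`SmallExtension.equiv_trivial_of_ε_notMem`). If it is universal, the extended
lift modulo powers of `𝔪_E` is classified by compatible homomorphisms `P → E / 𝔪_Eⁿ`, whose limit
`P → E` is a section of `E → P` by uniqueness (`Lift.IsUniversal.exists_section`).
-/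

namespace ComplexLift

/-! ### Powers of the radical -/

section Radical

variable (k : Type*) {A B : Type*} [Field k] [Ring A] [Algebra k A] [Ring B] [Algebra k B]

theorem mul_mem_rad_pow_add {m n : ℕ} {a b : A} (ha : a ∈ rad A ^ m) (hb : b ∈ rad A ^ n) :
    a * b ∈ rad A ^ (m + n) := by
  induction n generalizing b with
  | zero => simpa using Ideal.mul_mem_right b _ ha
  | succ n ih =>
    rw [Submodule.pow_succ] at hb
    induction hb using Submodule.mul_induction_on' with
    | mem_mul_mem x hx y hy =>
      rw [← add_assoc, Submodule.pow_succ, ← mul_assoc]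
      exact Ideal.mul_mem_mul (ih hx) hy
    | add x _ y _ hx hy => rw [mul_add]; exact add_mem hx hy

theorem mul_mem_rad_pow_succ {n : ℕ} {a b : A} (ha : a ∈ rad A ^ n) (hb : b ∈ rad A) :
    a * b ∈ rad A ^ (n + 1) := by
  rw [Submodule.pow_succ]; exact Ideal.mul_mem_mul ha hb

theorem algebra_smul_mem {I : Ideal A} (c : k) {a : A} (ha : a ∈ I) : c • a ∈ I := by
  rw [Algebra.smul_def]; exact Ideal.mul_mem_left _ _ ha

/-- A surjection of complete local algebras is surjective on each power of the radical. -/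
theorem exists_mem_rad_pow_map_eq [IsCompleteLocal k A] [IsCompleteLocal k B] (p : A →ₐ[k] B)
    (hp : Function.Surjective p) (n : ℕ) {b : B} (hb : b ∈ rad B ^ n) :
    ∃ a ∈ rad A ^ n, p a = b := by
  induction n generalizing b with
  | zero => obtain ⟨a, ha⟩ := hp b; exact ⟨a, by simp [Submodule.pow_zero], ha⟩
  | succ n ih =>
    rw [Submodule.pow_succ] at hb
    induction hb using Submodule.mul_induction_on' with
    | mem_mul_mem a ha b hb =>
      obtain ⟨x, hx, rfl⟩ := ih ha
      obtain ⟨z, rfl⟩ := hp b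
      refine ⟨x * z, mul_mem_rad_pow_succ hx ?_, by simp⟩
      rwa [mem_rad_iff k, ← residue_map k p, ← mem_rad_iff k]
    | add a _ b _ ha hb =>
      obtain ⟨x, hx, rfl⟩ := ha
      obtain ⟨z, hz, rfl⟩ := hb
      exact ⟨x + z, add_mem hx hz, by simp⟩

/-- The radical is generated, as a left ideal and compatibly with the filtration by its powers, by
finitely many elements. -/
theorem exists_finset_rad_generators (A : Type*) [Ring A] [Algebra k A] [IsCompleteLocal k A] :
    ∃ s : Finset A, (∀ v ∈ s, v ∈ rad A) ∧ ∀ n, ∀ a ∈ rad A ^ (n + 1),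
      ∃ c : A → A, (∀ v, c v ∈ rad A ^ n) ∧ a - ∑ v ∈ s, c v * v ∈ rad A ^ (n + 2) := by
  obtain ⟨V, hV, h⟩ := (finite_cotangent_iff k).1
    (IsCompleteLocal.finite_cotangent : Module.Finite k (rad A ⧸ _))
  have : Module.Finite k V := Module.Finite.iff_fg.2 hV
  -- `V` need not lie in the radical, but the representatives of elements of the radical do.
  obtain ⟨s, hs⟩ := Module.Finite.iff_fg.1
    (Submodule.finiteDimensional_inf_left V ((rad A).restrictScalars k))
  have hsr : ∀ v ∈ s, v ∈ rad A := fun v hv =>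
    ((hs ▸ Submodule.subset_span hv : v ∈ V ⊓ (rad A).restrictScalars k)).2
  refine ⟨s, hsr, fun n a ha => ?_⟩
  rw [Submodule.pow_succ] at ha
  induction ha using Submodule.mul_induction_on' with
  | mem_mul_mem a ha b hb =>
    obtain ⟨v, hv, hv'⟩ := h b hb
    have hvr : v ∈ rad A := by
      have := sub_mem hb ((Ideal.pow_le_self two_ne_zero : rad A ^ 2 ≤ rad A) hv')
      simpa using this
    have hv2 : v ∈ Submodule.span k (s : Set A) := by rw [hs]; exact ⟨hv, hvr⟩
    obtain ⟨f, -, hf⟩ := Submodule.mem_span_finset.1 hv2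
    refine ⟨fun v => f v • a, fun v => algebra_smul_mem k _ ha, ?_⟩
    have : a * b - ∑ v ∈ s, (f v • a) * v = a * (b - v) := by
      rw [mul_sub, ← hf, Finset.mul_sum]
      simp
    rw [this]
    exact mul_mem_rad_pow_add ha hv'
  | add a _ b _ ha hb =>
    obtain ⟨c, hc, hc'⟩ := ha
    obtain ⟨d, hd, hd'⟩ := hb
    refine ⟨c + d, fun v => add_mem (hc v) (hd v), ?_⟩
    have := add_mem hc' hd'
    convert! this using 1
    simp only [Pi.add_apply, add_mul, Finset.sum_add_distrib]
    abel

end Radical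

/-! ### Complete tensor products -/

section KerTensor

variable {k R : Type*} [Field k] [Ring R] [Algebra k R]
  {M : Type*} [AddCommGroup M] [Module k M] [Module R M] [IsScalarTower k R M]

/-- Right exactness of `M ⊗ -`, in terms of generators of the kernel. -/
theorem mem_closure_of_map_eq_zero {U V : Type*} [AddCommGroup U] [Module k U] [AddCommGroup V]
    [Module k V] (q : U →ₗ[k] V) (hq : Function.Surjective q) (z : M ⊗[k] U)
    (hz : TensorProduct.AlgebraTensorModule.map (LinearMap.id : M →ₗ[R] M) q z = 0) :
    z ∈ AddSubgroup.closure {y | ∃ (m : M) (a : U), q a = 0 ∧ y = m ⊗ₜ[k] a} := by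
  have hex : Function.Exact (LinearMap.ker q).subtype q := fun x => by simp
  obtain ⟨w, rfl⟩ := (lTensor_exact M hex hq z).1 hz
  induction w with
  | zero => simp
  | add x y hx hy =>
    rw [map_add] at hz ⊢
    have h : ∀ w : M ⊗[k] (LinearMap.ker q),
        TensorProduct.AlgebraTensorModule.map (LinearMap.id : M →ₗ[R] M) q
          ((LinearMap.lTensor M (LinearMap.ker q).subtype) w) = 0 := fun w =>
      (lTensor_exact M hex hq _).2 ⟨w, rfl⟩
    exact add_mem (hx (h x)) (hy (h y))
  | tmul m a => exact AddSubgroup.subset_closure ⟨m, a, a.2, rfl⟩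

end KerTensor

namespace CTensor

variable {k R : Type*} [Field k] [Ring R] [Algebra k R]
  {M N : Type*} [AddCommGroup M] [Module k M] [Module R M] [IsScalarTower k R M]
  [AddCommGroup N] [Module k N] [Module R N] [IsScalarTower k R N]
  {L : Type*} [AddCommGroup L] [Module k L] [Module R L] [IsScalarTower k R L]
  {A B C : Type*} [Ring A] [Algebra k A] [Ring B] [Algebra k B] [Ring C] [Algebra k C]

theorem ext_level {x y : CTensor k R M A} (h : ∀ n, x.1 n = y.1 n) : x = y :=
  Subtype.ext (funext h)

theorem map_level (u : M →ₗ[R] N) (v : A →ₗ[k] B) (hv : ∀ n, ∀ a ∈ rad A ^ n, v a ∈ rad B ^ n)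
    (x : CTensor k R M A) (n : ℕ) : (map u v hv x).1 n =
      TensorProduct.AlgebraTensorModule.map u
        (Submodule.mapQ (radPow k A n) (radPow k B n) v (hv n)) (x.1 n) := rfl

theorem map_level_congr (u : M →ₗ[R] N) (v : A →ₗ[k] B)
    (hv : ∀ n, ∀ a ∈ rad A ^ n, v a ∈ rad B ^ n)
    {x y : CTensor k R M A} {n : ℕ} (h : x.1 n = y.1 n) :
    (map u v hv x).1 n = (map u v hv y).1 n := by
  rw [map_level, map_level, h]

theorem add_level (x y : CTensor k R M A) (n : ℕ) : (x + y).1 n = x.1 n + y.1 n := rfl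
theorem sub_level (x y : CTensor k R M A) (n : ℕ) : (x - y).1 n = x.1 n - y.1 n := rfl
theorem zero_level (n : ℕ) : (0 : CTensor k R M A).1 n = 0 := rfl

/-- The element `m ⊗ a` of `M ⊗̂_k A`, as an `R`-linear function of `m`. -/
def incl (a : A) : M →ₗ[R] CTensor k R M A where
  toFun m := ⟨fun _ => m ⊗ₜ[k] Submodule.Quotient.mk a, fun _ => rfl⟩
  map_add' _ _ := ext_level fun _ => TensorProduct.add_tmul _ _ _
  map_smul' _ _ := ext_level fun _ => rfl

theorem incl_level (a : A) (m : M) (n : ℕ) :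
    (incl (k := k) (R := R) a m).1 n = m ⊗ₜ[k] Submodule.Quotient.mk a := rfl

theorem map_incl (u : M →ₗ[R] N) (v : A →ₗ[k] B) (hv) (a : A) (m : M) :
    map u v hv (incl a m) = incl (v a) (u m) := rfl

theorem rmul_incl (a b : A) (m : M) :
    rmul b (incl (k := k) (R := R) a m) = incl (a * b) m := rfl

theorem tmulLeft_incl (σ : M →ₗ[R] N) (a b : A) (m : M) :
    tmulLeft (k := k) σ b (incl a m) = incl (b * a) (σ m) := rfl

theorem baseChange_incl [IsCompleteLocal k A] [IsCompleteLocal k B] (f : A →ₐ[k] B) (a : A)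
    (m : M) : baseChange (R := R) f (incl a m) = incl (f a) m := rfl

theorem incl_zero (m : M) : incl (k := k) (R := R) (0 : A) m = 0 :=
  ext_level fun _ => TensorProduct.tmul_zero _ _

theorem incl_add (a b : A) (m : M) :
    incl (k := k) (R := R) (a + b) m = incl a m + incl b m :=
  ext_level fun n => TensorProduct.tmul_add m (Submodule.Quotient.mk a : A ⧸ radPow k A n)
    (Submodule.Quotient.mk b)

theorem incl_smul (c : k) (a : A) (m : M) :
    incl (k := k) (R := R) (c • a) m = incl a (c • m) :=
  ext_level fun n =>
    (TensorProduct.smul_tmul c m (Submodule.Quotient.mk a : A ⧸ radPow k A n)).symm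

theorem incl_level_eq_zero {a : A} {n : ℕ} (ha : a ∈ rad A ^ n) (m : M) :
    (incl (k := k) (R := R) a m).1 n = 0 := by
  have : (Submodule.Quotient.mk a : A ⧸ radPow k A n) = 0 :=
    (Submodule.Quotient.mk_eq_zero _).2 ha
  rw [incl_level, this, TensorProduct.tmul_zero]

theorem level_eq_zero_of_le {x : CTensor k R M A} {m n : ℕ} (hmn : m ≤ n) (h : x.1 n = 0) :
    x.1 m = 0 := by
  induction n, hmn using Nat.le_induction with
  | base => exact h
  | succ n _ ih => exact ih (by rw [← x.2 n, h, map_zero])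

theorem level_eq_of_le {x y : CTensor k R M A} {m n : ℕ} (hmn : m ≤ n) (h : x.1 n = y.1 n) :
    x.1 m = y.1 m := by
  rw [← sub_eq_zero] at h ⊢
  exact level_eq_zero_of_le (x := x - y) hmn h

theorem level_zero (x : CTensor k R M A) : x.1 0 = 0 := by
  induction x.1 0 with
  | zero => rfl
  | add y z hy hz => rw [hy, hz, add_zero]
  | tmul m a =>
    obtain ⟨a, rfl⟩ := Submodule.Quotient.mk_surjective _ a
    exact incl_level_eq_zero (k := k) (R := R) (by simp [Submodule.pow_zero]) m

variable (k R M) in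
/-- The subgroup of `M ⊗̂_k A` generated by the elements `m ⊗ a` with `a ∈ K`. -/
def tensors (K : Set A) : AddSubgroup (CTensor k R M A) :=
  AddSubgroup.closure {y | ∃ a ∈ K, ∃ m : M, y = incl a m}

theorem incl_mem_tensors {K : Set A} {a : A} (ha : a ∈ K) (m : M) :
    incl a m ∈ tensors k R M K := AddSubgroup.subset_closure ⟨a, ha, m, rfl⟩

theorem tensors_level_eq_zero {n : ℕ} {y : CTensor k R M A}
    (hy : y ∈ tensors k R M (rad A ^ n : Ideal A)) : y.1 n = 0 := by
  induction hy using AddSubgroup.closure_induction with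
  | mem y hy => obtain ⟨a, ha, m, rfl⟩ := hy; exact incl_level_eq_zero ha m
  | zero => rfl
  | add x y _ _ hx hy => rw [add_level, hx, hy, add_zero]
  | neg x _ hx => exact neg_eq_zero.2 hx

/-- The kernel of `M ⊗ A / 𝔪_Aⁿ → M ⊗ W`, for a surjection `A / 𝔪_Aⁿ → W`, is generated by tensors
`m ⊗ a` with `a ∈ K`, if the kernel of `A / 𝔪_Aⁿ → W` is represented by elements of `K`. -/
theorem exists_tensors_level_eq {W : Type*} [AddCommGroup W] [Module k W] {n : ℕ}
    (q : (A ⧸ radPow k A n) →ₗ[k] W) (hq : Function.Surjective q) (K : Set A)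
    (hK : ∀ a : A, q (Submodule.Quotient.mk a) = 0 → ∃ b ∈ K, a - b ∈ rad A ^ n)
    (z : M ⊗[k] (A ⧸ radPow k A n))
    (hz : TensorProduct.AlgebraTensorModule.map (LinearMap.id : M →ₗ[R] M) q z = 0) :
    ∃ y ∈ tensors k R M K, z = y.1 n := by
  have h := mem_closure_of_map_eq_zero q hq z hz
  induction h using AddSubgroup.closure_induction with
  | mem y hy =>
    obtain ⟨m, a, ha, rfl⟩ := hy
    obtain ⟨a, rfl⟩ := Submodule.Quotient.mk_surjective _ a
    obtain ⟨b, hb, hab⟩ := hK a ha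
    refine ⟨incl b m, incl_mem_tensors hb m, ?_⟩
    rw [incl_level, (Submodule.Quotient.eq _).2 (show a - b ∈ radPow k A n from hab)]
  | zero => exact ⟨0, zero_mem _, rfl⟩
  | add x y hx' hy' hx hy =>
    have hx0 : ∀ w ∈ AddSubgroup.closure
        {y | ∃ (m : M) (a : A ⧸ radPow k A n), q a = 0 ∧ y = m ⊗ₜ[k] a},
        TensorProduct.AlgebraTensorModule.map (LinearMap.id : M →ₗ[R] M) q w = 0 := by
      intro w hw
      induction hw using AddSubgroup.closure_induction with
      | mem y hy => obtain ⟨m, a, ha, rfl⟩ := hy; simp [ha]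
      | zero => simp
      | add x y _ _ hx hy => rw [map_add, hx, hy, add_zero]
      | neg x _ hx => rw [map_neg, hx, neg_zero]
    obtain ⟨x', hx1, hx2⟩ := hx (hx0 x hx')
    obtain ⟨y', hy1, hy2⟩ := hy (hx0 y hy')
    exact ⟨x' + y', add_mem hx1 hy1, by rw [hx2, hy2]; rfl⟩
  | neg x _ hx =>
    obtain ⟨x', hx1, hx2⟩ := hx (by simpa using hz)
    exact ⟨-x', neg_mem hx1, by rw [hx2]; rfl⟩

theorem exists_tensors_univ (x : CTensor k R M A) (n : ℕ) :
    ∃ y ∈ tensors k R M (Set.univ : Set A), x.1 n = y.1 n :=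
  exists_tensors_level_eq (W := PUnit) 0 (fun _ => ⟨0, rfl⟩) _
    (fun a _ => ⟨a, trivial, by simp⟩) _ (Subsingleton.elim (α := M ⊗[k] PUnit) _ _)

/-- A linear map between complete tensor products is filtered if it maps the kernel of the
reduction modulo `𝔪_Aⁿ` to the kernel of the reduction modulo `𝔪_Bⁿ`. -/
def IsFiltered (f : CTensor k R M A →ₗ[R] CTensor k R N B) : Prop :=
  ∀ n x, x.1 n = 0 → (f x).1 n = 0

theorem isFiltered_map (u : M →ₗ[R] N) (v : A →ₗ[k] B) (hv) : IsFiltered (R := R) (map u v hv) :=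
  fun _ _ h => (map_level_congr (y := 0) _ _ _ h).trans (by rw [map_zero, zero_level])

theorem isFiltered_id : IsFiltered (LinearMap.id : CTensor k R M A →ₗ[R] _) := fun _ _ h => h

theorem IsFiltered.comp {g : CTensor k R N B →ₗ[R] CTensor k R L C}
    {f : CTensor k R M A →ₗ[R] CTensor k R N B} (hg : IsFiltered g) (hf : IsFiltered f) :
    IsFiltered (g ∘ₗ f) := fun n _ h => hg n _ (hf n _ h)

theorem IsFiltered.level_congr {f : CTensor k R M A →ₗ[R] CTensor k R N B} (hf : IsFiltered f)
    {n : ℕ} {x y : CTensor k R M A} (h : x.1 n = y.1 n) : (f x).1 n = (f y).1 n := by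
  rw [← sub_eq_zero] at h ⊢
  exact (congrArg (fun z : CTensor k R N B => z.1 n) (map_sub f x y)).symm.trans (hf n (x - y) h)

theorem isFiltered_rmul (a : A) : IsFiltered (rmul a : CTensor k R M A →ₗ[R] _) :=
  isFiltered_map _ _ _

theorem isFiltered_tmulLeft (σ : M →ₗ[R] N) (a : A) : IsFiltered (tmulLeft (k := k) σ a) :=
  isFiltered_map _ _ _

theorem isFiltered_baseChange [IsCompleteLocal k A] [IsCompleteLocal k B] (f : A →ₐ[k] B) :
    IsFiltered (baseChange f : CTensor k R M A →ₗ[R] _) :=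
  isFiltered_map _ _ _

/-- Filtered linear maps are determined by their values on the elements `m ⊗ a`. -/
theorem IsFiltered.ext {f g : CTensor k R M A →ₗ[R] CTensor k R N B} (hf : IsFiltered f)
    (hg : IsFiltered g) (h : ∀ a m, f (incl a m) = g (incl a m)) : f = g := by
  refine LinearMap.ext fun x => ext_level fun n => ?_
  obtain ⟨y, hy, hxy⟩ := exists_tensors_univ x n
  rw [hf.level_congr hxy, hg.level_congr hxy]
  suffices hfg : f y = g y by rw [hfg]
  clear hxy
  induction hy using AddSubgroup.closure_induction with
  | mem y hy => obtain ⟨a, -, m, rfl⟩ := hy; exact h a m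
  | zero => rw [map_zero, map_zero]
  | add x y _ _ hx hy => rw [map_add, map_add, hx, hy]
  | neg x _ hx => rw [map_neg, map_neg, hx]

theorem rmul_rmul (a b : A) (x : CTensor k R M A) : rmul a (rmul b x) = rmul (b * a) x := by
  have : rmul a ∘ₗ rmul b = (rmul (b * a) : CTensor k R M A →ₗ[R] _) :=
    ((isFiltered_rmul a).comp (isFiltered_rmul b)).ext (isFiltered_rmul _) fun c m => by
      rw [LinearMap.comp_apply, rmul_incl, rmul_incl, rmul_incl, mul_assoc]
  exact LinearMap.congr_fun this x

theorem rmul_one (x : CTensor k R M A) : rmul (1 : A) x = x := by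
  have : rmul (1 : A) = (LinearMap.id : CTensor k R M A →ₗ[R] _) :=
    (isFiltered_rmul _).ext isFiltered_id fun c m => by rw [rmul_incl, mul_one]; rfl
  exact LinearMap.congr_fun this x

theorem tmulLeft_rmul (σ : M →ₗ[R] N) (a b : A) (x : CTensor k R M A) :
    tmulLeft σ b (rmul a x) = rmul a (tmulLeft σ b x) := by
  have : tmulLeft σ b ∘ₗ rmul a = rmul a ∘ₗ tmulLeft (k := k) σ b :=
    ((isFiltered_tmulLeft σ b).comp (isFiltered_rmul a)).ext
      ((isFiltered_rmul a).comp (isFiltered_tmulLeft σ b)) fun c m => by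
      rw [LinearMap.comp_apply, LinearMap.comp_apply, rmul_incl, tmulLeft_incl, tmulLeft_incl,
        rmul_incl, mul_assoc]
  exact LinearMap.congr_fun this x

theorem baseChange_rmul [IsCompleteLocal k A] [IsCompleteLocal k B] (f : A →ₐ[k] B) (a : A)
    (x : CTensor k R M A) : baseChange f (rmul a x) = rmul (f a) (baseChange f x) := by
  have : baseChange f ∘ₗ rmul a =
      rmul (f a) ∘ₗ (baseChange f : CTensor k R M A →ₗ[R] CTensor k R M B) :=
    ((isFiltered_baseChange f).comp (isFiltered_rmul a)).ext
      ((isFiltered_rmul _).comp (isFiltered_baseChange f)) fun c m => by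
      rw [LinearMap.comp_apply, LinearMap.comp_apply, rmul_incl, baseChange_incl,
        baseChange_incl, rmul_incl, map_mul]
  exact LinearMap.congr_fun this x

theorem baseChange_baseChange [IsCompleteLocal k A] [IsCompleteLocal k B] [IsCompleteLocal k C]
    (f : A →ₐ[k] B) (g : B →ₐ[k] C) (x : CTensor k R M A) :
    baseChange g (baseChange f x) = baseChange (g.comp f) x := by
  have : baseChange g ∘ₗ baseChange f =
      (baseChange (g.comp f) : CTensor k R M A →ₗ[R] CTensor k R M C) :=
    ((isFiltered_baseChange g).comp (isFiltered_baseChange f)).ext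
      (isFiltered_baseChange _) fun c m => by
      rw [LinearMap.comp_apply, baseChange_incl, baseChange_incl, baseChange_incl]; rfl
  exact LinearMap.congr_fun this x

/-- An element vanishing modulo `𝔪_Aⁿ` agrees modulo `𝔪_Aⁿ⁺¹` with a finite sum of elements `m ⊗ a`
with `a ∈ 𝔪_Aⁿ`. -/
theorem exists_tensors_of_level_eq_zero {x : CTensor k R M A} {n : ℕ} (h : x.1 n = 0) :
    ∃ y ∈ tensors k R M (rad A ^ n : Ideal A), x.1 (n + 1) = y.1 (n + 1) := by
  refine exists_tensors_level_eq (radProj k A n) ?_ _ ?_ _ ((x.2 n).trans h)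
  · intro a
    obtain ⟨a, rfl⟩ := Submodule.Quotient.mk_surjective _ a
    exact ⟨Submodule.Quotient.mk a, rfl⟩
  · intro a ha
    exact ⟨a, (Submodule.Quotient.mk_eq_zero _).1 ha, by simp⟩

/-- An element whose image in `M ⊗̂_k B` vanishes modulo `𝔪_Bⁿ` agrees modulo `𝔪_Aⁿ` with a finite
sum of elements `m ⊗ a` with `p(a) = 0`. -/
theorem exists_tensors_of_baseChange_level_eq_zero [IsCompleteLocal k A] [IsCompleteLocal k B]
    (p : A →ₐ[k] B) (hp : Function.Surjective p) {x : CTensor k R M A} {n : ℕ}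
    (h : (baseChange p x).1 n = 0) :
    ∃ y ∈ tensors k R M {a | p a = 0}, x.1 n = y.1 n := by
  refine exists_tensors_level_eq _ ?_ _ ?_ _ h
  · intro b
    obtain ⟨b, rfl⟩ := Submodule.Quotient.mk_surjective _ b
    obtain ⟨a, rfl⟩ := hp b
    exact ⟨Submodule.Quotient.mk a, rfl⟩
  · intro a ha
    obtain ⟨r, hr, hr'⟩ := exists_mem_rad_pow_map_eq k p hp n
      ((Submodule.Quotient.mk_eq_zero _).1 ha : p a ∈ rad B ^ n)
    exact ⟨a - r, by simp [hr'], by simpa using hr⟩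

theorem rmul_level_succ_eq_zero {x : CTensor k R M A} {n : ℕ} (h : x.1 n = 0) {b : A}
    (hb : b ∈ rad A) : (rmul b x).1 (n + 1) = 0 := by
  obtain ⟨y, hy, hxy⟩ := exists_tensors_of_level_eq_zero h
  refine (map_level_congr _ _ _ hxy).trans ?_
  change (rmul b y).1 (n + 1) = 0
  clear hxy
  induction hy using AddSubgroup.closure_induction with
  | mem y hy =>
    obtain ⟨a, ha, m, rfl⟩ := hy
    rw [rmul_incl]
    exact incl_level_eq_zero (mul_mem_rad_pow_succ ha hb) m
  | zero => rw [map_zero, zero_level]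
  | add x y _ _ hx hy => rw [map_add, add_level, hx, hy, add_zero]
  | neg x _ hx => rw [map_neg]; exact neg_eq_zero.2 hx

/-- Completeness: a series whose `j`-th term vanishes modulo `𝔪_Aʲ` converges. -/
theorem exists_sum_levels (y : ℕ → CTensor k R M A) (hy : ∀ j, (y j).1 j = 0) :
    ∃ Y : CTensor k R M A, ∀ n, Y.1 n = (∑ j ∈ Finset.range n, y j).1 n := by
  refine ⟨⟨fun n => (∑ j ∈ Finset.range n, y j).1 n, fun n => ?_⟩, fun n => rfl⟩
  rw [(∑ j ∈ Finset.range (n + 1), y j).2 n, Finset.sum_range_succ, add_level, hy, add_zero]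

/-- Successive approximation: an additive map between complete tensor products that shifts the
filtration by `s` and is surjective on associated graded pieces is surjective on each filtration
step. -/
theorem exists_eq_of_approx {ι : Type*} (G : (ι → CTensor k R M A) →+ CTensor k R N B) (s : ℕ)
    (hG : ∀ n y, (∀ i, (y i).1 n = 0) → (G y).1 (n + s) = 0)
    (h : ∀ n x, x.1 (n + s) = 0 → ∃ y, (∀ i, (y i).1 n = 0) ∧ (x - G y).1 (n + 1 + s) = 0)
    (n : ℕ) (x : CTensor k R N B) (hx : x.1 (n + s) = 0) :
    ∃ y, (∀ i, (y i).1 n = 0) ∧ G y = x := by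
  choose Y hY hY' using h
  -- `z j` is the error left after `j` corrections, and `y j` is the next correction.
  let z : ∀ j : ℕ, {x : CTensor k R N B // x.1 (n + j + s) = 0} := fun j =>
    Nat.rec ⟨x, hx⟩ (fun j z => ⟨z.1 - G (Y (n + j) z.1 z.2), hY' (n + j) z.1 z.2⟩) j
  let y : ℕ → ι → CTensor k R M A := fun j => Y (n + j) (z j).1 (z j).2
  have hy : ∀ j i, (y j i).1 (n + j) = 0 := fun j => hY _ _ _
  have hz : ∀ j, x - G (∑ i ∈ Finset.range j, y i) = (z j).1 := by
    intro j
    induction j with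
    | zero => rw [Finset.sum_range_zero, map_zero, sub_zero]; rfl
    | succ j ih => rw [Finset.sum_range_succ, map_add, ← sub_sub, ih]
  -- The corrections tend to zero, so they sum to an element of the complete tensor product.
  choose Z hZ using fun i => exists_sum_levels (fun j => y j i)
    (fun j => level_eq_zero_of_le (Nat.le_add_left j n) (hy j i))
  refine ⟨Z, fun i => ?_, ext_level fun m => ?_⟩
  · rw [hZ]
    have : ∀ m, (∑ j ∈ Finset.range m, y j i).1 n = 0 := by
      intro m
      induction m with
      | zero => rfl
      | succ m ih =>
        rw [Finset.sum_range_succ, add_level, ih, zero_add]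
        exact level_eq_zero_of_le (Nat.le_add_right n m) (hy m i)
    exact this n
  · have h1 : (G (Z - ∑ j ∈ Finset.range m, y j)).1 (m + s) = 0 := hG m _ fun i => by
      rw [Pi.sub_apply, Finset.sum_apply, sub_level, hZ, sub_self]
    have h2 := level_eq_zero_of_le (Nat.le_add_right m s) h1
    have h3 : (z m).1.1 m = 0 := level_eq_zero_of_le (by omega) (z m).2
    rw [← hz m, sub_level, sub_eq_zero] at h3
    rw [map_sub, sub_level, sub_eq_zero] at h2
    rw [h2, h3]

/-- Base change along a surjection of complete local algebras is surjective. -/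
theorem baseChange_surjective [IsCompleteLocal k A] [IsCompleteLocal k B] (p : A →ₐ[k] B)
    (hp : Function.Surjective p) :
    Function.Surjective (baseChange p : CTensor k R M A →ₗ[R] CTensor k R M B) := by
  intro x
  suffices h : ∃ y : Unit → CTensor k R M A, (∀ i, (y i).1 0 = 0) ∧
      ((baseChange p : CTensor k R M A →ₗ[R] CTensor k R M B).toAddMonoidHom.comp
        (Pi.evalAddMonoidHom _ ())) y = x by
    obtain ⟨y, -, hy⟩ := h
    exact ⟨y (), hy⟩
  refine exists_eq_of_approx _ 0 ?_ ?_ 0 x (level_zero x)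
  · intro n y hy
    exact isFiltered_baseChange p n _ (hy ())
  · intro n x hx
    obtain ⟨y, hy, hxy⟩ := exists_tensors_of_level_eq_zero hx
    have : ∃ z : CTensor k R M A, z.1 n = 0 ∧ baseChange p z = y := by
      clear hxy
      induction hy using AddSubgroup.closure_induction with
      | mem y hy =>
        obtain ⟨b, hb, m, rfl⟩ := hy
        obtain ⟨a, ha, rfl⟩ := exists_mem_rad_pow_map_eq k p hp n hb
        exact ⟨incl a m, incl_level_eq_zero ha m, rfl⟩
      | zero => exact ⟨0, rfl, map_zero _⟩
      | add x y _ _ hx hy =>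
        obtain ⟨x, hx, rfl⟩ := hx
        obtain ⟨y, hy, rfl⟩ := hy
        exact ⟨x + y, by rw [add_level, hx, hy, add_zero], map_add _ _ _⟩
      | neg x _ hx =>
        obtain ⟨x, hx, rfl⟩ := hx
        exact ⟨-x, neg_eq_zero.2 hx, map_neg _ _⟩
    obtain ⟨z, hz, rfl⟩ := this
    exact ⟨fun _ => z, fun _ => hz, sub_eq_zero.2 hxy⟩

/-- The kernel of `M ⊗̂_k A → M ⊗ A / 𝔪_Aⁿ⁺¹` is generated, as a right `A`-module, by finitely many
right multiples by elements of `𝔪_A` of the kernel of `M ⊗̂_k A → M ⊗ A / 𝔪_Aⁿ`. -/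
theorem exists_eq_sum_rmul [IsCompleteLocal k A] {n : ℕ} {x : CTensor k R M A}
    (hx : x.1 (n + 1) = 0) : ∃ s : Finset A, (∀ v ∈ s, v ∈ rad A) ∧
      ∃ y : A → CTensor k R M A, (∀ v, (y v).1 n = 0) ∧ x = ∑ v ∈ s, rmul v (y v) := by
  obtain ⟨s, hs, h⟩ := exists_finset_rad_generators k A
  -- The family is indexed by all of `A`; only the components in `s` matter.
  let G : (A → CTensor k R M A) →+ CTensor k R M A :=
    ∑ v ∈ s, (rmul v).toAddMonoidHom.comp (Pi.evalAddMonoidHom _ v)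
  have hG : ∀ y, G y = ∑ v ∈ s, rmul v (y v) := fun y => by
    rw [AddMonoidHom.finsetSum_apply]; rfl
  have hlev : ∀ (t : Finset A) (g : A → CTensor k R M A) n, (∀ v ∈ t, (g v).1 n = 0) →
      (∑ v ∈ t, g v).1 n = 0 := by
    intro t g n hg
    classical
    induction t using Finset.induction_on with
    | empty => rfl
    | insert a t ha ih =>
      rw [Finset.sum_insert ha, add_level, hg a (by simp),
        ih fun v hv => hg v (Finset.mem_insert_of_mem hv), add_zero]
  suffices hsuff : ∃ y, (∀ i, (y i).1 n = 0) ∧ G y = x by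
    obtain ⟨y, hy, hy'⟩ := hsuff
    exact ⟨s, hs, y, hy, by rw [← hy', hG]⟩
  refine exists_eq_of_approx G 1 ?_ ?_ n x hx
  · intro n y hy
    rw [hG]
    exact hlev _ _ _ fun v hv => rmul_level_succ_eq_zero (hy v) (hs v hv)
  · intro n x hx
    obtain ⟨y, hy, hxy⟩ := exists_tensors_of_level_eq_zero hx
    suffices hsuff : ∃ z, (∀ i, (z i).1 n = 0) ∧ (y - G z).1 (n + 1 + 1) = 0 by
      obtain ⟨z, hz, hz'⟩ := hsuff
      exact ⟨z, hz, by rw [sub_level, hxy]; exact hz'⟩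
    clear hxy
    induction hy using AddSubgroup.closure_induction with
    | mem y hy =>
      obtain ⟨b, hb, m, rfl⟩ := hy
      obtain ⟨c, hc, hc'⟩ := h n b hb
      refine ⟨fun v => incl (c v) m, fun v => incl_level_eq_zero (hc v) m, ?_⟩
      have : incl b m - G (fun v => incl (c v) m) =
          incl (k := k) (R := R) (b - ∑ v ∈ s, c v * v) m := by
        rw [hG]
        have hadd : ∀ t : Finset A, incl (k := k) (R := R) (∑ v ∈ t, c v * v) m =
            ∑ v ∈ t, rmul v (incl (c v) m) := by
          intro t
          classical
          induction t using Finset.induction_on with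
          | empty => exact incl_zero m
          | insert a t ha ih => rw [Finset.sum_insert ha, Finset.sum_insert ha, incl_add, ih]; rfl
        rw [← hadd, sub_eq_iff_eq_add, ← incl_add, sub_add_cancel]
      rw [this]
      exact incl_level_eq_zero hc' m
    | zero => exact ⟨0, fun _ => rfl, by rw [map_zero, sub_zero]; rfl⟩
    | add x y _ _ hx hy =>
      obtain ⟨a, ha, ha'⟩ := hx
      obtain ⟨b, hb, hb'⟩ := hy
      refine ⟨a + b, fun i => by rw [Pi.add_apply, add_level, ha, hb, add_zero], ?_⟩
      rw [map_add, add_sub_add_comm, add_level, ha', hb', add_zero]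
    | neg x _ hx =>
      obtain ⟨a, ha, ha'⟩ := hx
      refine ⟨-a, fun i => neg_eq_zero.2 (ha i), ?_⟩
      rw [map_neg, ← neg_sub']
      exact neg_eq_zero.2 ha'

/-- An additive map `M ⊗̂_k A → N ⊗̂_k B` that is semilinear over an algebra homomorphism is
compatible with the filtrations; continuity needs no separate hypothesis. -/
theorem isFiltered_of_semilinear [IsCompleteLocal k A] [IsCompleteLocal k B] (φ : A →ₐ[k] B)
    (f : CTensor k R M A →ₗ[R] CTensor k R N B)
    (hf : ∀ a x, f (rmul a x) = rmul (φ a) (f x)) : IsFiltered f := by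
  intro n x hx
  induction n generalizing x with
  | zero => exact level_zero _
  | succ n ih =>
    obtain ⟨s, hs, y, hy, rfl⟩ := exists_eq_sum_rmul hx
    clear hx
    classical
    induction s using Finset.induction_on with
    | empty => simp
    | insert a t ha iht =>
      rw [Finset.sum_insert ha, map_add, add_level, iht fun v hv => hs v (by simp [hv]), hf,
        add_zero]
      refine rmul_level_succ_eq_zero (ih _ (hy a)) ?_
      rw [mem_rad_iff k, residue_map, ← mem_rad_iff k]
      exact hs a (by simp)

/-- A semilinear map out of `M ⊗̂_k A` is determined modulo `𝔪ⁿ` by its values modulo `𝔪ⁿ` on the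
elements `m ⊗ 1`. -/
theorem level_eq_of_semilinear [IsCompleteLocal k A] [IsCompleteLocal k B] (φ : A →ₐ[k] B)
    (f g : CTensor k R M A →ₗ[R] CTensor k R N B)
    (hf : ∀ a x, f (rmul a x) = rmul (φ a) (f x)) (hg : ∀ a x, g (rmul a x) = rmul (φ a) (g x))
    (n : ℕ) (h : ∀ m, (f (incl 1 m)).1 n = (g (incl 1 m)).1 n) (x : CTensor k R M A) :
    (f x).1 n = (g x).1 n := by
  have hfg : ∀ a x, (f - g) (rmul a x) = rmul (φ a) ((f - g) x) := fun a x => by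
    rw [LinearMap.sub_apply, hf, hg, LinearMap.sub_apply, map_sub]
  have hF := isFiltered_of_semilinear φ _ hfg
  suffices hs : ((f - g) x).1 n = 0 from sub_eq_zero.1 hs
  obtain ⟨y, hy, hxy⟩ := exists_tensors_univ x n
  rw [hF.level_congr hxy]
  clear hxy
  induction hy using AddSubgroup.closure_induction with
  | mem y hy =>
    obtain ⟨a, -, m, rfl⟩ := hy
    have : incl a m = rmul a (incl (k := k) (R := R) 1 m) := by rw [rmul_incl, one_mul]
    rw [this, hfg]
    exact isFiltered_rmul _ _ _ (sub_eq_zero.2 (h m))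
  | zero => rw [map_zero, zero_level]
  | add x y _ _ hx hy => rw [map_add, add_level, hx, hy, add_zero]
  | neg x _ hx => rw [map_neg]; exact neg_eq_zero.2 hx

theorem semilinear_ext [IsCompleteLocal k A] [IsCompleteLocal k B] (φ : A →ₐ[k] B)
    {f g : CTensor k R M A →ₗ[R] CTensor k R N B}
    (hf : ∀ a x, f (rmul a x) = rmul (φ a) (f x)) (hg : ∀ a x, g (rmul a x) = rmul (φ a) (g x))
    (h : ∀ m, f (incl 1 m) = g (incl 1 m)) : f = g :=
  LinearMap.ext fun x => ext_level fun n =>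
    level_eq_of_semilinear φ f g hf hg n (fun m => by rw [h]) x

/-- `u ⊗̂ v` factors through reduction modulo the radical if `v` vanishes on the radical. -/
theorem map_eq_of_level_one [IsCompleteLocal k A] (u : M →ₗ[R] N) (v : A →ₗ[k] B) (hv)
    (h : ∀ a ∈ rad A, v a = 0) {x y : CTensor k R M A} (hxy : x.1 1 = y.1 1) :
    map u v hv x = map u v hv y := by
  rw [← sub_eq_zero, ← map_sub]
  obtain ⟨s, hs, z, -, hz⟩ := exists_eq_sum_rmul (n := 0) (x := x - y) (sub_eq_zero.2 hxy)
  rw [hz, map_sum]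
  refine Finset.sum_eq_zero fun a ha => ?_
  have : map u v hv ∘ₗ rmul a = 0 :=
    ((isFiltered_map u v hv).comp (isFiltered_rmul a)).ext (fun _ _ _ => rfl) fun b m => by
      rw [LinearMap.comp_apply, rmul_incl, map_incl, h _ (Ideal.mul_mem_left _ _ (hs a ha)),
        incl_zero, LinearMap.zero_apply]
  exact LinearMap.congr_fun this _

end CTensor

namespace CTensor

variable {k R : Type*} [Field k] [Ring R] [Algebra k R]
  {M N : Type*} [AddCommGroup M] [Module k M] [Module R M] [IsScalarTower k R M]
  [AddCommGroup N] [Module k N] [Module R N] [IsScalarTower k R N]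
  {L : Type*} [AddCommGroup L] [Module k L] [Module R L] [IsScalarTower k R L]
  {A B C : Type*} [Ring A] [Algebra k A] [Ring B] [Algebra k B] [Ring C] [Algebra k C]

/-! ### Extension of scalars -/

variable (k A) in
/-- Multiplication on `A / 𝔪_Aⁿ`. -/
def mulQ (n : ℕ) : (A ⧸ radPow k A n) →ₗ[k] (A ⧸ radPow k A n) →ₗ[k] (A ⧸ radPow k A n) :=
  Submodule.liftQ _
    { toFun := fun a => Submodule.mapQ _ _ (LinearMap.mulLeft k a)
        fun _ hb => Ideal.mul_mem_left (rad A ^ n) a hb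
      map_add' := fun a b => by
        refine LinearMap.ext fun c => ?_
        obtain ⟨c, rfl⟩ := Submodule.Quotient.mk_surjective _ c
        exact congrArg Submodule.Quotient.mk (add_mul a b c)
      map_smul' := fun r a => by
        refine LinearMap.ext fun c => ?_
        obtain ⟨c, rfl⟩ := Submodule.Quotient.mk_surjective _ c
        exact congrArg Submodule.Quotient.mk (smul_mul_assoc r a c) }
    (fun a ha => by
      refine LinearMap.ext fun c => ?_
      obtain ⟨c, rfl⟩ := Submodule.Quotient.mk_surjective _ c
      exact (Submodule.Quotient.mk_eq_zero _).2 (Ideal.mul_mem_right c (rad A ^ n) ha))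

/-- The map `(N ⊗ A / 𝔪_Aⁿ) ⊗ A / 𝔪_Aⁿ → N ⊗ A / 𝔪_Aⁿ` given by multiplication. -/
noncomputable def act (N : Type*) [AddCommGroup N] [Module k N] [Module R N] [IsScalarTower k R N]
    (n : ℕ) :
    (N ⊗[k] (A ⧸ radPow k A n)) ⊗[k] (A ⧸ radPow k A n) →ₗ[R] N ⊗[k] (A ⧸ radPow k A n) :=
  TensorProduct.AlgebraTensorModule.map (LinearMap.id : N →ₗ[R] N)
    (TensorProduct.lift (mulQ k A n)) ∘ₗ
    (TensorProduct.AlgebraTensorModule.assoc k k R N (A ⧸ radPow k A n)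
      (A ⧸ radPow k A n)).toLinearMap

theorem act_level (n : ℕ) (x : CTensor k R N A) (b : A) :
    act (R := R) N n (x.1 n ⊗ₜ[k] Submodule.Quotient.mk b) = (rmul b x).1 n := by
  obtain ⟨y, hy, hxy⟩ := exists_tensors_univ x n
  have h : (rmul b x).1 n = (rmul b y).1 n := map_level_congr _ _ _ hxy
  rw [h, hxy]
  clear hxy h
  induction hy using AddSubgroup.closure_induction with
  | mem y hy =>
    obtain ⟨a, -, m, rfl⟩ := hy
    rfl
  | zero => rw [zero_level, TensorProduct.zero_tmul, map_zero, map_zero, zero_level]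
  | add x y _ _ hx hy =>
    rw [add_level, TensorProduct.add_tmul, map_add, map_add, hx, hy, add_level]
  | neg x _ hx =>
    change act N n ((-x.1 n) ⊗ₜ _) = _
    rw [TensorProduct.neg_tmul, map_neg, map_neg, hx]
    rfl

variable (k R N A) in
/-- The projection `N ⊗̂_k A → N ⊗ A / 𝔪_Aⁿ`. -/
def proj (n : ℕ) : CTensor k R N A →ₗ[R] N ⊗[k] (A ⧸ radPow k A n) :=
  LinearMap.proj n ∘ₗ (CTensor k R N A).subtype

/-- The map `M ⊗ A / 𝔪_Aⁿ → N ⊗ A / 𝔪_Aⁿ` sending `m ⊗ a` to `u(m) a`. -/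
noncomputable def extendLevel (u : M →ₗ[R] CTensor k R N A) (n : ℕ) :
    M ⊗[k] (A ⧸ radPow k A n) →ₗ[R] N ⊗[k] (A ⧸ radPow k A n) :=
  act (R := R) N n ∘ₗ
    TensorProduct.AlgebraTensorModule.map (proj k R N A n ∘ₗ u) LinearMap.id

theorem extendLevel_tmul (u : M →ₗ[R] CTensor k R N A) (n : ℕ) (m : M) (a : A) :
    extendLevel u n (m ⊗ₜ[k] Submodule.Quotient.mk a) = (rmul a (u m)).1 n :=
  act_level n (u m) a

theorem extendLevel_proj (u : M →ₗ[R] CTensor k R N A) (n : ℕ)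
    (y : M ⊗[k] (A ⧸ radPow k A (n + 1))) :
    TensorProduct.AlgebraTensorModule.map (LinearMap.id : N →ₗ[R] N) (radProj k A n)
      (extendLevel u (n + 1) y) = extendLevel u n
        (TensorProduct.AlgebraTensorModule.map (LinearMap.id : M →ₗ[R] M) (radProj k A n) y) := by
  induction y with
  | zero => simp only [map_zero]
  | add y z hy hz => simp only [map_add, hy, hz]
  | tmul m a =>
    obtain ⟨a, rfl⟩ := Submodule.Quotient.mk_surjective _ a
    rw [extendLevel_tmul, (rmul a (u m)).2 n]
    exact (extendLevel_tmul u n m a).symm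

/-- The right `A`-linear extension `M ⊗̂_k A → N ⊗̂_k A` of an `R`-linear map `M → N ⊗̂_k A`. -/
noncomputable def extend (u : M →ₗ[R] CTensor k R N A) :
    CTensor k R M A →ₗ[R] CTensor k R N A where
  toFun x := ⟨fun n => extendLevel u n (x.1 n), fun n => by rw [extendLevel_proj, x.2 n]⟩
  map_add' _ _ := ext_level fun _ => map_add _ _ _
  map_smul' r x := ext_level fun n => (extendLevel u n).map_smul r (x.1 n)

theorem extend_level (u : M →ₗ[R] CTensor k R N A) (x : CTensor k R M A) (n : ℕ) :
    (extend u x).1 n = extendLevel u n (x.1 n) := rfl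

theorem isFiltered_extend (u : M →ₗ[R] CTensor k R N A) : IsFiltered (extend u) :=
  fun n x h => by rw [extend_level, h, map_zero]

theorem extend_incl (u : M →ₗ[R] CTensor k R N A) (a : A) (m : M) :
    extend u (incl a m) = rmul a (u m) :=
  ext_level fun n => extendLevel_tmul u n m a

theorem extend_incl_one (u : M →ₗ[R] CTensor k R N A) (m : M) : extend u (incl 1 m) = u m := by
  rw [extend_incl, rmul_one]

theorem extend_rmul (u : M →ₗ[R] CTensor k R N A) (a : A) (x : CTensor k R M A) :
    extend u (rmul a x) = rmul a (extend u x) := by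
  have : extend u ∘ₗ rmul a = rmul a ∘ₗ extend u :=
    ((isFiltered_extend u).comp (isFiltered_rmul a)).ext
      ((isFiltered_rmul a).comp (isFiltered_extend u)) fun b m => by
      rw [LinearMap.comp_apply, LinearMap.comp_apply, rmul_incl, extend_incl, extend_incl,
        rmul_rmul]
  exact LinearMap.congr_fun this x

end CTensor

/-! ### Base change of lifts -/

section BaseChange

open CTensor

namespace CTensor

variable {k R : Type*} [Field k] [Ring R] [Algebra k R]
  {M N : Type*} [AddCommGroup M] [Module k M] [Module R M] [IsScalarTower k R M]
  [AddCommGroup N] [Module k N] [Module R N] [IsScalarTower k R N]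
  {A B : Type*} [Ring A] [Algebra k A] [Ring B] [Algebra k B]

theorem extend_zero : extend (0 : M →ₗ[R] CTensor k R N A) = 0 :=
  (isFiltered_extend _).ext (fun _ _ _ => rfl) fun a m => by
    rw [extend_incl, LinearMap.zero_apply, map_zero, LinearMap.zero_apply]

theorem tmulLeft_one_level (σ : M →ₗ[R] N) (x : CTensor k R M A) (n : ℕ) :
    (tmulLeft σ 1 x).1 n = TensorProduct.AlgebraTensorModule.map σ LinearMap.id (x.1 n) := by
  obtain ⟨y, hy, hxy⟩ := exists_tensors_univ x n
  rw [(isFiltered_tmulLeft σ 1).level_congr hxy, hxy]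
  clear hxy
  induction hy using AddSubgroup.closure_induction with
  | mem y hy =>
    obtain ⟨a, -, m, rfl⟩ := hy
    rw [tmulLeft_incl, one_mul]
    rfl
  | zero => rw [map_zero, zero_level, zero_level, map_zero]
  | add x y _ _ hx hy => rw [map_add, add_level, hx, hy, add_level, map_add]
  | neg x _ hx =>
    rw [map_neg]
    exact (congrArg Neg.neg hx).trans (map_neg _ _).symm

theorem semilinear_ext_id [IsCompleteLocal k A] {f g : CTensor k R M A →ₗ[R] CTensor k R N A}
    (hf : ∀ a x, f (rmul a x) = rmul a (f x)) (hg : ∀ a x, g (rmul a x) = rmul a (g x))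
    (h : ∀ m, f (incl 1 m) = g (incl 1 m)) : f = g :=
  semilinear_ext (AlgHom.id k A) hf hg h

theorem baseChange_incl_one [IsCompleteLocal k A] [IsCompleteLocal k B] (f : A →ₐ[k] B) (m : M) :
    baseChange (R := R) f (incl 1 m) = incl 1 m := by
  rw [baseChange_incl, map_one]

end CTensor

variable {k : Type u} {R : Type v} [Field k] [Ring R] [Algebra k R]
  {F : ChainComplex (ModuleCat.{w} R) ℤ}
  {A B C : Type*} [Ring A] [Algebra k A] [Ring B] [Algebra k B] [Ring C] [Algebra k C]

/-- The graded homomorphism of right modules with prescribed restriction to `F`. -/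
noncomputable def CHom.ofMaps {n : ℤ} (u : ∀ i j : ℤ, F.X i →ₗ[R] CTensor k R (F.X j) A)
    (hu : ∀ i j, j ≠ i + n → u i j = 0) : CHom k F A n where
  map i j := extend (u i j)
  shape i j h := by rw [hu i j h, extend_zero]
  map_rmul _ _ _ _ := extend_rmul _ _ _

theorem CHom.ofMaps_incl_one {n : ℤ} (u : ∀ i j : ℤ, F.X i →ₗ[R] CTensor k R (F.X j) A)
    (hu : ∀ i j, j ≠ i + n → u i j = 0) (i j : ℤ) (m : F.X i) :
    (CHom.ofMaps u hu).map i j (incl 1 m) = u i j m := extend_incl_one _ _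

theorem Lift.map_incl_one_level_one (L : Lift k F A) (i j : ℤ) (m : F.X i) :
    (L.map i j (incl 1 m)).1 1 = (incl (k := k) (R := R) 1 (diff F i j m)).1 1 :=
  L.reduction i j _

theorem Lift.IsIso.refl (L : Lift k F A) : L.IsIso L :=
  ⟨fun _ => LinearEquiv.refl R _, fun _ _ _ => rfl, fun _ _ _ => rfl⟩

variable [IsCompleteLocal k A] [IsCompleteLocal k B] [IsCompleteLocal k C]

theorem CHom.map_eq_of_incl_one {n : ℤ} {Δ Δ' : CHom k F A n} {i j : ℤ}
    (h : ∀ m, Δ.map i j (incl 1 m) = Δ'.map i j (incl 1 m)) : Δ.map i j = Δ'.map i j :=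
  semilinear_ext_id (Δ.map_rmul i j) (Δ'.map_rmul i j) h

theorem isBaseChange_iff {f : A →ₐ[k] B} {n : ℤ} {Δ : CHom k F A n} {Δ' : CHom k F B n} :
    IsBaseChange f Δ Δ' ↔
      ∀ i j m, Δ'.map i j (incl 1 m) = baseChange f (Δ.map i j (incl 1 m)) := by
  constructor
  · intro h i j m
    rw [← h, baseChange_incl_one]
  · intro h i j
    refine LinearMap.congr_fun (semilinear_ext f (f := Δ'.map i j ∘ₗ baseChange f)
      (g := baseChange f ∘ₗ Δ.map i j) ?_ ?_ ?_)
    · intro a x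
      rw [LinearMap.comp_apply, baseChange_rmul, Δ'.map_rmul]; rfl
    · intro a x
      rw [LinearMap.comp_apply, Δ.map_rmul, baseChange_rmul]; rfl
    · intro m
      rw [LinearMap.comp_apply, baseChange_incl_one, h]; rfl

theorem IsBaseChange.comp {f : A →ₐ[k] B} {g : B →ₐ[k] C} {n : ℤ} {Δ : CHom k F A n}
    {Δ' : CHom k F B n} {Δ'' : CHom k F C n} (h : IsBaseChange f Δ Δ')
    (h' : IsBaseChange g Δ' Δ'') : IsBaseChange (g.comp f) Δ Δ'' := fun i j x => by
  rw [← baseChange_baseChange, h', h, baseChange_baseChange]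

/-- Base change is unique, since `F ⊗ 1` generates: if `Δ'` is the base change of `Δ` to `B`, then
the base change of `Δ` to `C` is the base change of `Δ'`. -/
theorem IsBaseChange.of_comp {f : A →ₐ[k] B} {g : B →ₐ[k] C} {n : ℤ} {Δ : CHom k F A n}
    {Δ' : CHom k F B n} {Δ'' : CHom k F C n} (h : IsBaseChange f Δ Δ')
    (h' : IsBaseChange (g.comp f) Δ Δ'') : IsBaseChange g Δ' Δ'' :=
  isBaseChange_iff.2 fun i j m => by
    rw [isBaseChange_iff.1 h', isBaseChange_iff.1 h, baseChange_baseChange]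

/-- Base change of a graded homomorphism along an arbitrary algebra homomorphism. -/
noncomputable def CHom.push (f : A →ₐ[k] B) {n : ℤ} (Δ : CHom k F A n) : CHom k F B n :=
  CHom.ofMaps (fun i j => baseChange f ∘ₗ Δ.map i j ∘ₗ incl 1) fun i j h => by
    rw [Δ.shape i j h, LinearMap.zero_comp, LinearMap.comp_zero]

theorem CHom.isBaseChange_push (f : A →ₐ[k] B) {n : ℤ} (Δ : CHom k F A n) :
    IsBaseChange f Δ (Δ.push f) :=
  isBaseChange_iff.2 fun i j m => CHom.ofMaps_incl_one _ _ i j m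

/-- It suffices to test on `F` whether a graded homomorphism of degree `-1` is a differential. -/
def Lift.ofCHom (Δ : CHom k F A (-1))
    (h2 : ∀ i j l m, Δ.map j l (Δ.map i j (incl 1 m)) = 0)
    (h1 : ∀ i j m, (Δ.map i j (incl 1 m)).1 1 = (incl (k := k) (R := R) 1 (diff F i j m)).1 1) :
    Lift k F A where
  toCHom := Δ
  sq_zero i j l := LinearMap.congr_fun (semilinear_ext_id (f := Δ.map j l ∘ₗ Δ.map i j) (g := 0)
    (fun a x => by rw [LinearMap.comp_apply, Δ.map_rmul, Δ.map_rmul]; rfl)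
    (fun a x => by rw [LinearMap.zero_apply, LinearMap.zero_apply, map_zero]) (h2 i j l))
  reduction i j x := by
    rw [← tmulLeft_one_level]
    refine level_eq_of_semilinear (AlgHom.id k A) _ _ (Δ.map_rmul i j)
      (fun a x => tmulLeft_rmul _ _ _ x) 1 (fun m => ?_) x
    rw [h1, tmulLeft_incl, one_mul]

/-- Base change of a lift along an arbitrary algebra homomorphism. -/
noncomputable def Lift.push (f : A →ₐ[k] B) (L : Lift k F A) : Lift k F B :=
  Lift.ofCHom (L.toCHom.push f)
    (fun i j l m => by
      have h := CHom.isBaseChange_push f L.toCHom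
      rw [isBaseChange_iff.1 h, h, L.sq_zero, map_zero])
    (fun i j m => by
      rw [isBaseChange_iff.1 (CHom.isBaseChange_push f L.toCHom)]
      rw [(isFiltered_baseChange f).level_congr (L.map_incl_one_level_one i j m),
        baseChange_incl_one])

theorem Lift.isBaseChange_push (f : A →ₐ[k] B) (L : Lift k F A) :
    IsBaseChange f L.toCHom (L.push f).toCHom := CHom.isBaseChange_push f L.toCHom

/-- Isomorphisms of lifts are stable under base change. -/
theorem Lift.IsIso.of_isBaseChange {L L' : Lift k F A} (h : L.IsIso L') (f : A →ₐ[k] B)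
    {M M' : Lift k F B} (hM : IsBaseChange f L.toCHom M.toCHom)
    (hM' : IsBaseChange f L'.toCHom M'.toCHom) : M.IsIso M' := by
  obtain ⟨φ, hφ, hφL⟩ := h
  have hφ' : ∀ i (a : A) x, (φ i).symm (rmul a x) = rmul a ((φ i).symm x) := fun i a x => by
    rw [LinearEquiv.symm_apply_eq, hφ, LinearEquiv.apply_symm_apply]
  have key : ∀ (i : ℤ) (g : CTensor k R (F.X i) A →ₗ[R] CTensor k R (F.X i) A),
      (∀ a x, g (rmul a x) = rmul a (g x)) →
      ∀ x, extend (baseChange f ∘ₗ g ∘ₗ incl 1) (baseChange f x) = baseChange f (g x) := by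
    intro i g hg
    refine LinearMap.congr_fun (semilinear_ext f
      (f := extend (baseChange f ∘ₗ g ∘ₗ incl 1) ∘ₗ baseChange f) (g := baseChange f ∘ₗ g) ?_ ?_ ?_)
    · intro a x
      rw [LinearMap.comp_apply, baseChange_rmul, extend_rmul]; rfl
    · intro a x
      rw [LinearMap.comp_apply, hg, baseChange_rmul]; rfl
    · intro m
      rw [LinearMap.comp_apply, baseChange_incl_one, extend_incl_one]; rfl
  -- `ψ` and `ψ'` are the base changes of `φ` and its inverse, extended from their values on `F`.
  let ψ : ∀ i, CTensor k R (F.X i) B →ₗ[R] CTensor k R (F.X i) B := fun i =>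
    extend (baseChange f ∘ₗ (φ i).toLinearMap ∘ₗ incl 1)
  let ψ' : ∀ i, CTensor k R (F.X i) B →ₗ[R] CTensor k R (F.X i) B := fun i =>
    extend (baseChange f ∘ₗ (φ i).symm.toLinearMap ∘ₗ incl 1)
  have h1 : ∀ i x, ψ i (baseChange f x) = baseChange f (φ i x) := fun i =>
    key i (φ i).toLinearMap (hφ i)
  have h2 : ∀ i x, ψ' i (baseChange f x) = baseChange f ((φ i).symm x) := fun i =>
    key i (φ i).symm.toLinearMap (hφ' i)
  have hr : ∀ i a x, ψ i (rmul a x) = rmul a (ψ i x) := fun i a x => extend_rmul _ a x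
  have hr' : ∀ i a x, ψ' i (rmul a x) = rmul a (ψ' i x) := fun i a x => extend_rmul _ a x
  have hid : ∀ i, ψ i ∘ₗ ψ' i = LinearMap.id := fun i => by
    refine semilinear_ext_id (fun a x => ?_) (fun _ _ => rfl) fun m => ?_
    · rw [LinearMap.comp_apply, hr', hr]; rfl
    · rw [LinearMap.comp_apply, ← baseChange_incl_one f, h2, h1, LinearEquiv.apply_symm_apply]
      rfl
  have hid' : ∀ i, ψ' i ∘ₗ ψ i = LinearMap.id := fun i => by
    refine semilinear_ext_id (fun a x => ?_) (fun _ _ => rfl) fun m => ?_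
    · rw [LinearMap.comp_apply, hr, hr']; rfl
    · rw [LinearMap.comp_apply, ← baseChange_incl_one f, h1, h2, LinearEquiv.symm_apply_apply]
      rfl
  refine ⟨fun i => LinearEquiv.ofLinearMap (ψ i) (ψ' i) (hid i) (hid' i), hr, fun i j => ?_⟩
  refine LinearMap.congr_fun (semilinear_ext_id (f := ψ j ∘ₗ M.map i j) (g := M'.map i j ∘ₗ ψ i)
    (fun a x => ?_) (fun a x => ?_) fun m => ?_)
  · rw [LinearMap.comp_apply, M.map_rmul, hr]; rfl
  · rw [LinearMap.comp_apply, hr, M'.map_rmul]; rfl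
  · rw [LinearMap.comp_apply, LinearMap.comp_apply, ← baseChange_incl_one f, hM, h1, hφL, h1, hM']

/-- Since `F` is projective, graded homomorphisms lift along surjections. -/
theorem CHom.exists_isBaseChange (hF : ∀ i : ℤ, Module.Projective R (F.X i)) (p : A →ₐ[k] B)
    (hp : Function.Surjective p) {n : ℤ} (Δ : CHom k F B n) :
    ∃ Δ' : CHom k F A n, IsBaseChange p Δ' Δ := by
  have h : ∀ i j, ∃ u : F.X i →ₗ[R] CTensor k R (F.X j) A,
      baseChange p ∘ₗ u = Δ.map i j ∘ₗ incl 1 ∧ (j ≠ i + n → u = 0) := by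
    intro i j
    by_cases hij : j = i + n
    · have := hF i
      obtain ⟨u, hu⟩ := Module.projective_lifting_property (baseChange p) (Δ.map i j ∘ₗ incl 1)
        (baseChange_surjective (M := F.X j) p hp)
      exact ⟨u, hu, fun h => (h hij).elim⟩
    · exact ⟨0, by rw [Δ.shape i j hij, LinearMap.comp_zero, LinearMap.zero_comp], fun _ => rfl⟩
  choose u hu hu' using h
  refine ⟨CHom.ofMaps u hu', isBaseChange_iff.2 fun i j m => ?_⟩
  rw [CHom.ofMaps_incl_one]
  exact (LinearMap.congr_fun (hu i j) m).symm

/-- A graded homomorphism lifting a lift along a surjection still reduces to the differential of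
`F`. -/
theorem level_one_of_isBaseChange {p : A →ₐ[k] B} (hp : Function.Surjective p)
    {Δ : CHom k F A (-1)} {L : Lift k F B} (h : IsBaseChange p Δ L.toCHom) (i j : ℤ) (m : F.X i) :
    (Δ.map i j (incl 1 m)).1 1 = (incl (k := k) (R := R) 1 (diff F i j m)).1 1 := by
  rw [← sub_eq_zero, ← sub_level]
  have h1 : (baseChange p (Δ.map i j (incl 1 m) - incl 1 (diff F i j m))).1 1 = 0 := by
    rw [map_sub, ← isBaseChange_iff.1 h, baseChange_incl_one, sub_level,
      L.map_incl_one_level_one, sub_self]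
  obtain ⟨y, hy, hxy⟩ := exists_tensors_of_baseChange_level_eq_zero p hp h1
  rw [hxy]
  refine tensors_level_eq_zero (AddSubgroup.closure_mono ?_ hy)
  rintro _ ⟨a, ha, m, rfl⟩
  refine ⟨a, ?_, m, rfl⟩
  have ha : p a = 0 := ha
  rw [SetLike.mem_coe, Submodule.pow_one, mem_rad_iff k, ← residue_map k p, ha, map_zero]

end BaseChange

/-! ### Coefficients along the socle element -/

section Coefficient

open CTensor

theorem exists_functional_of_notMem (k : Type*) {A : Type*} [Field k] [Ring A] [Algebra k A]
    {N : ℕ} {e : A} (he : e ∉ rad A ^ N) :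
    ∃ l : A →ₗ[k] k, l e = 1 ∧ ∀ a ∈ rad A ^ N, l a = 0 := by
  obtain ⟨f, hf, hf'⟩ := Submodule.exists_le_ker_of_notMem (p := radPow k A N) he
  refine ⟨(f e)⁻¹ • f, ?_, fun a ha => ?_⟩
  · rw [LinearMap.smul_apply, smul_eq_mul, inv_mul_cancel₀ hf]
  · rw [LinearMap.smul_apply, show f a = 0 from hf' ha, smul_zero]

namespace CTensor

variable {k R : Type*} [Field k] [Ring R] [Algebra k R]
  {M : Type*} [AddCommGroup M] [Module k M] [Module R M] [IsScalarTower k R M]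
  {A : Type*} [Ring A] [Algebra k A]

/-- The map `M ⊗̂_k A → M`, `m ⊗ a ↦ l(a) m`, for a functional `l` vanishing on `𝔪_Aᴺ`. -/
noncomputable def coeff (l : A →ₗ[k] k) (N : ℕ) (hl : ∀ a ∈ rad A ^ N, l a = 0) :
    CTensor k R M A →ₗ[R] M :=
  (TensorProduct.AlgebraTensorModule.rid k R M).toLinearMap ∘ₗ
    TensorProduct.AlgebraTensorModule.map LinearMap.id
      (Submodule.liftQ (radPow k A N) l fun a ha => hl a ha) ∘ₗ proj k R M A N

theorem coeff_incl (l : A →ₗ[k] k) (N : ℕ) (hl : ∀ a ∈ rad A ^ N, l a = 0) (a : A) (m : M) :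
    coeff (R := R) l N hl (incl a m) = l a • m := rfl

theorem coeff_congr (l : A →ₗ[k] k) {N : ℕ} (hl : ∀ a ∈ rad A ^ N, l a = 0)
    {x y : CTensor k R M A} (h : x.1 N = y.1 N) : coeff l N hl x = coeff l N hl y :=
  congrArg (fun z => (TensorProduct.AlgebraTensorModule.rid k R M)
    (TensorProduct.AlgebraTensorModule.map LinearMap.id
      (Submodule.liftQ (radPow k A N) l fun a ha => hl a ha) z)) h

end CTensor

variable {k P : Type u} [Field k] [Ring P] [Algebra k P]
  {R : Type*} [Ring R] [Algebra k R]
  {M N : Type*} [AddCommGroup M] [Module k M] [Module R M] [IsScalarTower k R M]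
  [AddCommGroup N] [Module k N] [Module R N] [IsScalarTower k R N]

namespace SmallExtension

/-- At all sufficiently high levels, `m` is determined by `m ⊗ ε`. -/
theorem exists_forall_incl_ε_level_injective (X : SmallExtension k P) :
    ∃ n₀, ∀ n, n₀ ≤ n → ∀ m m' : M,
      (incl (k := k) (R := R) X.ε m).1 n = (incl (k := k) (R := R) X.ε m').1 n → m = m' := by
  obtain ⟨n₀, h⟩ := X.exists_ε_notMem
  obtain ⟨l, hl, hl'⟩ := exists_functional_of_notMem k h
  refine ⟨n₀, fun n hn m m' hm => ?_⟩
  have := coeff_congr l hl' (level_eq_of_le hn hm)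
  simpa [coeff_incl, hl] using this

theorem incl_ε_injective (X : SmallExtension k P) :
    Function.Injective (incl X.ε : M →ₗ[R] CTensor k R M X.E) := fun m m' h => by
  obtain ⟨n, hn⟩ := X.exists_forall_incl_ε_level_injective (M := M) (R := R)
  exact hn n le_rfl m m' (by rw [h])

variable [IsCompleteLocal k P]

/-- The kernel of `M ⊗̂_k E → M ⊗̂_k P` is `M ⊗ ε`. -/
theorem exists_incl_ε_eq (X : SmallExtension k P) {z : CTensor k R M X.E}
    (hz : baseChange X.π z = 0) : ∃ m, z = incl X.ε m := by
  have h : ∀ n, ∃ m, z.1 n = (incl (k := k) (R := R) X.ε m).1 n := by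
    intro n
    obtain ⟨y, hy, hzy⟩ := exists_tensors_of_baseChange_level_eq_zero X.π X.surjective
      (n := n) (x := z) (by rw [hz, zero_level])
    have : ∃ m, y = incl X.ε m := by
      clear hzy
      induction hy using AddSubgroup.closure_induction with
      | mem y hy =>
        obtain ⟨a, ha, m, rfl⟩ := hy
        obtain ⟨c, rfl⟩ := (X.ker_eq a).1 ha
        exact ⟨c • m, incl_smul _ _ _⟩
      | zero => exact ⟨0, (map_zero _).symm⟩
      | add x y _ _ hx hy =>
        obtain ⟨a, rfl⟩ := hx
        obtain ⟨b, rfl⟩ := hy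
        exact ⟨a + b, (map_add _ _ _).symm⟩
      | neg x _ hx =>
        obtain ⟨a, rfl⟩ := hx
        exact ⟨-a, (map_neg _ _).symm⟩
    obtain ⟨m, rfl⟩ := this
    exact ⟨m, hzy⟩
  choose m hm using h
  obtain ⟨n₀, hn₀⟩ := X.exists_forall_incl_ε_level_injective (M := M) (R := R)
  -- The elements `m n` stabilize from level `n₀` on; lower levels follow by projection.
  refine ⟨m n₀, ext_level fun n => ?_⟩
  rcases le_total n₀ n with hn | hn
  · rw [hm n, hn₀ n₀ le_rfl (m n₀) (m n)]
    rw [← hm n₀]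
    exact level_eq_of_le hn (hm n)
  · exact level_eq_of_le hn (hm n₀)

/-- An `R`-linear map `M → N ⊗̂_k E` that vanishes in `N ⊗̂_k P` is of the form `m ↦ σ(m) ⊗ ε`. -/
theorem exists_linearMap_incl_ε {M : Type*} [AddCommGroup M] [Module R M] (X : SmallExtension k P)
    (f : M →ₗ[R] CTensor k R N X.E)
    (hf : ∀ m, baseChange X.π (f m) = 0) : ∃ σ : M →ₗ[R] N, ∀ m, f m = incl X.ε (σ m) := by
  obtain ⟨n, h⟩ := X.exists_ε_notMem
  obtain ⟨l, hl, hl'⟩ := exists_functional_of_notMem k h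
  refine ⟨coeff l n hl' ∘ₗ f, fun m => ?_⟩
  obtain ⟨y, hy⟩ := X.exists_incl_ε_eq (hf m)
  rw [LinearMap.comp_apply, hy, coeff_incl, hl, one_smul]

/-- Linear relations between the restrictions of homomorphisms `B → X.E`, `B → Y.E`, `B → Z.E` over
`P` to the kernel of `B → P` hold for the coefficients of `ε` in elements of the kernel of
`M ⊗̂_k B → M ⊗̂_k P`. -/
theorem coeff_relation {X Y Z : SmallExtension k P} {B : Type*} [Ring B] [Algebra k B]
    [IsCompleteLocal k B] (p : B →ₐ[k] P) (hp : Function.Surjective p)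
    (gX : B →ₐ[k] X.E) (gY : B →ₐ[k] Y.E) (gZ : B →ₐ[k] Z.E) (c d : k)
    (h : ∀ b, p b = 0 → ∃ s t : k, gX b = s • X.ε ∧ gY b = t • Y.ε ∧
      gZ b = (c * s + d * t) • Z.ε)
    {z : CTensor k R M B} (hz : baseChange p z = 0) {x y w : M}
    (hx : baseChange gX z = incl X.ε x) (hy : baseChange gY z = incl Y.ε y)
    (hw : baseChange gZ z = incl Z.ε w) : w = c • x + d • y := by
  obtain ⟨n₁, h₁⟩ := X.exists_forall_incl_ε_level_injective (M := M) (R := R)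
  obtain ⟨n₂, h₂⟩ := Y.exists_forall_incl_ε_level_injective (M := M) (R := R)
  obtain ⟨n₃, h₃⟩ := Z.exists_forall_incl_ε_level_injective (M := M) (R := R)
  obtain ⟨t, ht, hzt⟩ := exists_tensors_of_baseChange_level_eq_zero p hp
    (n := n₁ + n₂ + n₃) (x := z) (by rw [hz, zero_level])
  -- At a high level `z` is a finite sum of elements `m ⊗ b` with `b` in the kernel of `B → P`.
  have key : ∃ a b, baseChange gX t = incl X.ε a ∧ baseChange gY t = incl Y.ε b ∧
      baseChange gZ t = incl Z.ε (c • a + d • b) := by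
    clear hzt
    induction ht using AddSubgroup.closure_induction with
    | mem y hy =>
      obtain ⟨b, hb, m, rfl⟩ := hy
      obtain ⟨s, t, h1, h2, h3⟩ := h b hb
      refine ⟨s • m, t • m, ?_, ?_, ?_⟩
      · rw [baseChange_incl, h1, incl_smul]
      · rw [baseChange_incl, h2, incl_smul]
      · rw [baseChange_incl, h3, incl_smul, add_smul, mul_smul, mul_smul]
    | zero => exact ⟨0, 0, by simp, by simp, by simp⟩
    | add u v _ _ hu hv =>
      obtain ⟨a, b, h1, h2, h3⟩ := hu
      obtain ⟨a', b', h1', h2', h3'⟩ := hv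
      refine ⟨a + a', b + b', ?_, ?_, ?_⟩
      · rw [map_add, h1, h1', map_add]
      · rw [map_add, h2, h2', map_add]
      · rw [map_add, h3, h3', ← map_add, smul_add, smul_add, add_add_add_comm]
    | neg u _ hu =>
      obtain ⟨a, b, h1, h2, h3⟩ := hu
      refine ⟨-a, -b, ?_, ?_, ?_⟩
      · rw [map_neg, h1, map_neg]
      · rw [map_neg, h2, map_neg]
      · rw [map_neg, h3, ← map_neg, neg_add, smul_neg, smul_neg]
  obtain ⟨a, b, h1, h2, h3⟩ := key
  have e1 : x = a := h₁ (n₁ + n₂ + n₃) (by omega) _ _ (by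
    rw [← hx, ← h1, (isFiltered_baseChange gX).level_congr hzt])
  have e2 : y = b := h₂ (n₁ + n₂ + n₃) (by omega) _ _ (by
    rw [← hy, ← h2, (isFiltered_baseChange gY).level_congr hzt])
  have e3 : w = c • a + d • b := h₃ (n₁ + n₂ + n₃) (by omega) _ _ (by
    rw [← hw, ← h3, (isFiltered_baseChange gZ).level_congr hzt])
  rw [e1, e2, e3]

end SmallExtension

end Coefficient

/-! ### Obstructions -/

section Obstruction

open CTensor

variable {k : Type u} {R : Type v} [Field k] [Ring R] [Algebra k R]
  {F : ChainComplex (ModuleCat.{w} R) ℤ} {P : Type u} [Ring P] [Algebra k P]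

theorem mem_nullHomotopic_neg_two {σ : Family F} : σ ∈ nullHomotopic k F (-2) ↔
    ∃ h : gradedHom k F (-1), homDiff k F (-1) h.1 = σ := by
  rw [nullHomotopic, show (-2 + 1 : ℤ) = -1 from rfl, Submodule.mem_map, Subtype.exists]
  simp only [exists_prop]

/-- The relation `Δ² = σ ⊗ ε`, tested on `F`. -/
def IsObstruction (X : SmallExtension k P) (Δ : CHom k F X.E (-1)) (σ : Family F) : Prop :=
  ∀ i l m, Δ.map (i - 1) l (Δ.map i (i - 1) (incl 1 m)) = incl X.ε (σ i l m)

theorem IsObstruction.sq_eq {X : SmallExtension k P} {Δ : CHom k F X.E (-1)} {σ : Family F}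
    (h : IsObstruction X Δ σ) (i l : ℤ) (x : CTensor k R (F.X i) X.E) :
    Δ.map (i - 1) l (Δ.map i (i - 1) x) = tmulLeft (σ i l) X.ε x := by
  refine LinearMap.congr_fun (semilinear_ext_id (f := Δ.map (i - 1) l ∘ₗ Δ.map i (i - 1))
    (g := tmulLeft (σ i l) X.ε) (fun a x => ?_) (fun a x => tmulLeft_rmul _ _ _ x) fun m => ?_) x
  · rw [LinearMap.comp_apply, Δ.map_rmul, Δ.map_rmul]; rfl
  · rw [LinearMap.comp_apply, h, tmulLeft_incl, mul_one]

theorem IsObstruction.unique {X : SmallExtension k P} {Δ : CHom k F X.E (-1)} {σ τ : Family F}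
    (h : IsObstruction X Δ σ) (h' : IsObstruction X Δ τ) : σ = τ := by
  funext i l
  exact LinearMap.ext fun m => X.incl_ε_injective (R := R) ((h i l m).symm.trans (h' i l m))

/-- The perturbation `Δ + h ⊗ ε` of a graded homomorphism `Δ`. -/
noncomputable def CHom.perturb {X : SmallExtension k P} (Δ : CHom k F X.E (-1))
    (h : gradedHom k F (-1)) : CHom k F X.E (-1) :=
  CHom.ofMaps (fun i j => Δ.map i j ∘ₗ incl 1 + incl X.ε ∘ₗ h.1 i j) fun i j hij => by
    rw [Δ.shape i j hij, h.2 i j hij, LinearMap.zero_comp, LinearMap.comp_zero, add_zero]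

theorem CHom.perturb_incl_one {X : SmallExtension k P} (Δ : CHom k F X.E (-1))
    (h : gradedHom k F (-1)) (i j : ℤ) (m : F.X i) :
    (Δ.perturb h).map i j (incl 1 m) = Δ.map i j (incl 1 m) + incl X.ε (h.1 i j m) :=
  CHom.ofMaps_incl_one _ _ i j m

variable [IsCompleteLocal k P]

section

variable {X : SmallExtension k P} {L : Lift k F P} {Δ : CHom k F X.E (-1)}

/-- On `F ⊗ ε` a graded homomorphism lifting `L` acts as `d`, since `𝔪_E ε = 0`. -/
theorem map_incl_ε (h : IsBaseChange X.π Δ L.toCHom) (i j : ℤ) (m : F.X i) :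
    Δ.map i j (incl X.ε m) = incl X.ε (diff F i j m) := by
  have h1 : ∀ {j} (n : F.X j), incl X.ε n = rmul X.ε (incl (k := k) (R := R) 1 n) := fun n => by
    rw [rmul_incl, one_mul]
  rw [h1, Δ.map_rmul, h1]
  exact map_eq_of_level_one _ _ _ (fun a ha => (X.socle a ha).1)
    (level_one_of_isBaseChange X.surjective h i j m)

/-- The composite of `σ ⊗ ε` with a graded homomorphism lifting `L` is `σ d ⊗ ε`, since
`ε 𝔪_E = 0`. -/
theorem tmulLeft_ε_map (h : IsBaseChange X.π Δ L.toCHom) {i j l : ℤ} (σ : F.X j →ₗ[R] F.X l)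
    (m : F.X i) : tmulLeft σ X.ε (Δ.map i j (incl 1 m)) = incl X.ε (σ (diff F i j m)) := by
  refine (map_eq_of_level_one _ _ _ (fun a ha => (X.socle a ha).2)
    (level_one_of_isBaseChange X.surjective h i j m)).trans ?_
  exact (tmulLeft_incl σ 1 X.ε _).trans (by rw [mul_one])

/-- The square of a graded homomorphism lifting `L` is `σ ⊗ ε` for a chain homomorphism `σ`; the
chain condition is `Δ Δ² = Δ² Δ`. -/
theorem exists_isObstruction (h : IsBaseChange X.π Δ L.toCHom) :
    ∃ σ ∈ chainHom k F (-2), IsObstruction X Δ σ := by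
  have h1 : ∀ i l, ∃ σ : F.X i →ₗ[R] F.X l, ∀ m,
      Δ.map (i - 1) l (Δ.map i (i - 1) (incl 1 m)) = incl X.ε (σ m) := fun i l =>
    X.exists_linearMap_incl_ε (Δ.map (i - 1) l ∘ₗ Δ.map i (i - 1) ∘ₗ incl 1) fun m => by
      rw [LinearMap.comp_apply, LinearMap.comp_apply, ← h, ← h, L.sq_zero]
  choose σ hσ using h1
  have hσ : IsObstruction X Δ σ := hσ
  refine ⟨σ, ⟨fun i j hij => LinearMap.ext fun m => X.incl_ε_injective (R := R) ?_, ?_⟩, hσ⟩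
  · rw [← hσ, Δ.shape (i - 1) j (by omega)]
    simp
  · change homDiff k F (-2) σ = 0
    funext i l
    refine LinearMap.ext fun m => X.incl_ε_injective (R := R) ?_
    -- The sign in the differential of a graded homomorphism of degree `-2` is `(-1)⁻¹ = -1`.
    change incl X.ε (σ (i - 1) l (diff F i (i - 1) m) +
      (-1 : ℤ) • (diff F (i + -2) l (σ i (i + -2) m))) = incl X.ε 0
    rw [map_zero, map_add, map_zsmul, neg_one_zsmul, ← tmulLeft_ε_map h, ← map_incl_ε h, ← hσ,
      ← hσ.sq_eq, show i + -2 = i - 1 - 1 by ring, add_neg_cancel]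

theorem isBaseChange_perturb (hΔ : IsBaseChange X.π Δ L.toCHom) (h : gradedHom k F (-1)) :
    IsBaseChange X.π (Δ.perturb h) L.toCHom :=
  isBaseChange_iff.2 fun i j m => by
    rw [CHom.perturb_incl_one, map_add, baseChange_incl, X.π_ε, incl_zero, add_zero,
      isBaseChange_iff.1 hΔ]

/-- Perturbing `Δ` by `h ⊗ ε` changes `σ` by the boundary of `h`. -/
theorem IsObstruction.perturb (hΔ : IsBaseChange X.π Δ L.toCHom) {σ : Family F}
    (hσ : IsObstruction X Δ σ) (h : gradedHom k F (-1)) :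
    IsObstruction X (Δ.perturb h) (σ + homDiff k F (-1) h.1) := by
  intro i l m
  have h1 : ∀ (i j : ℤ) x, (Δ.perturb h).map i j x = Δ.map i j x + tmulLeft (h.1 i j) X.ε x := by
    intro i j
    refine LinearMap.congr_fun (semilinear_ext_id (f := (Δ.perturb h).map i j)
      (g := Δ.map i j + tmulLeft (h.1 i j) X.ε) ((Δ.perturb h).map_rmul i j) ?_ ?_)
    · intro a x
      rw [LinearMap.add_apply, Δ.map_rmul, tmulLeft_rmul, LinearMap.add_apply, map_add]
    · intro m
      rw [CHom.perturb_incl_one, LinearMap.add_apply, tmulLeft_incl, mul_one]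
  have h2 : (σ + homDiff k F (-1) h.1) i l m = σ i l m + (h.1 (i - 1) l (diff F i (i - 1) m) +
      (1 : ℤ) • diff F (i + -1) l (h.1 i (i + -1) m)) := rfl
  rw [CHom.perturb_incl_one, map_add, h2,
    map_incl_ε (isBaseChange_perturb hΔ h), h1, hσ, tmulLeft_ε_map hΔ, one_zsmul, map_add, map_add,
    add_assoc]
  rfl

/-- Two graded homomorphisms lifting `L` to a small extension differ by a perturbation. -/
theorem exists_perturb {Δ' : CHom k F X.E (-1)} (hΔ : IsBaseChange X.π Δ L.toCHom)
    (hΔ' : IsBaseChange X.π Δ' L.toCHom) : ∃ h : gradedHom k F (-1), ∀ i j m,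
      Δ'.map i j (incl 1 m) = (Δ.perturb h).map i j (incl 1 m) := by
  have h1 : ∀ i j, ∃ σ : F.X i →ₗ[R] F.X j, ∀ m,
      (Δ'.map i j (incl 1 m) - Δ.map i j (incl 1 m)) = incl X.ε (σ m) := fun i j =>
    X.exists_linearMap_incl_ε (Δ'.map i j ∘ₗ incl 1 - Δ.map i j ∘ₗ incl 1) fun m => by
      rw [LinearMap.sub_apply, map_sub, LinearMap.comp_apply, LinearMap.comp_apply, ← hΔ, ← hΔ',
        sub_self]
  choose σ hσ using h1
  refine ⟨⟨σ, fun i j hij => LinearMap.ext fun m => X.incl_ε_injective (R := R) ?_⟩,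
    fun i j m => ?_⟩
  · rw [← hσ, Δ.shape i j hij, Δ'.shape i j hij]
    simp
  · rw [CHom.perturb_incl_one, ← hσ, add_sub_cancel]

/-- The homotopy class of `σ` does not depend on the choice of `Δ`. -/
theorem IsObstruction.sub_mem {Δ' : CHom k F X.E (-1)} (hΔ : IsBaseChange X.π Δ L.toCHom)
    (hΔ' : IsBaseChange X.π Δ' L.toCHom) {σ σ' : Family F} (hσ : IsObstruction X Δ σ)
    (hσ' : IsObstruction X Δ' σ') : σ' - σ ∈ nullHomotopic k F (-2) := by
  obtain ⟨h, hh⟩ := exists_perturb hΔ hΔ'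
  have : IsObstruction X Δ' (σ + homDiff k F (-1) h.1) := fun i l m => by
    rw [CHom.map_eq_of_incl_one (hh i (i - 1)), CHom.map_eq_of_incl_one (hh (i - 1) l)]
    exact hσ.perturb hΔ h i l m
  rw [hσ'.unique this, add_sub_cancel_left]
  exact mem_nullHomotopic_neg_two.2 ⟨h, rfl⟩

theorem exists_lift_of_isObstruction_zero (hΔ : IsBaseChange X.π Δ L.toCHom)
    (h0 : IsObstruction X Δ 0) : ∃ L' : Lift k F X.E, IsBaseChange X.π L'.toCHom L.toCHom := by
  refine ⟨Lift.ofCHom Δ (fun i j l m => ?_) fun i j m =>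
    level_one_of_isBaseChange X.surjective hΔ i j m, hΔ⟩
  -- The composite through `F_j` vanishes for degree reasons unless `j = i - 1`.
  by_cases hj : j = i + -1
  · obtain rfl : j = i - 1 := hj
    rw [h0 i l m]
    exact map_zero _
  · rw [Δ.shape i j hj, LinearMap.zero_apply, map_zero]

/-- If `σ` is null homotopic, the lift extends to the small extension. -/
theorem exists_lift_of_nullHomotopic (hΔ : IsBaseChange X.π Δ L.toCHom) {σ : Family F}
    (hσ : IsObstruction X Δ σ) (h0 : σ ∈ nullHomotopic k F (-2)) :
    ∃ L' : Lift k F X.E, IsBaseChange X.π L'.toCHom L.toCHom := by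
  obtain ⟨h, hh⟩ := mem_nullHomotopic_neg_two.1 h0
  have h2 := hσ.perturb hΔ (-h)
  rw [show (-h).1 = -h.1 from rfl, map_neg, hh, add_neg_cancel] at h2
  exact exists_lift_of_isObstruction_zero (isBaseChange_perturb hΔ (-h)) h2

end

/-- All obstructions of a lift in one small extension have the same class. -/
theorem exists_obstructionClass (L : Lift k F P) (X : SmallExtension k P) :
    ∃ c : ExtGroup k F 2, ∀ Δ : CHom k F X.E (-1), IsBaseChange X.π Δ L.toCHom →
      ∀ σ : chainHom k F (-2), IsObstruction X Δ σ → c = Submodule.Quotient.mk σ := by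
  by_cases h : ∃ Δ : CHom k F X.E (-1), IsBaseChange X.π Δ L.toCHom
  · obtain ⟨Δ, hΔ⟩ := h
    obtain ⟨σ, hσ, hσ'⟩ := exists_isObstruction hΔ
    refine ⟨Submodule.Quotient.mk ⟨σ, hσ⟩, fun Δ' hΔ' τ hτ => ?_⟩
    exact (Submodule.Quotient.eq _).2 (IsObstruction.sub_mem hΔ' hΔ hτ hσ')
  · exact ⟨0, fun Δ hΔ => (h ⟨Δ, hΔ⟩).elim⟩

/-- The obstruction class of the lift `L` in the small extension `X`. -/
noncomputable def obstructionClass (L : Lift k F P) (X : SmallExtension k P) : ExtGroup k F 2 :=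
  (exists_obstructionClass L X).choose

theorem obstructionClass_eq {L : Lift k F P} {X : SmallExtension k P} {Δ : CHom k F X.E (-1)}
    (hΔ : IsBaseChange X.π Δ L.toCHom) {σ : chainHom k F (-2)} (hσ : IsObstruction X Δ σ) :
    obstructionClass L X = Submodule.Quotient.mk σ :=
  (exists_obstructionClass L X).choose_spec Δ hΔ σ hσ

/-- Naturality of the obstruction class: a complete local algebra `B` over `P` mapping to three
small extensions transports a linear relation between the induced functionals on the kernel of
`B → P` to the obstruction classes. The proof lifts the differential to `B` and pushes it forward
to the three small extensions. -/
theorem obstructionClass_relation (hF : ∀ i : ℤ, Module.Projective R (F.X i)) (L : Lift k F P)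
    {X Y Z : SmallExtension k P} {B : Type u} [Ring B] [Algebra k B] [IsCompleteLocal k B]
    (p : B →ₐ[k] P) (hp : Function.Surjective p)
    (gX : B →ₐ[k] X.E) (gY : B →ₐ[k] Y.E) (gZ : B →ₐ[k] Z.E)
    (hX : ∀ b, X.π (gX b) = p b) (hY : ∀ b, Y.π (gY b) = p b) (hZ : ∀ b, Z.π (gZ b) = p b)
    (c d : k) (h : ∀ b, p b = 0 → ∃ s t : k, gX b = s • X.ε ∧ gY b = t • Y.ε ∧
      gZ b = (c * s + d * t) • Z.ε) :
    obstructionClass L Z = c • obstructionClass L X + d • obstructionClass L Y := by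
  obtain ⟨Δ, hΔ⟩ := CHom.exists_isBaseChange hF p hp L.toCHom
  have key : ∀ (W : SmallExtension k P) (g : B →ₐ[k] W.E), (∀ b, W.π (g b) = p b) →
      ∃ σ : chainHom k F (-2), obstructionClass L W = Submodule.Quotient.mk σ ∧ ∀ i l m,
        baseChange g (Δ.map (i - 1) l (Δ.map i (i - 1) (incl 1 m))) = incl W.ε (σ.1 i l m) := by
    intro W g hW
    have h1 := CHom.isBaseChange_push g Δ
    obtain rfl : p = W.π.comp g := AlgHom.ext fun b => (hW b).symm
    obtain ⟨σ, hσ, hσ'⟩ := exists_isObstruction (h1.of_comp hΔ)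
    refine ⟨⟨σ, hσ⟩, obstructionClass_eq (h1.of_comp hΔ) hσ', fun i l m => ?_⟩
    rw [← hσ' i l m, isBaseChange_iff.1 h1, h1]
  obtain ⟨σX, eX, hσX⟩ := key X gX hX
  obtain ⟨σY, eY, hσY⟩ := key Y gY hY
  obtain ⟨σZ, eZ, hσZ⟩ := key Z gZ hZ
  have : σZ = c • σX + d • σY := by
    refine Subtype.ext (funext fun i => funext fun l => LinearMap.ext fun m => ?_)
    refine SmallExtension.coeff_relation p hp gX gY gZ c d h (R := R) ?_ (hσX i l m) (hσY i l m)
      (hσZ i l m)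
    rw [← hΔ, ← hΔ, L.sq_zero]
  rw [eX, eY, eZ, this]
  rfl

theorem obstructionClass_congr (hF : ∀ i : ℤ, Module.Projective R (F.X i)) (L : Lift k F P)
    {X Y : SmallExtension k P} (h : X ≈ Y) : obstructionClass L X = obstructionClass L Y := by
  obtain ⟨f, hf, hf'⟩ := h
  have := obstructionClass_relation hF L X.π X.surjective (AlgHom.id k X.E) (AlgHom.id k X.E)
    (f : X.E →ₐ[k] Y.E) (fun _ => rfl) (fun _ => rfl) hf 1 0 fun b hb => by
      obtain ⟨s, rfl⟩ := (X.ker_eq b).1 hb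
      refine ⟨s, s, rfl, rfl, ?_⟩
      rw [one_mul, zero_mul, add_zero, ← hf']
      exact map_smul f s X.ε
  rw [this, one_smul, zero_smul, add_zero]

theorem obstructionClass_smul (hF : ∀ i : ℤ, Module.Projective R (F.X i)) (L : Lift k F P) (c : k)
    (X : SmallExtension k P) :
    obstructionClass L (SmallExtension.smul c X) = c • obstructionClass L X := by
  obtain ⟨g, hg, hg'⟩ := SmallExtension.exists_smulMap c X
  have := obstructionClass_relation hF L X.π X.surjective (AlgHom.id k X.E) (AlgHom.id k X.E)
    g (fun _ => rfl) (fun _ => rfl) hg c 0 fun b hb => by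
      obtain ⟨s, rfl⟩ := (X.ker_eq b).1 hb
      refine ⟨s, s, rfl, rfl, ?_⟩
      rw [zero_mul, add_zero, hg', mul_comm]
  rw [this, zero_smul, add_zero]

/-- The fibre product of two small extensions is a small extension of the first one, hence complete
local. -/
theorem SmallExtension.isCompleteLocal_fib (X Y : SmallExtension k P) :
    IsCompleteLocal k (Fib X.π Y.π) := by
  refine isCompleteLocal_of_extension (Fib.fst X.π Y.π)
    (fun x => by
      obtain ⟨y, hy⟩ := Y.surjective (X.π x)
      exact ⟨⟨(x, y), hy.symm⟩, rfl⟩)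
    ⟨(0, Y.ε), by simp [AlgHom.mem_equalizer, Y.π_ε]⟩ ?_ ?_ rfl ?_
  · intro b hb
    have h1 : b.1.1 = 0 := hb
    obtain ⟨d, hd⟩ := (Y.ker_eq b.1.2).1 (by rw [← Fib.condition, h1, map_zero])
    exact ⟨d, Subtype.ext (Prod.ext (by simp [h1]) (by simp [hd]))⟩
  · intro b hb
    have h1 : residue k P (Y.π b.1.2) = 0 := by
      rw [← Fib.condition, residue_map k X.π]
      exact hb
    exact ⟨Subtype.ext (Prod.ext (mul_zero _) (Y.socle' h1).1),
      Subtype.ext (Prod.ext (zero_mul _) (Y.socle' h1).2)⟩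
  · intro hrad
    obtain ⟨n, hn⟩ := Y.exists_ε_notMem
    refine ⟨n, fun h => hn ?_⟩
    have key : ∀ n, ∀ b ∈ rad (Fib X.π Y.π) ^ n, b.1.2 ∈ rad Y.E ^ n := by
      intro n
      induction n with
      | zero => intro b _; simp [Submodule.pow_zero]
      | succ n ih =>
        intro b hb
        rw [Submodule.pow_succ] at hb
        induction hb using Submodule.mul_induction_on' with
        | mem_mul_mem a ha b hb =>
          refine mul_mem_rad_pow_succ (ih a ha) ?_
          rw [hrad] at hb
          have hb' : residue k X.E b.1.1 = 0 := hb
          rw [mem_rad_iff k, ← residue_map k Y.π, ← Fib.condition, residue_map k X.π, hb']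
        | add a _ b _ ha hb => exact add_mem ha hb
    exact key n _ h

theorem obstructionClass_add (hF : ∀ i : ℤ, Module.Projective R (F.X i)) (L : Lift k F P)
    (X Y : SmallExtension k P) :
    obstructionClass L (X.add Y) = obstructionClass L X + obstructionClass L Y := by
  have := X.isCompleteLocal_fib Y
  obtain ⟨g, hg, hg'⟩ := SmallExtension.exists_addMap X Y
  have := obstructionClass_relation hF L (X.π.comp (Fib.fst X.π Y.π))
    (SmallExtension.fib_surjective X Y) (Fib.fst X.π Y.π) (Fib.snd X.π Y.π) g (fun _ => rfl)
    (fun b => (Fib.condition _ _ b).symm) hg 1 1 fun b hb => by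
      obtain ⟨s, t, hs, ht⟩ := SmallExtension.fib_ker X Y b hb
      exact ⟨s, t, hs, ht, by rw [one_mul, one_mul]; exact hg' b s t hs ht⟩
  rw [this, one_smul, one_smul]

/-- The obstruction map of a lift. -/
noncomputable def obstructionMap (hF : ∀ i : ℤ, Module.Projective R (F.X i)) (L : Lift k F P) :
    SmallExtClass k P →ₗ[k] ExtGroup k F 2 where
  toFun := Quotient.lift (obstructionClass L) fun _ _ h => obstructionClass_congr hF L h
  map_add' := by rintro ⟨X⟩ ⟨Y⟩; exact obstructionClass_add hF L X Y
  map_smul' := by rintro c ⟨X⟩; exact obstructionClass_smul hF L c X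

theorem isObstructionMap_obstructionMap (hF : ∀ i : ℤ, Module.Projective R (F.X i))
    (L : Lift k F P) : IsObstructionMap L (obstructionMap hF L) := by
  refine fun X => ⟨CHom.exists_isBaseChange hF X.π X.surjective L.toCHom, fun Δ hΔ => ?_⟩
  obtain ⟨σ, hσ, hσ'⟩ := exists_isObstruction hΔ
  exact ⟨⟨σ, hσ⟩, hσ'.sq_eq, obstructionClass_eq (σ := ⟨σ, hσ⟩) hΔ hσ'⟩

/-- A lift extends to every small extension in which its obstruction class vanishes. -/
theorem exists_lift_of_obstructionClass_eq_zero (hF : ∀ i : ℤ, Module.Projective R (F.X i))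
    (L : Lift k F P) (X : SmallExtension k P) (h : obstructionClass L X = 0) :
    ∃ L' : Lift k F X.E, IsBaseChange X.π L'.toCHom L.toCHom := by
  obtain ⟨Δ, hΔ⟩ := CHom.exists_isBaseChange hF X.π X.surjective L.toCHom
  obtain ⟨σ, hσ, hσ'⟩ := exists_isObstruction hΔ
  rw [obstructionClass_eq (σ := ⟨σ, hσ⟩) hΔ hσ', Submodule.Quotient.mk_eq_zero] at h
  exact exists_lift_of_nullHomotopic hΔ hσ' h

end Obstruction

/-! ### Split small extensions -/

section Split

variable {k P : Type u} [Field k] [Ring P] [Algebra k P] [IsCompleteLocal k P]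

namespace SmallExtension

theorem equiv_trivial_of_section (X : SmallExtension k P) (g : P →ₐ[k] X.E)
    (hg : ∀ x, X.π (g x) = x) : X ≈ trivial k P := by
  obtain ⟨z, hz⟩ := exists_trivialMap (k := k) (P := P)
  exact equivalent_of_common (AlgHom.id k P) (fun x => ⟨x, rfl⟩) g z hg hz fun b hb =>
    ⟨0, by rw [show b = 0 from hb, map_zero, zero_smul],
      by rw [show b = 0 from hb, map_zero, zero_smul]⟩

/-- A small extension whose socle element is not in the square of the radical is trivial: for a
functional `l` with `l(ε) = 1` which vanishes on `𝔪²` and at `1`, the map `x ↦ x - l(x) ε` is an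
algebra endomorphism which kills `ε`. -/
theorem equiv_trivial_of_ε_notMem (X : SmallExtension k P) (h : X.ε ∉ rad X.E ^ 2) :
    X ≈ trivial k P := by
  obtain ⟨l₀, hl₀, hl₀'⟩ := exists_functional_of_notMem k h
  obtain ⟨l, hl⟩ : ∃ l : X.E →ₗ[k] k, ∀ x, l x = l₀ x - residue k X.E x * l₀ 1 :=
    ⟨l₀ - (l₀ 1) • (residue k X.E).toLinearMap, fun x => by simp [mul_comm]⟩
  have hresε : residue k X.E X.ε = 0 := by rw [← residue_map k X.π, X.π_ε, map_zero]
  have hlε : l X.ε = 1 := by rw [hl, hl₀, hresε, zero_mul, sub_zero]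
  have hl1 : l 1 = 0 := by rw [hl, map_one (residue k X.E), one_mul, sub_self]
  -- The functional `l` is a derivation along the residue map.
  have hder : ∀ x y, l (x * y) = residue k X.E x * l y + l x * residue k X.E y := by
    intro x y
    have h1 : (x - algebraMap k X.E (residue k X.E x)) *
        (y - algebraMap k X.E (residue k X.E y)) ∈ rad X.E ^ 2 := by
      rw [Submodule.pow_succ, Submodule.pow_one]
      exact Ideal.mul_mem_mul (sub_residue_mem k x) (sub_residue_mem k y)
    have h2 := hl₀' _ h1
    have h3 : (x - algebraMap k X.E (residue k X.E x)) *
        (y - algebraMap k X.E (residue k X.E y)) =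
        x * y - residue k X.E x • y - residue k X.E y • x +
          (residue k X.E x * residue k X.E y) • 1 := by
      rw [sub_mul, mul_sub, mul_sub, ← Algebra.smul_def, ← Algebra.commutes, ← Algebra.smul_def,
        ← map_mul, Algebra.algebraMap_eq_smul_one]
      abel
    rw [h3] at h2
    simp only [map_add, map_sub, map_smul, smul_eq_mul] at h2
    rw [hl, hl, hl, map_mul (residue k X.E)]
    linear_combination h2
  let r : X.E →ₐ[k] X.E := AlgHom.ofLinearMap (LinearMap.id - l.smulRight X.ε)
    (by simp [hl1])
    (fun x y => by
      simp only [LinearMap.sub_apply, LinearMap.id_apply, LinearMap.smulRight_apply, sub_mul,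
        mul_sub, smul_mul_assoc, mul_smul_comm, X.mul_ε, X.ε_mul, residue_map k X.π,
        hder, add_smul, smul_smul, map_sub, map_smul, hresε, smul_zero, sub_zero]
      rw [mul_comm (l y)]
      abel)
  have hr : ∀ x, r x = x - l x • X.ε := fun _ => rfl
  obtain ⟨z, hz⟩ := exists_trivialMap (k := k) (P := P)
  refine equivalent_of_common X.π X.surjective r (z.comp X.π) (fun x => ?_) (fun x => hz _)
    fun x hx => ⟨0, ?_, ?_⟩
  · rw [hr, map_sub, map_smul, X.π_ε, smul_zero, sub_zero]
  · obtain ⟨c, rfl⟩ := (X.ker_eq x).1 hx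
    rw [hr, map_smul, hlε, smul_eq_mul, mul_one, sub_self, zero_smul]
  · rw [AlgHom.comp_apply, hx, map_zero, zero_smul]

end SmallExtension

end Split

/-! ### Artinian quotients -/

section Quotients

variable (k A : Type*) [Field k] [Ring A] [Algebra k A]

/-- The algebra `A / 𝔪_Aⁿ⁺¹`; the shift keeps it nonzero. -/
abbrev RadQuot (n : ℕ) : Type _ := A ⧸ (rad A ^ (n + 1))

/-- The projection `A → A / 𝔪_Aⁿ⁺¹`. -/
abbrev RadQuot.mk (n : ℕ) : A →ₐ[k] RadQuot A n := Ideal.Quotient.mkₐ k (rad A ^ (n + 1))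

theorem RadQuot.mk_eq_mk {k A : Type*} [Field k] [Ring A] [Algebra k A] {n : ℕ} {x y : A} :
    RadQuot.mk k A n x = RadQuot.mk k A n y ↔ x - y ∈ rad A ^ (n + 1) := Ideal.Quotient.eq

variable [IsCompleteLocal k A]

/-- Each `𝔪_Aⁿ / 𝔪_Aⁿ⁺¹` is finite-dimensional. -/
theorem exists_fg_rad_pow (n : ℕ) : ∃ V : Submodule k A, V.FG ∧
    ∀ x ∈ rad A ^ n, ∃ v ∈ V, x - v ∈ rad A ^ (n + 1) := by
  induction n with
  | zero =>
    refine ⟨Submodule.span k {1}, ⟨{1}, by simp⟩, fun x _ =>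
      ⟨residue k A x • 1, Submodule.smul_mem _ _ (Submodule.mem_span_singleton_self _), ?_⟩⟩
    rw [zero_add, Submodule.pow_one, ← Algebra.algebraMap_eq_smul_one]
    exact sub_residue_mem k x
  | succ n ih =>
    obtain ⟨V, hV, h⟩ := ih
    obtain ⟨W, hW, h'⟩ := (finite_cotangent_iff k).1
      (IsCompleteLocal.finite_cotangent : Module.Finite k (rad A ⧸ _))
    refine ⟨V * W, hV.mul hW, fun x hx => ?_⟩
    rw [Submodule.pow_succ] at hx
    induction hx using Submodule.mul_induction_on' with
    | mem_mul_mem a ha b hb =>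
      obtain ⟨v, hv, hv'⟩ := h a ha
      obtain ⟨w, hw, hw'⟩ := h' b hb
      refine ⟨v * w, Submodule.mul_mem_mul hv hw, ?_⟩
      have h1 : (a - v) * w ∈ rad A ^ (n + 1 + 1) := by
        have hwr : w ∈ rad A := by
          have := sub_mem hb ((Ideal.pow_le_self two_ne_zero : rad A ^ 2 ≤ rad A) hw')
          simpa using this
        exact mul_mem_rad_pow_succ hv' hwr
      have h2 : a * (b - w) ∈ rad A ^ (n + 2) := mul_mem_rad_pow_add ha hw'
      have := add_mem h1 h2
      convert! this using 1
      rw [sub_mul, mul_sub]; abel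
    | add a _ b _ ha hb =>
      obtain ⟨v, hv, hv'⟩ := ha
      obtain ⟨w, hw, hw'⟩ := hb
      exact ⟨v + w, add_mem hv hw, by rw [add_sub_add_comm]; exact add_mem hv' hw'⟩

theorem exists_fg_sub_mem_rad_pow (n : ℕ) : ∃ V : Submodule k A, V.FG ∧
    ∀ x, ∃ v ∈ V, x - v ∈ rad A ^ n := by
  induction n with
  | zero => exact ⟨⊥, Submodule.fg_bot, fun x => ⟨0, zero_mem _, by simp [Submodule.pow_zero]⟩⟩
  | succ n ih =>
    obtain ⟨V, hV, h⟩ := ih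
    obtain ⟨W, hW, h'⟩ := exists_fg_rad_pow k A n
    refine ⟨V ⊔ W, hV.sup hW, fun x => ?_⟩
    obtain ⟨v, hv, hv'⟩ := h x
    obtain ⟨w, hw, hw'⟩ := h' _ hv'
    exact ⟨v + w, Submodule.add_mem_sup hv hw, by rwa [← sub_sub]⟩

theorem finite_radQuot (n : ℕ) : Module.Finite k (RadQuot A n) := by
  obtain ⟨V, hV, h⟩ := exists_fg_sub_mem_rad_pow k A (n + 1)
  have : Module.Finite k V := Module.Finite.iff_fg.2 hV
  refine Module.Finite.of_surjective
    ((Ideal.Quotient.mkₐ k (rad A ^ (n + 1))).toLinearMap ∘ₗ V.subtype) fun y => ?_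
  obtain ⟨x, rfl⟩ := Ideal.Quotient.mkₐ_surjective k _ y
  obtain ⟨v, hv, hv'⟩ := h x
  exact ⟨⟨v, hv⟩, ((Ideal.Quotient.eq).2 hv').symm⟩

theorem isCompleteLocal_radQuot (n : ℕ) : IsCompleteLocal k (RadQuot A n) := by
  let q := Ideal.Quotient.mkₐ k (rad A ^ (n + 1))
  have hq : Function.Surjective q := Ideal.Quotient.mkₐ_surjective k _
  let χ : RadQuot A n →ₐ[k] k := Ideal.Quotient.liftₐ (rad A ^ (n + 1)) (residue k A) fun a ha =>
    (mem_rad_iff k a).1 (Ideal.pow_le_self (Nat.succ_ne_zero n) ha)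
  have hu : ∀ x, χ x = 0 → IsUnit (1 + x) := by
    intro x hx
    obtain ⟨a, rfl⟩ := hq x
    rw [← map_one q, ← map_add]
    exact (isUnit_one_add k ((mem_rad_iff k a).2 hx)).map q
  have hrad := rad_eq_ker k χ hu
  -- Powers of the radical of the quotient are images of powers of `𝔪_A`, so it is nilpotent.
  have hpow : ∀ m, ∀ x ∈ rad (RadQuot A n) ^ m, ∃ a ∈ rad A ^ m, q a = x := by
    intro m
    induction m with
    | zero => intro x _; obtain ⟨a, ha⟩ := hq x; exact ⟨a, by simp [Submodule.pow_zero], ha⟩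
    | succ m ih =>
      intro x hx
      replace hx : x ∈ rad (RadQuot A n) ^ m * rad (RadQuot A n) := by
        rwa [← Submodule.pow_succ]
      induction hx using Submodule.mul_induction_on' with
      | mem_mul_mem x hx y hy =>
        obtain ⟨a, ha, rfl⟩ := ih x hx
        obtain ⟨b, rfl⟩ := hq y
        rw [hrad] at hy
        exact ⟨a * b, mul_mem_rad_pow_succ ha ((mem_rad_iff k b).2 hy), map_mul _ _ _⟩
      | add x _ y _ hx hy =>
        obtain ⟨a, ha, rfl⟩ := hx
        obtain ⟨b, hb, rfl⟩ := hy
        exact ⟨a + b, add_mem ha hb, map_add _ _ _⟩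
  have hnil : ∀ m, n + 1 ≤ m → ∀ x ∈ rad (RadQuot A n) ^ m, x = 0 := by
    intro m hm x hx
    obtain ⟨a, ha, rfl⟩ := hpow m x hx
    exact Ideal.Quotient.eq_zero_iff_mem.2 (Ideal.pow_le_pow_right hm ha)
  refine ⟨isLocalRing_of_character k χ hu, residue_bijective_of_character k χ hrad, ?_, ?_, ?_⟩
  · have := finite_radQuot k A n
    exact (finite_cotangent_iff k).2 ⟨⊤, Module.finite_def.1 this, fun x _ =>
      ⟨x, Submodule.mem_top, by simp⟩⟩
  · exact fun x hx => hnil (n + 1) le_rfl x (hx _)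
  · intro s hs
    have hconst : ∀ m, n + 1 ≤ m → s m = s (n + 1) := by
      intro m hm
      induction m, hm using Nat.le_induction with
      | base => rfl
      | succ m hm ih => rw [← ih, ← sub_eq_zero]; exact hnil m hm _ (hs m)
    have hsum : ∀ m d, s (m + d) - s m ∈ rad (RadQuot A n) ^ m := by
      intro m d
      induction d with
      | zero => simp
      | succ d ih =>
        have := add_mem (Ideal.pow_le_pow_right (Nat.le_add_right m d) (hs (m + d))) ih
        convert! this using 1
        rw [← add_assoc]; abel
    refine ⟨s (n + 1), fun m => ?_⟩
    rw [← hconst (m + (n + 1)) (Nat.le_add_left _ _)]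
    exact hsum m _

variable {k A}

theorem eq_of_forall_mk_eq {x y : A} (h : ∀ n, RadQuot.mk k A n x = RadQuot.mk k A n y) :
    x = y := by
  refine sub_eq_zero.1 (IsCompleteLocal.separated (k := k) _ fun n => ?_)
  exact Ideal.pow_le_pow_right (Nat.le_succ n) (RadQuot.mk_eq_mk.1 (h n))

variable (k A) in
/-- The projection `A / 𝔪_Aⁿ⁺² → A / 𝔪_Aⁿ⁺¹`. -/
def RadQuot.trans (n : ℕ) : RadQuot A (n + 1) →ₐ[k] RadQuot A n :=
  Ideal.Quotient.liftₐ (rad A ^ (n + 1 + 1)) (RadQuot.mk k A n) fun _ ha =>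
    Ideal.Quotient.eq_zero_iff_mem.2 (Ideal.pow_le_pow_right (Nat.le_succ _) ha)

/-- The homomorphism `A / 𝔪_Aⁿ⁺¹ → B / 𝔪_Bⁿ⁺¹` induced by a homomorphism `A → B`. -/
def RadQuot.map {B : Type*} [Ring B] [Algebra k B] [IsCompleteLocal k B] (f : A →ₐ[k] B) (n : ℕ) :
    RadQuot A n →ₐ[k] RadQuot B n :=
  Ideal.Quotient.liftₐ (rad A ^ (n + 1)) ((RadQuot.mk k B n).comp f) fun _ ha =>
    Ideal.Quotient.eq_zero_iff_mem.2 (map_mem_rad_pow k f _ ha)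

theorem RadQuot.map_comp_mk {B : Type*} [Ring B] [Algebra k B] [IsCompleteLocal k B]
    (f : A →ₐ[k] B) (n : ℕ) :
    (RadQuot.map f n).comp (RadQuot.mk k A n) = (RadQuot.mk k B n).comp f := rfl

/-- A compatible system of homomorphisms `P → A / 𝔪_Aⁿ⁺¹` comes from a homomorphism `P → A`. -/
theorem exists_algHom_of_compatible {P : Type*} [Ring P] [Algebra k P]
    (f : ∀ n, P →ₐ[k] RadQuot A n) (hf : ∀ n, (RadQuot.trans k A n).comp (f (n + 1)) = f n) :
    ∃ g : P →ₐ[k] A, ∀ n, (RadQuot.mk k A n).comp g = f n := by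
  have h : ∀ x, ∃ y : A, ∀ n, RadQuot.mk k A n y = f n x := by
    intro x
    choose s hs using fun n => Ideal.Quotient.mkₐ_surjective k (rad A ^ (n + 1)) (f n x)
    have hss : ∀ n, RadQuot.mk k A n (s (n + 1)) = f n x := fun n => by
      rw [← hf n, AlgHom.comp_apply, ← hs (n + 1)]; rfl
    obtain ⟨y, hy⟩ := IsCompleteLocal.complete k s fun n =>
      Ideal.pow_le_pow_right (Nat.le_succ n) (RadQuot.mk_eq_mk.1 ((hss n).trans (hs n).symm))
    exact ⟨y, fun n => by rw [← hss n]; exact RadQuot.mk_eq_mk.2 (hy (n + 1))⟩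
  choose g hg using h
  refine ⟨AlgHom.ofLinearMap
    { toFun := g
      map_add' := fun x y => eq_of_forall_mk_eq (k := k) fun n => by
        rw [map_add, hg, hg, hg, map_add]
      map_smul' := fun c x => eq_of_forall_mk_eq (k := k) fun n => by
        rw [RingHom.id_apply, map_smul, hg, hg, map_smul] }
    (eq_of_forall_mk_eq (k := k) fun n => by
      change RadQuot.mk k A n (g 1) = _
      rw [hg, map_one, map_one])
    (fun x y => eq_of_forall_mk_eq (k := k) fun n => by
      change RadQuot.mk k A n (g (x * y)) = RadQuot.mk k A n (g x * g y)
      rw [map_mul, hg, hg, hg, map_mul]), fun n => AlgHom.ext fun x => hg x n⟩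

end Quotients

/-! ### Universal and maximal lifts -/

section Main

variable {k : Type u} {R : Type v} [Field k] [Ring R] [Algebra k R]
  {F : ChainComplex (ModuleCat.{w} R) ℤ} {P : Type u} [Ring P] [Algebra k P] [IsCompleteLocal k P]

/-- If `ε ∈ 𝔪_E²`, maximality would make `E → P` injective, although it kills `ε ≠ 0`. -/
theorem Lift.IsMaximal.equiv_trivial {L : Lift k F P} (hL : L.IsMaximal) (X : SmallExtension k P)
    (hX : ∃ L' : Lift k F X.E, IsBaseChange X.π L'.toCHom L.toCHom) :
    X ≈ SmallExtension.trivial k P := by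
  refine X.equiv_trivial_of_ε_notMem fun hε => X.ε_ne_zero ?_
  refine hL X.E X.π X.surjective (fun x hx => ?_) hX (X.π_ε.trans (map_zero _).symm)
  obtain ⟨c, rfl⟩ := (X.ker_eq x).1 hx
  exact algebra_smul_mem k c hε

/-- The homomorphism `g` classifies the lift `M`: base change of `L` along `g` is isomorphic to
`M`. -/
def Lift.Classifies (L : Lift k F P) {B : Type u} [Ring B] [Algebra k B] [IsCompleteLocal k B]
    (g : P →ₐ[k] B) (M : Lift k F B) : Prop :=
  ∃ M' : Lift k F B, IsBaseChange g L.toCHom M'.toCHom ∧ M'.IsIso M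

theorem Lift.Classifies.comp {L : Lift k F P} {B : Type u} [Ring B] [Algebra k B]
    [IsCompleteLocal k B] {g : P →ₐ[k] B} {M : Lift k F B} (h : L.Classifies g M) {C : Type u}
    [Ring C] [Algebra k C] [IsCompleteLocal k C] {t : B →ₐ[k] C} {N : Lift k F C}
    (hN : IsBaseChange t M.toCHom N.toCHom) : L.Classifies (t.comp g) N := by
  obtain ⟨M', h1, h2⟩ := h
  exact ⟨M'.push t, h1.comp (M'.isBaseChange_push t),
    h2.of_isBaseChange t (M'.isBaseChange_push t) hN⟩

theorem Lift.IsUniversal.eq_of_classifies {L : Lift k F P} (hL : L.IsUniversal) {B : Type u}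
    [Ring B] [Algebra k B] [IsCompleteLocal k B] [Module.Finite k B] {M : Lift k F B}
    {g₁ g₂ : P →ₐ[k] B} (h₁ : L.Classifies g₁ M) (h₂ : L.Classifies g₂ M) : g₁ = g₂ :=
  (hL B M).unique h₁ h₂

/-- A universal lift that extends along `π : E → P` yields a section of `π`: the extended lift is
classified modulo each power of `𝔪_E`, and the classifying homomorphisms `P → E / 𝔪_Eⁿ⁺¹` are
compatible and lift the projections `P → P / 𝔪_Pⁿ⁺¹` by uniqueness. -/
theorem Lift.IsUniversal.exists_section {L : Lift k F P} (hL : L.IsUniversal) {E : Type u} [Ring E]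
    [Algebra k E] [IsCompleteLocal k E] (π : E →ₐ[k] P) (L' : Lift k F E)
    (hL' : IsBaseChange π L'.toCHom L.toCHom) : ∃ g : P →ₐ[k] E, ∀ x, π (g x) = x := by
  have := isCompleteLocal_radQuot k E
  have := isCompleteLocal_radQuot k P
  have := finite_radQuot k E
  have := finite_radQuot k P
  have hex : ∀ n, ∃ f : P →ₐ[k] RadQuot E n, L.Classifies f (L'.push (RadQuot.mk k E n)) :=
    fun n => (hL (RadQuot E n) (L'.push (RadQuot.mk k E n))).exists
  choose f hf using hex
  obtain ⟨g, hg⟩ := exists_algHom_of_compatible f fun n =>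
    hL.eq_of_classifies ((hf (n + 1)).comp (t := RadQuot.trans k E n)
      ((L'.isBaseChange_push (RadQuot.mk k E (n + 1))).of_comp
        (L'.isBaseChange_push (RadQuot.mk k E n)))) (hf n)
  have key : ∀ n, (RadQuot.mk k P n).comp (π.comp g) = RadQuot.mk k P n := by
    intro n
    have h0 : IsBaseChange ((RadQuot.map π n).comp (RadQuot.mk k E n)) L'.toCHom
        (L.push (RadQuot.mk k P n)).toCHom := by
      rw [RadQuot.map_comp_mk]
      exact hL'.comp (L.isBaseChange_push (RadQuot.mk k P n))
    have h1 : L.Classifies ((RadQuot.map π n).comp (f n)) (L.push (RadQuot.mk k P n)) :=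
      (hf n).comp ((L'.isBaseChange_push (RadQuot.mk k E n)).of_comp h0)
    have h2 : L.Classifies (RadQuot.mk k P n) (L.push (RadQuot.mk k P n)) :=
      ⟨_, L.isBaseChange_push (RadQuot.mk k P n), Lift.IsIso.refl _⟩
    rw [← AlgHom.comp_assoc, ← RadQuot.map_comp_mk, AlgHom.comp_assoc, hg]
    exact hL.eq_of_classifies h1 h2
  exact ⟨g, fun x => eq_of_forall_mk_eq fun n => AlgHom.congr_fun (key n) x⟩

end Main

end ComplexLift

theorem mainTheorem3 {k : Type u} {R : Type v} [Field k] [Ring R] [Algebra k R]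
    (F : ChainComplex (ModuleCat.{w} R) ℤ) (hF : ∀ i : ℤ, Module.Projective R (F.X i))
    {P₀ : Type u} [Ring P₀] [Algebra k P₀] [ComplexLift.IsCompleteLocal k P₀]
    (L₀ : ComplexLift.Lift k F P₀) (hL₀ : L₀.IsUniversal ∨ L₀.IsMaximal) :
    ∃ α : ComplexLift.SmallExtClass k P₀ →ₗ[k] ComplexLift.ExtGroup k F 2,
      ComplexLift.IsObstructionMap L₀ α ∧ Function.Injective α := by
  refine ⟨ComplexLift.obstructionMap hF L₀, ComplexLift.isObstructionMap_obstructionMap hF L₀,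
    (injective_iff_map_eq_zero _).2 ?_⟩
  rintro ⟨X⟩ hX
  obtain ⟨L', hL'⟩ := ComplexLift.exists_lift_of_obstructionClass_eq_zero hF L₀ X hX
  refine Quotient.sound ?_
  rcases hL₀ with hL₀ | hL₀
  · obtain ⟨g, hg⟩ := hL₀.exists_section X.π L' hL'
    exact X.equiv_trivial_of_section g hg
  · exact hL₀.equiv_trivial X ⟨L', hL'⟩
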